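/- Let $\mathcal X,\mathcal Y$ be finite alphabets, $Q$ a probability distribution on $\mathcal X$, $W(y|x)$ a transition law from $\mathcal X$ to $\mathcal Y$ (used memorylessly, $W^n(\mathbf y|\mathbf x)=\prod_i W(y_i|x_i)$), and $q:\mathcal X\times\mathcal Y\to[0,\infty)$ a decoding metric. A message uniform on $\{1,\dots,M\}$ is sent with a codebook $\mathbf x^{(1)},\dots,\mathbf x^{(M)}\in\mathcal X^n$; the decoder outputs a maximizer of $j\mapsto q^n(\mathbf x^{(j)},\mathbf y)=\prod_i q(x^{(j)}_i,y_i)$, ties being broken uniformly at random. For a codeword distribution $P_{\mathbf X}$ on $\mathcal X^n$, $\bar p_e(n,M)$ denotes the error probability averaged over codebooks of $M$ independent codewords drawn from $P_{\mathbf X}$. Fix a rate $R>0$, and read $M=e^{nR}$ as $e^{nR}$ rounded up or down to an integer. Let $a_1,\dots,a_L:\mathcal X\to\mathbb R$ ($L\ge 0$), $\phi_l=\mathbb E_Q[a_l(X)]$, $\delta>0$. The cost-constrained ensemble has $$P_{\mathbf X}(\mathbf x)=\frac1{\mu_n}\prod_{i=1}^n Q(x_i)\,\mathbf 1\{\mathbf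 x\in\mathcal D_n\},\qquad \mathcal D_n=\Big\{\mathbf x:\Big|\frac1n\sum_{i=1}^n a_l(x_i)-\phi_l\Big|\le\frac{\delta}{n},\ l=1,\dots,L\Big\},$$ with $\mu_n$ the normalizing constant. Assume that $\delta$ is such that $\mu_n=\Omega(n^{-L'/2})$, where $L'\le L$ is the rank of the covariance matrix of $(a_1(X),\dots,a_L(X))$, $X\sim Q$ (so $L'=L$ if that matrix is nonsingular). With the conventions $\log 0=-\infty$, $0\cdot(-\infty)=0$, let $\mathcal S$ be the set of all probability distributions $P_{XY}$ on $\mathcal X\times\mathcal Y$ with $\mathbb E_P[a_l(X)]=\phi_l$ for all $l$, and let $\mathcal T(P_{XY})$ be the set of all $\widetilde P_{XY}$ with $\mathbb E_{\widetilde P}[a_l(X)]=\phi_l$ for all $l$, $\widetilde P_Y=P_Y$ and $\mathbb E_{\widetilde P}[\log q(X,Y)]\ge\mathbb E_P[\log q(X,Y)]$. Then $$\lim_{n\to\infty}-\frac1n\log\bar p_e(n,e^{nR})=E_{\mathrm r}^{\mathrm{cost}}(Q,R,\{a_l\}):=\min_{P_{XY}\in\mathcal S}\ \min_{\widetilde P_{XY}\in\mathcal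 T(P_{XY})}D(P_{XY}\|Q\times W)+\big[D(\widetilde P_{XY}\|Q\times P_Y)-R\big]^+ ,$$ where both minima are attained and the value is finite. In particular: 1. (i.i.d. ensemble, $L=0$, $P_{\mathbf X}=\prod_i Q(x_i)$.) The limit equals the same double minimum without the constraints on $\mathbb E_P[a_l]$ and $\mathbb E_{\widetilde P}[a_l]$. 2. (Constant composition.) For the indicator costs $a_x=\mathbf 1\{\cdot=x\}$, $x\in\mathcal X$, $E_{\mathrm r}^{\mathrm{cost}}$ equals Csiszár's exponent $$E_{\mathrm r}^{\mathrm{cc}}(Q,R)=\min_{P_{XY}:\,P_X=Q}\ \ \min_{\substack{\widetilde P_{XY}:\ \widetilde P_X=Q,\ \widetilde P_Y=P_Y,\\ \mathbb E_{\widetilde P}[\log q]\ge\mathbb E_P[\log q]}}D(P_{XY}\|Q\times W)+\big[I_{\widetilde P}(X;Y)-R\big]^+ ,$$ and $\lim_{n\to\infty}-\frac1n\log\bar p_e(n,e^{nR})=E_{\mathrm r}^{\mathrm{cc}}(Q,R)$ when the codewords are uniform on the type class $T^n(Q_n)$, for any types $Q_n$ with $\max_x|Q_n(x)-Q(x)|\le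 1/n$ and $Q_n(x)=0$ whenever $Q(x)=0$. -/

import Mathlib

open Filter Topology Asymptotics

open scoped Classical

noncomputable section

namespace Mismatched

variable {X Y : Type*} [Fintype X] [Fintype Y]

/-! ### Memoryless channel, decoding metric, random-coding error probability -/

/-- `W` is a transition law: every row `W x = W(·|x)` is a probability distribution on `Y`. -/
def IsChannel (W : X → Y → ℝ) : Prop := ∀ x, W x ∈ stdSimplex ℝ Y

/-- The memoryless extension `W^n(y|x) = ∏ᵢ W(yᵢ|xᵢ)`. -/
def chanN (W : X → Y → ℝ) {n : ℕ} (x : Fin n → X) (y : Fin n → Y) : ℝ := ∏ i, W (x i) (y i)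

/-- The metric of a word, `q^n(x,y) = ∏ᵢ q(xᵢ,yᵢ)`. -/
def metricN (q : X → Y → ℝ) {n : ℕ} (x : Fin n → X) (y : Fin n → Y) : ℝ := ∏ i, q (x i) (y i)

/-- The messages whose codeword attains the largest metric with the received word `y`. -/
def winners (q : X → Y → ℝ) {n M : ℕ} (C : Fin M → Fin n → X) (y : Fin n → Y) :
    Finset (Fin M) :=
  Finset.univ.filter fun j => ∀ i, metricN q (C i) y ≤ metricN q (C j) y

/-- Probability that the decoder outputs `m` on receiving `y`: it picks a maximizer of the metric,
ties being resolved uniformly at random. -/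
def decodeProb (q : X → Y → ℝ) {n M : ℕ} (C : Fin M → Fin n → X) (y : Fin n → Y) (m : Fin M) :
    ℝ :=
  if m ∈ winners q C y then 1 / ((winners q C y).card : ℝ) else 0

/-- Error probability of a codebook, the message being uniform on the `M` messages. -/
def errProb (W q : X → Y → ℝ) {n M : ℕ} (C : Fin M → Fin n → X) : ℝ :=
  (1 / (M : ℝ)) * ∑ m, ∑ y : Fin n → Y, chanN W (C m) y * (1 - decodeProb q C y m)

/-- Random-coding error probability: the mean of `errProb` when the `M` codewords are drawn
independently from the distribution `PX` on words of length `n`. -/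
def avgErrProb (W q : X → Y → ℝ) {n : ℕ} (M : ℕ) (PX : (Fin n → X) → ℝ) : ℝ :=
  ∑ C : Fin M → Fin n → X, (∏ m, PX (C m)) * errProb W q C

/-! ### Codeword distributions -/

/-- The i.i.d. codeword distribution `∏ᵢ Q(xᵢ)`. -/
def iidDist (Q : X → ℝ) {n : ℕ} (x : Fin n → X) : ℝ := ∏ i, Q (x i)

/-- The mean `φ = E_Q[f(X)]`. -/
def mean (Q f : X → ℝ) : ℝ := ∑ x, Q x * f x

/-- The set `D_n` of words whose empirical costs are within `δ/n` of their means. -/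
def costSet (Q : X → ℝ) {L : ℕ} (a : Fin L → X → ℝ) (δ : ℝ) (n : ℕ) : Set (Fin n → X) :=
  {x | ∀ l, |(1 / (n : ℝ)) * ∑ i, a l (x i) - mean Q (a l)| ≤ δ / n}

/-- The normalizing constant `μ_n`, the i.i.d. probability of `D_n`. -/
def costMass (Q : X → ℝ) {L : ℕ} (a : Fin L → X → ℝ) (δ : ℝ) (n : ℕ) : ℝ :=
  ∑ x : Fin n → X, if x ∈ costSet Q a δ n then iidDist Q x else 0

/-- The cost-constrained codeword distribution: i.i.d. conditioned on `D_n`. -/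
def costDist (Q : X → ℝ) {L : ℕ} (a : Fin L → X → ℝ) (δ : ℝ) {n : ℕ} (x : Fin n → X) : ℝ :=
  if x ∈ costSet Q a δ n then iidDist Q x / costMass Q a δ n else 0

/-- The covariance matrix of `(a_1(X), …, a_L(X))` for `X ∼ Q`. -/
def costCov (Q : X → ℝ) {L : ℕ} (a : Fin L → X → ℝ) : Matrix (Fin L) (Fin L) ℝ :=
  fun l k => ∑ x, Q x * ((a l x - mean Q (a l)) * (a k x - mean Q (a k)))

/-- The type (empirical distribution) of a word. -/
def wordType {n : ℕ} (x : Fin n → X) (b : X) : ℝ :=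
  ((Finset.univ.filter fun i => x i = b).card : ℝ) / n

/-- The type class `T^n(P)`. -/
def typeClass (P : X → ℝ) (n : ℕ) : Finset (Fin n → X) :=
  Finset.univ.filter fun x => wordType x = P

/-- The constant-composition codeword distribution: uniform on the type class `T^n(P)`. -/
def ccDist (P : X → ℝ) {n : ℕ} (x : Fin n → X) : ℝ :=
  if x ∈ typeClass P n then 1 / ((typeClass P n).card : ℝ) else 0

/-! ### Information quantities on finite alphabets -/

/-- Relative entropy `D(P‖S)`, equal to `+∞` unless `P ≪ S` (and with `0 log 0 = 0`). -/
def relEnt {α : Type*} [Fintype α] (P S : α → ℝ) : EReal :=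
  if ∀ b, S b = 0 → P b = 0 then ((∑ b, P b * Real.log (P b / S b) : ℝ) : EReal) else ⊤

/-- The marginal `P_X`. -/
def margX (P : X × Y → ℝ) (x : X) : ℝ := ∑ y, P (x, y)

/-- The marginal `P_Y`. -/
def margY (P : X × Y → ℝ) (y : Y) : ℝ := ∑ x, P (x, y)

/-- The joint distribution `(Q × W)(x,y) = Q(x) W(y|x)`. -/
def joint (Q : X → ℝ) (W : X → Y → ℝ) (p : X × Y) : ℝ := Q p.1 * W p.1 p.2

/-- The product distribution `Q(x) S(y)`. -/
def prodDist (Q : X → ℝ) (S : Y → ℝ) (p : X × Y) : ℝ := Q p.1 * S p.2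

/-- Mutual information `I_P(X;Y) = D(P‖P_X × P_Y)`. -/
def mutualInfo (P : X × Y → ℝ) : EReal := relEnt P (prodDist (margX P) (margY P))

/-- `E_P[log q(X,Y)]` with `log 0 = -∞` and `0 · (-∞) = 0`. -/
def meanLog (q : X → Y → ℝ) (P : X × Y → ℝ) : EReal :=
  if ∀ x y, q x y = 0 → P (x, y) = 0 then
    ((∑ p, P p * Real.log (q p.1 p.2) : ℝ) : EReal)
  else ⊥

/-! ### Exponents -/

/-- The set `S^cost({a_l})`. -/
def setScost (Q : X → ℝ) {L : ℕ} (a : Fin L → X → ℝ) : Set (X × Y → ℝ) :=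
  {P | P ∈ stdSimplex ℝ (X × Y) ∧ ∀ l, mean (margX P) (a l) = mean Q (a l)}

/-- The set `T^cost(P_XY, {a_l})`. -/
def setTcost (Q : X → ℝ) (q : X → Y → ℝ) {L : ℕ} (a : Fin L → X → ℝ) (P : X × Y → ℝ) :
    Set (X × Y → ℝ) :=
  {P' | P' ∈ stdSimplex ℝ (X × Y) ∧ (∀ l, mean (margX P') (a l) = mean Q (a l)) ∧
    margY P' = margY P ∧ meanLog q P ≤ meanLog q P'}

/-- The objective `D(P‖Q × W) + [D(P'‖Q × P_Y) - R]^+`. -/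
def objective (Q : X → ℝ) (W : X → Y → ℝ) (R : ℝ) (P P' : X × Y → ℝ) : EReal :=
  relEnt P (joint Q W) + max (relEnt P' (prodDist Q (margY P)) - (R : EReal)) 0

/-- The exponent `E_r^cost(Q, R, {a_l})`. -/
def expCost (Q : X → ℝ) (W q : X → Y → ℝ) (R : ℝ) {L : ℕ} (a : Fin L → X → ℝ) : EReal :=
  ⨅ P ∈ setScost (Y := Y) Q a, ⨅ P' ∈ setTcost Q q a P, objective Q W R P P'

/-- The i.i.d. exponent: no constraint on the `X`-marginals. -/
def expIid (Q : X → ℝ) (W q : X → Y → ℝ) (R : ℝ) : EReal :=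
  ⨅ P ∈ stdSimplex ℝ (X × Y),
    ⨅ P' ∈ {P' | P' ∈ stdSimplex ℝ (X × Y) ∧ margY P' = margY P ∧ meanLog q P ≤ meanLog q P'},
      relEnt P (joint Q W) + max (relEnt P' (prodDist Q (margY P)) - (R : EReal)) 0

/-- Csiszár's constant-composition exponent: both `X`-marginals equal `Q`. -/
def expCC (Q : X → ℝ) (W q : X → Y → ℝ) (R : ℝ) : EReal :=
  ⨅ P ∈ {P | P ∈ stdSimplex ℝ (X × Y) ∧ margX P = Q},
    ⨅ P' ∈ {P' | P' ∈ stdSimplex ℝ (X × Y) ∧ margX P' = Q ∧ margY P' = margY P ∧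
        meanLog q P ≤ meanLog q P'},
      relEnt P (joint Q W) + max (mutualInfo P' - (R : EReal)) 0

/-- `lim_n -(1/n) log p_n = E`, the logarithm being a genuine one for all large `n`. -/
def HasExponent (p : ℕ → ℝ) (E : EReal) : Prop :=
  (∀ᶠ n in atTop, 0 < p n) ∧
    Tendsto (fun n : ℕ => ((-(1 / (n : ℝ)) * Real.log (p n) : ℝ) : EReal)) atTop (𝓝 E)

end Mismatched

end

/-! The proof is the method of types applied to a truncated union bound. Given the sent word and the
output, the competitors are independent, so up to a factor 4 the error probability is the mean of
`min 1 (k * beatProb)` with `k = M - 1` (`avgErrProb_le_rcu`, `rcu_le_avgErrProb`). All the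
ensembles are i.i.d. words conditioned on permutation-invariant sets `D n` whose probability is not
exponentially small, and the number of types is polynomial; neither affects the exponent. A joint
type `P` of (sent word, output) has probability about `exp (-n D(P‖Q × W))`. Given the output, a
competitor has joint type `P'` with it with probability about `exp (-n D(P'‖Q × P_Y))`. Hence a pair
of types contributes `exp (-n objR)`.

For the upper bound on the error probability (`rcu_le_exp`, `eventually_le_objR`), the pairs of
types at which an error can occur satisfy every constraint of `feasible`, except that the costs
match only up to o(1). Their limit points are feasible, so compactness and continuity of `objR` give
the minimum.

For the lower bound (`eventually_exists_words`, `exp_le_rcu`), one triple (sent word, competitor,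
output) near a minimizing pair suffices, since permuting it yields entire type classes. But the
metric inequality must hold exactly, and both words must lie in `D n`, where the total costs have
only a bounded window; plain rounding would break both. The triple is therefore obtained from a
trivial one, in which the competitor equals the sent word, by adding an integer vector `z` close to
`k • d`. Here `d` is the displacement of types and `k` is within a constant of `n` (pigeonhole on
the torus). As `d` has zero cost, `z` changes the costs by less than any prescribed `η`, and `z` can
be chosen so that it does not decrease the metric difference (`exists_int_near_mul_nonneg`).

This needs a word of `D n` at which cost changes below a fixed `η` do not leave `D n`
(`IsEnsemble.slack`). For the cost ensemble this is where the lower bound on `μ_n` enters. A cost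
coordinate that small integer moves can change is within `η` of the boundary only with probability
at most a small multiple of `n ^ (-L'/2)`, because such a slab has very many disjoint translates of
comparable probability (`exists_slab_bound`). A coordinate that small moves cannot change does no
harm.

If `Q × W` charges a zero of `q`, the metric of the sent word vanishes with high probability, so
every competitor ties or wins, and the exponent is 0. -/

set_option linter.unusedSectionVars false

noncomputable section

namespace Mismatched

/-! ### Counts of words and the size of type classes -/

section Counts

variable {α : Type*} [Fintype α]

/-- The number of occurrences of `b` in the word `w`. -/
def cnt {n : ℕ} (w : Fin n → α) (b : α) : ℕ := (Finset.univ.filter fun i => w i = b).card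

theorem sum_cnt {n : ℕ} (w : Fin n → α) : ∑ b, cnt w b = n := by
  have := Finset.card_eq_sum_card_fiberwise (s := (Finset.univ : Finset (Fin n)))
    (t := (Finset.univ : Finset α)) (f := w) (fun _ _ => Finset.mem_coe.2 (Finset.mem_univ _))
  simpa [cnt] using this.symm

theorem cnt_le {n : ℕ} (w : Fin n → α) (b : α) : cnt w b ≤ n := by
  simpa [cnt] using Finset.card_filter_le (Finset.univ : Finset (Fin n)) (fun i => w i = b)

theorem cnt_pos_iff {n : ℕ} (w : Fin n → α) (b : α) : 0 < cnt w b ↔ ∃ i, w i = b := by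
  simp [cnt, Finset.card_pos, Finset.filter_nonempty_iff]

theorem cnt_apply_pos {n : ℕ} (w : Fin n → α) (i : Fin n) : 0 < cnt w (w i) :=
  (cnt_pos_iff w _).2 ⟨i, rfl⟩

theorem sum_word {n : ℕ} (w : Fin n → α) (f : α → ℝ) :
    ∑ i, f (w i) = ∑ b, (cnt w b : ℝ) * f b := by
  rw [← Finset.sum_fiberwise (s := Finset.univ) (g := w)]
  refine Finset.sum_congr rfl fun b _ => ?_
  rw [Finset.sum_congr rfl (g := fun _ => f b), Finset.sum_const, nsmul_eq_mul, cnt]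
  intro i hi
  rw [(Finset.mem_filter.1 hi).2]

theorem prod_word {n : ℕ} (w : Fin n → α) (f : α → ℝ) :
    ∏ i, f (w i) = ∏ b, f b ^ cnt w b := by
  rw [← Finset.prod_fiberwise (s := Finset.univ) (g := w)]
  refine Finset.prod_congr rfl fun b _ => ?_
  rw [Finset.prod_congr rfl (g := fun _ => f b), Finset.prod_const, cnt]
  intro i hi
  rw [(Finset.mem_filter.1 hi).2]

theorem wordType_eq {n : ℕ} (w : Fin n → α) (b : α) : wordType w b = (cnt w b : ℝ) / n := rfl

theorem cnt_comp_perm {n : ℕ} (w : Fin n → α) (σ : Equiv.Perm (Fin n)) : cnt (w ∘ σ) = cnt w := by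
  funext b
  unfold cnt
  refine Finset.card_bij' (fun i _ => σ i) (fun i _ => σ.symm i) ?_ ?_ ?_ ?_ <;> simp

theorem exists_perm_of_cnt_eq {n : ℕ} {w w' : Fin n → α} (h : cnt w = cnt w') :
    ∃ σ : Equiv.Perm (Fin n), w' = w ∘ σ := by
  have e : ∀ c, Nonempty ({a // w' a = c} ≃ {b // w b = c}) := fun c => by
    rw [← Fintype.card_eq, Fintype.card_subtype, Fintype.card_subtype]
    have := congrFun h c
    unfold cnt at this
    convert this.symm
  refine ⟨Equiv.ofFiberEquiv (fun c => (e c).some), ?_⟩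
  funext i
  exact (Equiv.ofFiberEquiv_map (fun c => (e c).some) i).symm

theorem exists_word {n : ℕ} (N : α → ℕ) (hN : ∑ b, N b = n) : ∃ w : Fin n → α, cnt w = N := by
  have hc : Fintype.card (Σ b, Fin (N b)) = Fintype.card (Fin n) := by simp [hN]
  let e := Fintype.equivOfCardEq hc
  refine ⟨fun i => (e.symm i).1, ?_⟩
  funext b
  unfold cnt
  rw [Finset.card_filter, ← Equiv.sum_comp e]
  simp only [Equiv.symm_apply_apply]
  rw [Fintype.sum_sigma, Finset.sum_eq_single b]
  · simp
  · intro c _ hc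
    simp [hc]
  · simp

/-- The words with prescribed counts. -/
def cls (N : α → ℕ) (n : ℕ) : Finset (Fin n → α) := Finset.univ.filter fun w => cnt w = N

theorem mem_cls {N : α → ℕ} {n : ℕ} {w : Fin n → α} : w ∈ cls N n ↔ cnt w = N := by simp [cls]

/-- Orbit-stabilizer: permutations act transitively on the words with counts `N`, and each fibre of
`σ ↦ w ∘ σ` is a coset of the stabilizer of `w`, of order `∏ (N b)!`. -/
theorem card_cls_mul {n : ℕ} (N : α → ℕ) (hN : ∑ b, N b = n) :
    (cls N n).card * ∏ b, (N b).factorial = n.factorial := by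
  obtain ⟨w, hw⟩ := exists_word N hN
  have h1 := Finset.card_eq_sum_card_fiberwise (s := (Finset.univ : Finset (Equiv.Perm (Fin n))))
    (t := cls N n) (f := fun σ : Equiv.Perm (Fin n) => w ∘ σ) (fun σ _ => by
      
      rw [Finset.mem_coe, mem_cls]; exact (cnt_comp_perm w σ).trans hw)
  rw [Finset.card_univ, Fintype.card_perm, Fintype.card_fin] at h1
  rw [h1, ← smul_eq_mul, ← Finset.sum_const]
  refine Finset.sum_congr rfl fun w' hw' => ?_
  obtain ⟨σ, rfl⟩ := exists_perm_of_cnt_eq (hw.trans (mem_cls.1 hw').symm)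
  have h2 := DomMulAct.stabilizer_card w
  have h3 : (∏ b, (N b).factorial) = ∏ i, (Fintype.card {a // w a = i}).factorial := by
    refine Finset.prod_congr rfl fun b _ => ?_
    rw [Fintype.card_subtype, ← hw]; rfl
  rw [h3, ← h2, Fintype.card_subtype]
  refine Finset.card_bij' (fun τ _ => τ * σ) (fun τ _ => τ * σ⁻¹) ?_ ?_ ?_ ?_
  · intro τ hτ
    have := (Finset.mem_filter.1 hτ).2
    simp only [Finset.mem_filter, Finset.mem_univ, true_and]
    funext i
    exact congrFun this (σ i)
  · intro τ hτ
    have := (Finset.mem_filter.1 hτ).2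
    simp only [Finset.mem_filter, Finset.mem_univ, true_and]
    funext i
    simpa using congrFun this (σ⁻¹ i)
  · intro τ _; simp
  · intro τ _; simp

/-- The probability of the words with counts `N` under the product weight of `S`. -/
def clsProb (S : α → ℝ) (N : α → ℕ) (n : ℕ) : ℝ := ∑ w ∈ cls N n, ∏ i, S (w i)

theorem clsProb_eq (S : α → ℝ) (N : α → ℕ) (n : ℕ) :
    clsProb S N n = (cls N n).card * ∏ b, S b ^ N b := by
  unfold clsProb
  rw [Finset.sum_congr rfl (g := fun _ => ∏ b, S b ^ N b), Finset.sum_const, nsmul_eq_mul]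
  intro w hw
  rw [prod_word, mem_cls.1 hw]

theorem clsProb_nonneg {S : α → ℝ} (hS : ∀ b, 0 ≤ S b) (N : α → ℕ) (n : ℕ) : 0 ≤ clsProb S N n :=
  Finset.sum_nonneg fun _ _ => Finset.prod_nonneg fun _ _ => hS _

theorem sum_prod_word (S : α → ℝ) (n : ℕ) : ∑ w : Fin n → α, ∏ i, S (w i) = (∑ b, S b) ^ n := by
  have := Finset.prod_univ_sum (fun _ : Fin n => (Finset.univ : Finset α)) (fun _ b => S b)
  simpa using this.symm

/-- The set of possible counts of words of length `n`. -/
def counts (α : Type*) [Fintype α] (n : ℕ) : Finset (α → ℕ) :=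
  Fintype.piFinset fun _ => Finset.range (n + 1)

theorem card_counts (n : ℕ) : (counts α n).card = (n + 1) ^ Fintype.card α := by
  simp [counts]

theorem cnt_mem_counts {n : ℕ} (w : Fin n → α) : cnt w ∈ counts α n := by
  simp only [counts, Fintype.mem_piFinset, Finset.mem_range]
  exact fun b => Nat.lt_succ_of_le (cnt_le w b)

theorem sum_counts {n : ℕ} (f : (Fin n → α) → ℝ) :
    ∑ N ∈ counts α n, ∑ w ∈ cls N n, f w = ∑ w, f w := by
  have := Finset.sum_fiberwise_of_maps_to (s := (Finset.univ : Finset (Fin n → α)))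
    (t := counts α n) (g := cnt) (fun w _ => cnt_mem_counts w) f
  rw [← this]
  rfl

theorem cls_eq_empty {n : ℕ} {N : α → ℕ} (h : ∑ b, N b ≠ n) : cls N n = ∅ := by
  refine Finset.eq_empty_of_forall_notMem fun w hw => h ?_
  rw [← mem_cls.1 hw, sum_cnt]

/-- The Poisson weights `a ^ b / b!` are largest at `b = a`; cross-multiplying avoids division. -/
theorem factorial_mul_pow_le (a b : ℕ) :
    (a.factorial : ℝ) * (a : ℝ) ^ b ≤ (b.factorial : ℝ) * (a : ℝ) ^ a := by
  rcases le_total a b with h | h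
  · have := Nat.factorial_mul_pow_sub_le_factorial h
    have h2 : (a : ℝ) ^ b = (a : ℝ) ^ (b - a) * (a : ℝ) ^ a := by rw [← pow_add]; congr 1; omega
    rw [h2, ← mul_assoc]
    gcongr
    exact_mod_cast this
  · have h1 := Nat.factorial_mul_descFactorial (Nat.sub_le a b)
    have h2 := Nat.descFactorial_le_pow a (a - b)
    rw [Nat.sub_sub_self h] at h1
    have h3 : (a : ℝ) ^ a = (a : ℝ) ^ (a - b) * (a : ℝ) ^ b := by rw [← pow_add]; congr 1; omega
    rw [h3, ← mul_assoc, ← h1]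
    push_cast
    gcongr
    exact_mod_cast h2

/-- The counts of a word are the most likely ones under its own type. -/
theorem clsProb_le_clsProb_self {n : ℕ} (N N' : α → ℕ) (hN : ∑ b, N b = n) (hN' : ∑ b, N' b = n) :
    clsProb (fun b => (N b : ℝ) / n) N' n ≤ clsProb (fun b => (N b : ℝ) / n) N n := by
  have key : ∀ K : α → ℕ, ∑ b, K b = n → clsProb (fun b => (N b : ℝ) / n) K n =
      ((n.factorial : ℝ) / (n : ℝ) ^ n) * ∏ b, ((N b : ℝ) ^ K b / (K b).factorial) := by
    intro K hK
    rw [clsProb_eq, Finset.prod_div_distrib]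
    have h1 : ((cls K n).card : ℝ) * ∏ b, ((K b).factorial : ℝ) = n.factorial := by
      exact_mod_cast card_cls_mul K hK
    have h2 : (∏ b, ((K b).factorial : ℝ)) ≠ 0 :=
      Finset.prod_ne_zero_iff.2 fun b _ => by positivity
    have h3 : ∏ b, ((N b : ℝ) / n) ^ K b = (∏ b, (N b : ℝ) ^ K b) / (n : ℝ) ^ n := by
      simp_rw [div_pow]
      rw [Finset.prod_div_distrib, Finset.prod_pow_eq_pow_sum, hK]
    rw [h3, ← h1]
    field_simp
  rw [key N' hN', key N hN]
  refine mul_le_mul_of_nonneg_left ?_ (by positivity)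
  refine Finset.prod_le_prod (fun b _ => by positivity) fun b _ => ?_
  rw [div_le_div_iff₀ (by positivity) (by positivity)]
  have := factorial_mul_pow_le (N b) (N' b)
  linarith

/-- The classes have total probability 1 under the type of `N`, there are at most `(n + 1) ^ |α|` of
them, and that of `N` is the likeliest. -/
theorem clsProb_self_ge {n : ℕ} (N : α → ℕ) (hN : ∑ b, N b = n) :
    1 ≤ ((n : ℝ) + 1) ^ Fintype.card α * clsProb (fun b => (N b : ℝ) / n) N n := by
  have h0 : 0 ≤ clsProb (fun b => (N b : ℝ) / n) N n := clsProb_nonneg (fun b => by positivity) N n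
  have h1 : ∑ K ∈ counts α n, clsProb (fun b => (N b : ℝ) / n) K n = 1 := by
    unfold clsProb
    rw [sum_counts, sum_prod_word (fun b => (N b : ℝ) / n)]
    rcases Nat.eq_zero_or_pos n with rfl | hn
    · simp
    · rw [← Finset.sum_div, ← Nat.cast_sum, hN, div_self (by positivity), one_pow]
  have h2 := Finset.sum_le_card_nsmul (counts α n) (fun K => clsProb (fun b => (N b : ℝ) / n) K n)
    (clsProb (fun b => (N b : ℝ) / n) N n) (fun K _ => by
      by_cases hK : ∑ b, K b = n
      · exact clsProb_le_clsProb_self N K hN hK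
      · rw [clsProb, cls_eq_empty hK]; simpa using h0)
  rw [h1, card_counts, nsmul_eq_mul] at h2
  exact_mod_cast h2

theorem clsProb_le_one {S : α → ℝ} (hS : S ∈ stdSimplex ℝ α) (N : α → ℕ) (n : ℕ) :
    clsProb S N n ≤ 1 := by
  calc clsProb S N n ≤ ∑ w : Fin n → α, ∏ i, S (w i) :=
        Finset.sum_le_sum_of_subset_of_nonneg (Finset.subset_univ _) fun _ _ _ =>
          Finset.prod_nonneg fun _ _ => hS.1 _
    _ = 1 := by rw [sum_prod_word, hS.2, one_pow]

theorem wordType_mem {n : ℕ} (hn : 0 < n) (w : Fin n → α) : wordType w ∈ stdSimplex ℝ α := by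
  refine ⟨fun b => by rw [wordType_eq]; positivity, ?_⟩
  simp_rw [wordType_eq]
  rw [← Finset.sum_div, ← Nat.cast_sum, sum_cnt, div_self (by positivity)]

end Counts

/-! ### Exponential size of type classes -/

section Exponents

variable {α : Type*} [Fintype α]

/-- The real sum that defines the relative entropy. -/
def klR (P S : α → ℝ) : ℝ := ∑ b, P b * Real.log (P b / S b)

theorem relEnt_of_ac {P S : α → ℝ} (h : ∀ b, S b = 0 → P b = 0) : relEnt P S = (klR P S : EReal) := by
  simp [relEnt, klR, if_pos h]

/-- For `s = 0` the convention `x / 0 = 0` makes the term vanish identically. Hence `klR` is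
continuous in `P` on the whole space, at the price of being the relative entropy only when `P ≪ S`.
-/
theorem continuous_mul_log_div (s : ℝ) : Continuous fun x : ℝ => x * Real.log (x / s) := by
  by_cases hs : s = 0
  · simp [hs, continuous_const]
  · have : (fun x : ℝ => x * Real.log (x / s)) = fun x => x * Real.log x - x * Real.log s := by
      funext x
      by_cases hx : x = 0
      · simp [hx]
      · rw [Real.log_div hx hs]; ring
    rw [this]
    exact Real.continuous_mul_log.sub (continuous_id.mul continuous_const)

theorem continuous_klR (S : α → ℝ) : Continuous fun P : α → ℝ => klR P S :=
  continuous_finsetSum _ fun b _ => (continuous_mul_log_div (S b)).comp (continuous_apply b)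

theorem mul_log_div_eq {p s : ℝ} (h : s = 0 → p = 0) :
    p * Real.log (p / s) = s * InformationTheory.klFun (p / s) + (p - s) := by
  by_cases hs : s = 0
  · simp [hs, h hs]
  · rw [InformationTheory.klFun_apply]
    field_simp
    ring

/-- Rewriting with `klFun`, nonnegative and zero only at 1, gives Gibbs' inequality and its equality
case term by term. -/
theorem klR_eq {P S : α → ℝ} (hP : P ∈ stdSimplex ℝ α) (hS : S ∈ stdSimplex ℝ α)
    (h : ∀ b, S b = 0 → P b = 0) :
    klR P S = ∑ b, S b * InformationTheory.klFun (P b / S b) := by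
  unfold klR
  rw [Finset.sum_congr rfl fun b _ => mul_log_div_eq (h b), Finset.sum_add_distrib,
    Finset.sum_sub_distrib, hP.2, hS.2]
  simp

theorem klR_nonneg {P S : α → ℝ} (hP : P ∈ stdSimplex ℝ α) (hS : S ∈ stdSimplex ℝ α)
    (h : ∀ b, S b = 0 → P b = 0) : 0 ≤ klR P S := by
  rw [klR_eq hP hS h]
  exact Finset.sum_nonneg fun b _ => mul_nonneg (hS.1 b)
    (InformationTheory.klFun_nonneg (div_nonneg (hP.1 b) (hS.1 b)))

theorem eq_of_klR_eq_zero {P S : α → ℝ} (hP : P ∈ stdSimplex ℝ α) (hS : S ∈ stdSimplex ℝ α)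
    (h : ∀ b, S b = 0 → P b = 0) (h0 : klR P S = 0) : P = S := by
  rw [klR_eq hP hS h, Finset.sum_eq_zero_iff_of_nonneg fun b _ => mul_nonneg (hS.1 b)
    (InformationTheory.klFun_nonneg (div_nonneg (hP.1 b) (hS.1 b)))] at h0
  funext b
  by_cases hs : S b = 0
  · rw [hs, h b hs]
  · have := (mul_eq_zero.1 (h0 b (Finset.mem_univ b))).resolve_left hs
    rw [InformationTheory.klFun_eq_zero_iff (div_nonneg (hP.1 b) (hS.1 b))] at this
    rwa [div_eq_one_iff_eq hs] at this

theorem klR_self {S : α → ℝ} : klR S S = 0 := by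
  unfold klR
  refine Finset.sum_eq_zero fun b _ => ?_
  by_cases hs : S b = 0
  · simp [hs]
  · simp [div_self hs]

theorem relEnt_nonneg {P S : α → ℝ} (hP : P ∈ stdSimplex ℝ α) (hS : S ∈ stdSimplex ℝ α) :
    0 ≤ relEnt P S := by
  by_cases h : ∀ b, S b = 0 → P b = 0
  · rw [relEnt_of_ac h]
    exact_mod_cast klR_nonneg hP hS h
  · rw [relEnt, if_neg h]
    exact le_top

theorem sum_word_wordType {n : ℕ} (w : Fin n → α) (f : α → ℝ) :
    ∑ i, f (w i) = n * ∑ b, wordType w b * f b := by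
  rw [sum_word, Finset.mul_sum]
  refine Finset.sum_congr rfl fun b _ => ?_
  rw [wordType_eq]
  rcases Nat.eq_zero_or_pos n with rfl | hn
  · simp [cnt]
  · field_simp

theorem wordType_apply_pos {n : ℕ} (w : Fin n → α) (i : Fin n) : 0 < wordType w (w i) := by
  have h1 := cnt_apply_pos w i
  have h2 : 0 < n := Nat.pos_of_ne_zero fun h => by subst h; exact i.elim0
  rw [wordType_eq]
  positivity

theorem prod_eq_mul_exp {n : ℕ} (f g : Fin n → ℝ) (hf : ∀ i, 0 < f i) (hg : ∀ i, 0 < g i) :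
    ∏ i, f i = (∏ i, g i) * Real.exp (-∑ i, Real.log (g i / f i)) := by
  rw [Real.exp_neg, Real.exp_sum, Finset.prod_congr rfl fun i _ =>
    Real.exp_log (div_pos (hg i) (hf i)), Finset.prod_div_distrib]
  have h1 : ∏ i, g i ≠ 0 := Finset.prod_ne_zero_iff.2 fun i _ => (hg i).ne'
  have h2 : ∏ i, f i ≠ 0 := Finset.prod_ne_zero_iff.2 fun i _ => (hf i).ne'
  field_simp

/-- Change of measure from `S` to the type of the word itself: the log-likelihood ratio is a sum
over letters, so it depends on the type only. -/
theorem prod_word_eq_exp {n : ℕ} (w : Fin n → α) {S : α → ℝ} (hS : ∀ i, 0 < S (w i)) :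
    ∏ i, S (w i) = (∏ i, wordType w (w i)) * Real.exp (-(n * klR (wordType w) S)) := by
  rw [prod_eq_mul_exp (fun i => S (w i)) (fun i => wordType w (w i)) hS (wordType_apply_pos w),
    sum_word_wordType w fun b => Real.log (wordType w b / S b)]
  rfl

theorem wordType_of_mem_cls {n : ℕ} {N : α → ℕ} {w : Fin n → α} (hw : w ∈ cls N n) :
    wordType w = fun b => (N b : ℝ) / n := by
  funext b
  rw [wordType_eq, mem_cls.1 hw]

theorem clsProb_le {S : α → ℝ} (hS : ∀ b, 0 ≤ S b) {n : ℕ} (N : α → ℕ) :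
    clsProb S N n ≤ Real.exp (-(n * klR (fun b => (N b : ℝ) / n) S)) := by
  by_cases hN : ∑ b, N b = n
  swap
  · rw [clsProb, cls_eq_empty hN, Finset.sum_empty]
    positivity
  rcases Nat.eq_zero_or_pos n with rfl | hn
  · simp only [Nat.cast_zero, zero_mul, neg_zero, Real.exp_zero]
    calc clsProb S N 0 ≤ ∑ w : Fin 0 → α, ∏ i, S (w i) :=
        Finset.sum_le_sum_of_subset_of_nonneg (Finset.subset_univ _) fun _ _ _ =>
          Finset.prod_nonneg fun _ _ => hS _
      _ = 1 := by rw [sum_prod_word, pow_zero]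
  obtain ⟨w0, hw0⟩ := exists_word N hN
  have ht : (fun b => (N b : ℝ) / n) ∈ stdSimplex ℝ α :=
    wordType_of_mem_cls (mem_cls.2 hw0) ▸ wordType_mem hn w0
  have h1 : clsProb S N n ≤ clsProb (fun b => (N b : ℝ) / n) N n *
      Real.exp (-(n * klR (fun b => (N b : ℝ) / n) S)) := by
    unfold clsProb
    rw [Finset.sum_mul]
    refine Finset.sum_le_sum fun w hw => ?_
    by_cases hpos : ∀ i, 0 < S (w i)
    · rw [prod_word_eq_exp w hpos, wordType_of_mem_cls hw]
    · push Not at hpos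
      obtain ⟨i, hi⟩ := hpos
      rw [Finset.prod_eq_zero (Finset.mem_univ i) (le_antisymm hi (hS _))]
      exact mul_nonneg (Finset.prod_nonneg fun i _ => by positivity) (Real.exp_nonneg _)
  refine h1.trans ?_
  exact mul_le_of_le_one_left (Real.exp_nonneg _) (clsProb_le_one ht N n)

theorem clsProb_ge {S : α → ℝ} (hS : ∀ b, 0 ≤ S b) {n : ℕ} (N : α → ℕ) (hN : ∑ b, N b = n)
    (h : ∀ b, S b = 0 → N b = 0) :
    Real.exp (-(n * klR (fun b => (N b : ℝ) / n) S)) ≤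
      ((n : ℝ) + 1) ^ Fintype.card α * clsProb S N n := by
  have h1 : clsProb S N n = clsProb (fun b => (N b : ℝ) / n) N n *
      Real.exp (-(n * klR (fun b => (N b : ℝ) / n) S)) := by
    unfold clsProb
    rw [Finset.sum_mul]
    refine Finset.sum_congr rfl fun w hw => ?_
    have hpos : ∀ i, 0 < S (w i) := fun i => lt_of_le_of_ne (hS _) fun h0 => by
      have h2 := cnt_apply_pos w i
      rw [mem_cls.1 hw, h _ h0.symm] at h2
      exact lt_irrefl _ h2
    rw [prod_word_eq_exp w hpos, wordType_of_mem_cls hw]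
  rw [h1, ← mul_assoc]
  exact le_mul_of_one_le_left (Real.exp_nonneg _) (clsProb_self_ge N hN)

theorem cnt_comp {β : Type*} [Fintype β] {n : ℕ} (w : Fin n → α) (f : α → β) (c : β) :
    cnt (fun i => f (w i)) c = ∑ b, if f b = c then cnt w b else 0 := by
  have h := sum_word w (fun b => if f b = c then (1 : ℝ) else 0)
  have h2 : ((cnt (fun i => f (w i)) c : ℕ) : ℝ) = ∑ i, if f (w i) = c then (1 : ℝ) else 0 := by
    simp [cnt]
  rw [← h2] at h
  have h3 : ((cnt (fun i => f (w i)) c : ℕ) : ℝ) =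
      ((∑ b, if f b = c then cnt w b else 0 : ℕ) : ℝ) := by
    rw [h]; push_cast
    exact Finset.sum_congr rfl fun b _ => by split_ifs <;> simp
  exact_mod_cast h3

end Exponents

/-! ### Conditional type classes given an output word -/

section Conditional

variable {X Y : Type*} [Fintype X] [Fintype Y]

/-- The word of pairs `(xᵢ, yᵢ)`. -/
def pairW {n : ℕ} (x : Fin n → X) (y : Fin n → Y) (i : Fin n) : X × Y := (x i, y i)

/-- For `P ≪ Q × P_Y` this is `D(P‖Q × P_Y)`. -/
def condKL (Q : X → ℝ) (P : X × Y → ℝ) : ℝ :=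
  ∑ p, P p * Real.log (P p / Q p.1) - ∑ y, margY P y * Real.log (margY P y)

theorem continuous_margY : Continuous fun P : X × Y → ℝ => margY P :=
  continuous_pi fun y => continuous_finsetSum _ fun x _ => continuous_apply (x, y)

theorem continuous_margX : Continuous fun P : X × Y → ℝ => margX P :=
  continuous_pi fun x => continuous_finsetSum _ fun y _ => continuous_apply (x, y)

theorem continuous_condKL (Q : X → ℝ) : Continuous fun P : X × Y → ℝ => condKL Q P := by
  refine Continuous.sub ?_ ?_
  · exact continuous_finsetSum _ fun p _ =>
      (continuous_mul_log_div (Q p.1)).comp (continuous_apply p)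
  · exact continuous_finsetSum _ fun y _ =>
      Real.continuous_mul_log.comp ((continuous_apply y).comp continuous_margY)

theorem margY_pos {P : X × Y → ℝ} (hP : ∀ p, 0 ≤ P p) {x : X} {y : Y} (h : P (x, y) ≠ 0) :
    0 < margY P y :=
  Finset.sum_pos' (fun x _ => hP (x, y)) ⟨x, Finset.mem_univ _, lt_of_le_of_ne (hP _) h.symm⟩

theorem condKL_eq_klR {Q : X → ℝ} {P : X × Y → ℝ} (hP : ∀ p, 0 ≤ P p)
    (h : ∀ x y, Q x = 0 → P (x, y) = 0) : condKL Q P = klR P (prodDist Q (margY P)) := by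
  have h2 : ∑ y, margY P y * Real.log (margY P y) = ∑ p : X × Y, P p * Real.log (margY P p.2) := by
    rw [Fintype.sum_prod_type_right]
    refine Finset.sum_congr rfl fun y _ => ?_
    exact Finset.sum_mul _ _ _
  unfold condKL klR
  rw [h2, ← Finset.sum_sub_distrib]
  refine Finset.sum_congr rfl fun p _ => ?_
  by_cases hp : P p = 0
  · simp [hp]
  · have h3 : 0 < margY P p.2 := margY_pos hP (x := p.1) hp
    have h4 : Q p.1 ≠ 0 := fun h0 => hp (h p.1 p.2 h0)
    rw [prodDist, Real.log_div hp h4, Real.log_div hp (mul_ne_zero h4 h3.ne'),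
      Real.log_mul h4 h3.ne']
    ring

theorem margY_wordType {n : ℕ} (x : Fin n → X) (y : Fin n → Y) :
    margY (wordType (pairW x y)) = wordType y := by
  funext c
  have h := cnt_comp (pairW x y) Prod.snd c
  have h2 : cnt y c = ∑ a, cnt (pairW x y) (a, c) := by
    rw [Fintype.sum_prod_type_right] at h
    rw [Finset.sum_eq_single c] at h
    · simp only [if_true] at h
      exact h
    · intro b _ hb; simp [hb]
    · simp
  simp_rw [margY, wordType_eq, ← Finset.sum_div]
  rw [h2, Nat.cast_sum]

theorem margX_wordType {n : ℕ} (x : Fin n → X) (y : Fin n → Y) :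
    margX (wordType (pairW x y)) = wordType x := by
  funext c
  have h := cnt_comp (pairW x y) Prod.fst c
  have h2 : cnt x c = ∑ a, cnt (pairW x y) (c, a) := by
    rw [Fintype.sum_prod_type] at h
    rw [Finset.sum_eq_single c] at h
    · simp only [if_true] at h
      exact h
    · intro b _ hb; simp [hb]
    · simp
  simp_rw [margX, wordType_eq, ← Finset.sum_div]
  rw [h2, Nat.cast_sum]

/-- The words `x` that have joint counts `N` with `y`. -/
def condCls {n : ℕ} (N : X × Y → ℕ) (y : Fin n → Y) : Finset (Fin n → X) :=
  Finset.univ.filter fun x => cnt (pairW x y) = N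

theorem mem_condCls {n : ℕ} {N : X × Y → ℕ} {y : Fin n → Y} {x : Fin n → X} :
    x ∈ condCls N y ↔ cnt (pairW x y) = N := by simp [condCls]

theorem wordType_of_mem_condCls {n : ℕ} {N : X × Y → ℕ} {y : Fin n → Y} {x : Fin n → X}
    (hx : x ∈ condCls N y) : wordType (pairW x y) = fun b => (N b : ℝ) / n := by
  funext b
  rw [wordType_eq, mem_condCls.1 hx]

/-- Change of measure from `Q` to the reverse conditional type `P(x|y)`; the logarithmic ratio
averages to `condKL`. -/
theorem prod_word_eq_exp_condKL {n : ℕ} (x : Fin n → X) (y : Fin n → Y) {Q : X → ℝ}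
    (hQ : ∀ i, 0 < Q (x i)) :
    ∏ i, Q (x i) = (∏ i, wordType (pairW x y) (x i, y i) / wordType y (y i)) *
      Real.exp (-(n * condKL Q (wordType (pairW x y)))) := by
  have hpos : ∀ i, 0 < wordType (pairW x y) (x i, y i) := wordType_apply_pos (pairW x y)
  rw [prod_eq_mul_exp (fun i => Q (x i))
    (fun i => wordType (pairW x y) (x i, y i) / wordType y (y i)) hQ
    (fun i => div_pos (hpos i) (wordType_apply_pos y i))]
  congr 3
  have h1 := sum_word_wordType (pairW x y) fun p => Real.log (wordType (pairW x y) p / Q p.1)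
  have h2 := sum_word_wordType y fun b => Real.log (wordType y b)
  unfold condKL
  rw [mul_sub, ← h1, margY_wordType, ← h2, ← Finset.sum_sub_distrib]
  refine Finset.sum_congr rfl fun i _ => ?_
  simp only [pairW]
  rw [← Real.log_div (div_pos (hpos i) (hQ i)).ne' (wordType_apply_pos y i).ne']
  congr 1
  rw [div_div, div_div, mul_comm]

/-- After the change of measure, what remains is the probability of the class under the product of
the laws `P(·|y i)`, which is at most 1. -/
theorem sum_condCls_le {Q : X → ℝ} (hQ : ∀ b, 0 ≤ Q b) {n : ℕ} (N : X × Y → ℕ) (y : Fin n → Y) :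
    ∑ x ∈ condCls N y, ∏ i, Q (x i) ≤
      Real.exp (-(n * condKL Q (fun b => (N b : ℝ) / n))) := by
  by_cases hne : (condCls N y).Nonempty
  swap
  · rw [Finset.not_nonempty_iff_eq_empty.1 hne, Finset.sum_empty]
    positivity
  obtain ⟨x0, hx0⟩ := hne
  have hY : ∀ b, ∑ a, ((N (a, b) : ℝ) / n) = wordType y b := fun b => by
    rw [← margY_wordType x0 y, wordType_of_mem_condCls hx0]; rfl
  calc ∑ x ∈ condCls N y, ∏ i, Q (x i)
      ≤ ∑ x ∈ condCls N y, (∏ i, ((N (x i, y i) : ℝ) / n) / wordType y (y i)) *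
        Real.exp (-(n * condKL Q (fun b => (N b : ℝ) / n))) := by
        refine Finset.sum_le_sum fun x hx => ?_
        by_cases hpos : ∀ i, 0 < Q (x i)
        · rw [prod_word_eq_exp_condKL x y hpos, wordType_of_mem_condCls hx]
        · push Not at hpos
          obtain ⟨i, hi⟩ := hpos
          rw [Finset.prod_eq_zero (Finset.mem_univ i) (le_antisymm hi (hQ _))]
          exact mul_nonneg (Finset.prod_nonneg fun i _ =>
            div_nonneg (by positivity) (wordType_apply_pos y i).le) (Real.exp_nonneg _)
    _ = (∑ x ∈ condCls N y, ∏ i, ((N (x i, y i) : ℝ) / n) / wordType y (y i)) *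
        Real.exp (-(n * condKL Q (fun b => (N b : ℝ) / n))) := by rw [Finset.sum_mul]
    _ ≤ 1 * Real.exp (-(n * condKL Q (fun b => (N b : ℝ) / n))) := by
        gcongr
        calc ∑ x ∈ condCls N y, ∏ i, ((N (x i, y i) : ℝ) / n) / wordType y (y i)
            ≤ ∑ x : Fin n → X, ∏ i, ((N (x i, y i) : ℝ) / n) / wordType y (y i) :=
              Finset.sum_le_sum_of_subset_of_nonneg (Finset.subset_univ _) fun _ _ _ =>
                Finset.prod_nonneg fun i _ =>
                  div_nonneg (by positivity) (wordType_apply_pos y i).le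
          _ = ∏ i, ∑ a, ((N (a, y i) : ℝ) / n) / wordType y (y i) := by
              have := Finset.prod_univ_sum (fun _ : Fin n => (Finset.univ : Finset X))
                (fun i a => ((N (a, y i) : ℝ) / n) / wordType y (y i))
              simpa using this.symm
          _ = 1 := by
              refine Finset.prod_eq_one fun i _ => ?_
              rw [← Finset.sum_div, hY, div_self (wordType_apply_pos y i).ne']
    _ = _ := one_mul _

theorem sum_condCls_comp_perm {n : ℕ} (N : X × Y → ℕ) (y : Fin n → Y) (σ : Equiv.Perm (Fin n))
    (f : X × Y → ℝ) :
    ∑ x ∈ condCls N (y ∘ σ), ∏ i, f (x i, (y ∘ σ) i) = ∑ x ∈ condCls N y, ∏ i, f (x i, y i) := by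
  symm
  refine Finset.sum_bij' (fun x _ => x ∘ σ) (fun x _ => x ∘ σ.symm) ?_ ?_ ?_ ?_ ?_
  · intro x hx
    rw [mem_condCls] at hx ⊢
    rw [← hx]
    exact cnt_comp_perm (pairW x y) σ
  · intro x hx
    rw [mem_condCls] at hx ⊢
    rw [← hx, ← cnt_comp_perm _ σ]
    congr 1
    funext i
    simp [pairW]
  · intro x _; funext i; simp
  · intro x _; funext i; simp
  · intro x _
    exact (Equiv.prod_comp σ fun i => f (x i, y i)).symm

/-- Under its own type `t` the joint class has at least polynomially small probability. By
permutation symmetry this splits evenly over the type class of `y`, whose size is at most `1 / ∏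
wordType y (y i)`. So the conditional class of `y` itself has at least that probability under the
reverse conditional law. -/
theorem sum_condCls_ge {Q : X → ℝ} (hQ : ∀ b, 0 ≤ Q b) {n : ℕ} {N : X × Y → ℕ} {y : Fin n → Y}
    {x0 : Fin n → X} (hx0 : cnt (pairW x0 y) = N) (h : ∀ a b, Q a = 0 → N (a, b) = 0) :
    Real.exp (-(n * condKL Q (fun b => (N b : ℝ) / n))) ≤
      ((n : ℝ) + 1) ^ Fintype.card (X × Y) * ∑ x ∈ condCls N y, ∏ i, Q (x i) := by
  set t : X × Y → ℝ := fun b => (N b : ℝ) / n with ht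
  have hx0' : x0 ∈ condCls N y := mem_condCls.2 hx0
  have hsum : ∑ b, N b = n := by rw [← hx0, sum_cnt]
  -- the weight of the conditional class under `t`
  set F : ℝ := ∑ x ∈ condCls N y, ∏ i, t (x i, y i) with hF
  have hF0 : 0 ≤ F := Finset.sum_nonneg fun _ _ => Finset.prod_nonneg fun _ _ => by
    simp only [ht]; positivity
  have hG : 0 < ∏ i, wordType y (y i) := Finset.prod_pos fun i _ => wordType_apply_pos y i
  have h1 : ∑ x ∈ condCls N y, ∏ i, Q (x i) =
      F / (∏ i, wordType y (y i)) * Real.exp (-(n * condKL Q t)) := by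
    rw [hF, Finset.sum_div, Finset.sum_mul]
    refine Finset.sum_congr rfl fun x hx => ?_
    have hpos : ∀ i, 0 < Q (x i) := fun i => lt_of_le_of_ne (hQ _) fun h0 => by
      have h2 := cnt_apply_pos (pairW x y) i
      rw [mem_condCls.1 hx] at h2
      exact lt_irrefl _ ((h (x i) (y i) h0.symm) ▸ h2)
    rw [prod_word_eq_exp_condKL x y hpos, wordType_of_mem_condCls hx, Finset.prod_div_distrib]
  have h2 : clsProb t N n = (cls (cnt y) n).card * F := by
    have e1 : clsProb t N n = ∑ y' : Fin n → Y, ∑ x ∈ condCls N y', ∏ i, t (x i, y' i) := by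
      unfold clsProb condCls
      simp_rw [Finset.sum_filter]
      rw [cls, Finset.sum_filter, ← Fintype.sum_prod_type_right']
      refine (Equiv.sum_comp (Equiv.arrowProdEquivProdArrow (Fin n) (fun _ => X) (fun _ => Y))
        (fun xy => if cnt (pairW xy.1 xy.2) = N then ∏ i, t (xy.1 i, xy.2 i) else 0)).symm.trans ?_ |>.symm
      rfl
    rw [e1, ← Finset.sum_subset (Finset.subset_univ (cls (cnt y) n))]
    · rw [← nsmul_eq_mul, ← Finset.sum_const]
      refine Finset.sum_congr rfl fun y' hy' => ?_
      obtain ⟨σ, rfl⟩ := exists_perm_of_cnt_eq (mem_cls.1 hy').symm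
      exact sum_condCls_comp_perm N y σ t
    · intro y' _ hy'
      refine Finset.sum_eq_zero_iff_of_nonneg (fun _ _ => Finset.prod_nonneg fun _ _ => by
        simp only [ht]; positivity) |>.2 fun x hx => ?_
      exfalso
      apply hy'
      rw [mem_cls]
      have e2 : wordType y' = wordType y := by
        rw [← margY_wordType x y', ← margY_wordType x0 y, wordType_of_mem_condCls hx,
          wordType_of_mem_condCls hx0']
      funext b
      have e3 := congrFun e2 b
      rw [wordType_eq, wordType_eq] at e3
      rcases Nat.eq_zero_or_pos n with rfl | hn
      · simp [cnt]
      · have hn' : (n : ℝ) ≠ 0 := by positivity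
        rw [div_left_inj' hn'] at e3
        exact_mod_cast e3
  have h3 : ((cls (cnt y) n).card : ℝ) * ∏ i, wordType y (y i) ≤ 1 := by
    rcases Nat.eq_zero_or_pos n with rfl | hn
    · have : (cls (cnt y) 0).card ≤ 1 := by
        refine Finset.card_le_one.2 fun a _ b _ => Subsingleton.elim _ _
      simpa using this
    · have := clsProb_le_one (wordType_mem hn y) (cnt y) n
      rw [clsProb_eq] at this
      rwa [prod_word y (wordType y)]
  have h4 := clsProb_self_ge N hsum
  have h5 : clsProb t N n ≤ F / ∏ i, wordType y (y i) := by
    rw [le_div_iff₀ hG, h2]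
    calc _ = (((cls (cnt y) n).card : ℝ) * ∏ i, wordType y (y i)) * F := by ring
      _ ≤ 1 * F := by gcongr
      _ = F := one_mul F
  rw [h1, ← mul_assoc]
  refine le_mul_of_one_le_left (Real.exp_nonneg _) (h4.trans ?_)
  gcongr

end Conditional

/-! ### The random-coding union bound and its tightness -/

section UnionBound

variable {X Y : Type*} [Fintype X] [Fintype Y]

/-- The probability that an independent codeword does at least as well as `x` on receiving `y`. -/
def beatProb (q : X → Y → ℝ) {n : ℕ} (PX : (Fin n → X) → ℝ) (x : Fin n → X) (y : Fin n → Y) : ℝ :=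
  ∑ x', if metricN q x y ≤ metricN q x' y then PX x' else 0

/-- The random-coding union bound with `k` competing codewords. -/
def rcu (W q : X → Y → ℝ) {n : ℕ} (k : ℕ) (PX : (Fin n → X) → ℝ) : ℝ :=
  ∑ x, ∑ y, PX x * chanN W x y * min 1 (k * beatProb q PX x y)

theorem one_sub_decodeProb_le (q : X → Y → ℝ) {n k : ℕ} (m : Fin (k + 1)) (x : Fin n → X)
    (C : Fin k → Fin n → X) (y : Fin n → Y) :
    1 - decodeProb q (m.insertNth x C : Fin (k + 1) → Fin n → X) y m ≤
      if ∃ j, metricN q x y ≤ metricN q (C j) y then 1 else 0 := by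
  split_ifs with h
  · have : 0 ≤ decodeProb q (m.insertNth x C : Fin (k + 1) → Fin n → X) y m := by
      unfold decodeProb; split_ifs <;> positivity
    linarith
  · push Not at h
    have hw : winners q (m.insertNth x C : Fin (k + 1) → Fin n → X) y = {m} := by
      ext j
      simp only [winners, Finset.mem_filter, Finset.mem_univ, true_and, Finset.mem_singleton]
      constructor
      · intro hj
        by_contra hne
        obtain ⟨j', rfl⟩ := Fin.exists_succAbove_eq hne
        have := hj m
        simp only [Fin.insertNth_apply_same, Fin.insertNth_apply_succAbove] at this
        exact absurd this (not_le.2 (h j'))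
      · rintro rfl i
        simp only [Fin.insertNth_apply_same]
        by_cases hi : i = j
        · subst hi; simp
        · obtain ⟨i', rfl⟩ := Fin.exists_succAbove_eq hi
          simp only [Fin.insertNth_apply_succAbove]
          exact (h i').le
    simp [decodeProb, hw]

/-- If `m` wins in spite of a competitor at least as good, that competitor wins too, so the uniform
tie-break picks `m` with probability at most 1/2. -/
theorem le_one_sub_decodeProb (q : X → Y → ℝ) {n k : ℕ} (m : Fin (k + 1)) (x : Fin n → X)
    (C : Fin k → Fin n → X) (y : Fin n → Y) :
    (1 / 2) * (if ∃ j, metricN q x y ≤ metricN q (C j) y then 1 else 0) ≤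
      1 - decodeProb q (m.insertNth x C : Fin (k + 1) → Fin n → X) y m := by
  unfold decodeProb
  split_ifs with h hm
  · obtain ⟨j, hj⟩ := h
    have hm' := (Finset.mem_filter.1 hm).2
    have hj' : m.succAbove j ∈ winners q (m.insertNth x C : Fin (k + 1) → Fin n → X) y := by
      simp only [winners, Finset.mem_filter, Finset.mem_univ, true_and]
      intro i
      refine (hm' i).trans ?_
      simpa using hj
    have hc : 1 < (winners q (m.insertNth x C : Fin (k + 1) → Fin n → X) y).card :=
      Finset.one_lt_card.2 ⟨_, hj', m, hm, Fin.succAbove_ne m j⟩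
    have hc' : (2 : ℝ) ≤ (winners q (m.insertNth x C : Fin (k + 1) → Fin n → X) y).card := by
      exact_mod_cast hc
    have : 1 / ((winners q (m.insertNth x C : Fin (k + 1) → Fin n → X) y).card : ℝ) ≤ 1 / 2 :=
      one_div_le_one_div_of_le (by norm_num) hc'
    linarith
  · norm_num
  · rename_i hm
    have hc : 0 < (winners q (m.insertNth x C : Fin (k + 1) → Fin n → X) y).card :=
      Finset.card_pos.2 ⟨m, hm⟩
    have : 1 / ((winners q (m.insertNth x C : Fin (k + 1) → Fin n → X) y).card : ℝ) ≤ 1 :=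
      div_le_one_of_le₀ (by exact_mod_cast hc) (by positivity)
    linarith
  · norm_num

/-- Complement of the event that all `k` independent draws avoid `p`. -/
theorem sum_exists_eq {α : Type*} [Fintype α] {P : α → ℝ} (hP : P ∈ stdSimplex ℝ α) (k : ℕ)
    (p : α → Prop) :
    ∑ C : Fin k → α, (∏ j, P (C j)) * (if ∃ j, p (C j) then (1 : ℝ) else 0) =
      1 - (1 - ∑ b, if p b then P b else 0) ^ k := by
  have h1 : ∀ C : Fin k → α, (∏ j, P (C j)) * (if ∃ j, p (C j) then (1 : ℝ) else 0) =
      ∏ j, P (C j) - ∏ j, (if p (C j) then 0 else P (C j)) := by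
    intro C
    split_ifs with h
    · obtain ⟨j, hj⟩ := h
      rw [Finset.prod_eq_zero (f := fun j => if p (C j) then 0 else P (C j)) (Finset.mem_univ j)
        (by simp [hj])]
      ring
    · push Not at h
      simp [h]
  simp_rw [h1]
  rw [Finset.sum_sub_distrib, sum_prod_word, hP.2, one_pow,
    sum_prod_word (fun b => if p b then 0 else P b)]
  congr 2
  rw [← hP.2, ← Finset.sum_sub_distrib]
  refine Finset.sum_congr rfl fun b _ => ?_
  split_ifs <;> simp

theorem one_sub_pow_le_min {β : ℝ} (h1 : β ≤ 1) (k : ℕ) :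
    1 - (1 - β) ^ k ≤ min 1 (k * β) := by
  refine le_min ?_ ?_
  · have : 0 ≤ (1 - β) ^ k := pow_nonneg (by linarith) k
    linarith
  · have := one_add_mul_le_pow (a := -β) (by linarith) k
    have h2 : (1 + -β) ^ k = (1 - β) ^ k := by ring
    rw [h2] at this
    linarith

/-- With `u = k β`, one has `(1 - β) ^ k ≤ exp (-u) ≤ 1 / (1 + u)`, and `u / (1 + u) ≥ min 1 u / 2`.
So for independent competitors the truncated union bound is tight up to a factor 2. -/
theorem min_le_one_sub_pow {β : ℝ} (h0 : 0 ≤ β) (h1 : β ≤ 1) (k : ℕ) :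
    (1 / 2) * min 1 (k * β) ≤ 1 - (1 - β) ^ k := by
  set u : ℝ := k * β with hu
  have hu0 : 0 ≤ u := by positivity
  have h2 : (1 - β) ^ k ≤ Real.exp (-u) := by
    rw [hu, ← mul_neg, Real.exp_nat_mul]
    exact pow_le_pow_left₀ (by linarith) (by have := Real.add_one_le_exp (-β); linarith) k
  have h3 : Real.exp (-u) ≤ 1 / (1 + u) := by
    rw [Real.exp_neg, ← one_div]
    exact one_div_le_one_div_of_le (by linarith) (by have := Real.add_one_le_exp u; linarith)
  have h4 : 1 / (1 + u) ≤ 1 - (1 / 2) * min 1 u := by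
    rw [div_le_iff₀ (by linarith)]
    rcases le_total 1 u with h | h
    · rw [min_eq_left h]; linarith
    · rw [min_eq_right h]; nlinarith
  linarith

theorem beatProb_nonneg (q : X → Y → ℝ) {n : ℕ} {PX : (Fin n → X) → ℝ} (hP : ∀ x, 0 ≤ PX x)
    (x : Fin n → X) (y : Fin n → Y) : 0 ≤ beatProb q PX x y :=
  Finset.sum_nonneg fun x' _ => by split_ifs <;> simp [hP]

theorem beatProb_le_one (q : X → Y → ℝ) {n : ℕ} {PX : (Fin n → X) → ℝ}
    (hP : PX ∈ stdSimplex ℝ (Fin n → X)) (x : Fin n → X) (y : Fin n → Y) :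
    beatProb q PX x y ≤ 1 := by
  rw [← hP.2]
  exact Finset.sum_le_sum fun x' _ => by split_ifs <;> simp [hP.1]

theorem chanN_nonneg {W : X → Y → ℝ} (hW : IsChannel W) {n : ℕ} (x : Fin n → X) (y : Fin n → Y) :
    0 ≤ chanN W x y := Finset.prod_nonneg fun _ _ => (hW _).1 _

/-- `Fin.insertNth` separates the codeword of the sent message from its `k` competitors, which can
then be averaged first. -/
theorem avgErrProb_eq (W q : X → Y → ℝ) {n : ℕ} (k : ℕ) (PX : (Fin n → X) → ℝ) :
    avgErrProb W q (k + 1) PX = (1 / ((k + 1 : ℕ) : ℝ)) * ∑ m : Fin (k + 1), ∑ x, ∑ y,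
      PX x * chanN W x y * ∑ C : Fin k → Fin n → X, (∏ j, PX (C j)) *
        (1 - decodeProb q (m.insertNth x C : Fin (k + 1) → Fin n → X) y m) := by
  unfold avgErrProb errProb
  simp_rw [mul_left_comm _ (1 / ((k + 1 : ℕ) : ℝ))]
  rw [← Finset.mul_sum]
  congr 1
  simp_rw [Finset.mul_sum (s := (Finset.univ : Finset (Fin (k + 1))))]
  rw [Finset.sum_comm]
  refine Finset.sum_congr rfl fun m _ => ?_
  rw [← Equiv.sum_comp (Fin.insertNthEquiv (fun _ => Fin n → X) m), Fintype.sum_prod_type]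
  refine Finset.sum_congr rfl fun x _ => ?_
  simp_rw [Finset.mul_sum]
  rw [Finset.sum_comm]
  refine Finset.sum_congr rfl fun y _ => Finset.sum_congr rfl fun C _ => ?_
  simp only [Fin.insertNthEquiv, Equiv.coe_fn_mk]
  rw [Fin.prod_univ_succAbove _ m]
  simp only [Fin.insertNth_apply_same, Fin.insertNth_apply_succAbove]
  ring

theorem avgErrProb_le_rcu {W : X → Y → ℝ} (hW : IsChannel W) (q : X → Y → ℝ) {n : ℕ} (k : ℕ)
    {PX : (Fin n → X) → ℝ} (hP : PX ∈ stdSimplex ℝ (Fin n → X)) :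
    avgErrProb W q (k + 1) PX ≤ rcu W q k PX := by
  rw [avgErrProb_eq]
  have : ∀ m ∈ (Finset.univ : Finset (Fin (k + 1))), (∑ x, ∑ y,
      PX x * chanN W x y * ∑ C : Fin k → Fin n → X, (∏ j, PX (C j)) *
        (1 - decodeProb q (m.insertNth x C : Fin (k + 1) → Fin n → X) y m)) ≤ rcu W q k PX := by
    intro m _
    refine Finset.sum_le_sum fun x _ => Finset.sum_le_sum fun y _ => ?_
    refine mul_le_mul_of_nonneg_left ?_ (mul_nonneg (hP.1 x) (chanN_nonneg hW x y))
    refine le_trans (Finset.sum_le_sum fun C _ => mul_le_mul_of_nonneg_left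
      (one_sub_decodeProb_le q m x C y) (Finset.prod_nonneg fun j _ => hP.1 _)) ?_
    rw [sum_exists_eq hP k fun x' => metricN q x y ≤ metricN q x' y]
    exact one_sub_pow_le_min (beatProb_le_one q hP x y) k
  have h2 := Finset.sum_le_card_nsmul _ _ _ this
  rw [Finset.card_univ, Fintype.card_fin, nsmul_eq_mul] at h2
  rw [one_div, inv_mul_le_iff₀ (by positivity)]
  exact h2

/-- The 4 is a factor 2 for ties times a factor 2 for truncating the union bound. -/
theorem rcu_le_avgErrProb {W : X → Y → ℝ} (hW : IsChannel W) (q : X → Y → ℝ) {n : ℕ} (k : ℕ)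
    {PX : (Fin n → X) → ℝ} (hP : PX ∈ stdSimplex ℝ (Fin n → X)) :
    rcu W q k PX ≤ 4 * avgErrProb W q (k + 1) PX := by
  rw [avgErrProb_eq]
  have : ∀ m ∈ (Finset.univ : Finset (Fin (k + 1))), rcu W q k PX / 4 ≤ (∑ x, ∑ y,
      PX x * chanN W x y * ∑ C : Fin k → Fin n → X, (∏ j, PX (C j)) *
        (1 - decodeProb q (m.insertNth x C : Fin (k + 1) → Fin n → X) y m)) := by
    intro m _
    rw [rcu, Finset.sum_div]
    refine Finset.sum_le_sum fun x _ => ?_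
    rw [Finset.sum_div]
    refine Finset.sum_le_sum fun y _ => ?_
    rw [mul_div_assoc]
    refine mul_le_mul_of_nonneg_left ?_ (mul_nonneg (hP.1 x) (chanN_nonneg hW x y))
    refine le_trans ?_ (Finset.sum_le_sum fun C _ => mul_le_mul_of_nonneg_left
      (le_one_sub_decodeProb q m x C y) (Finset.prod_nonneg fun j _ => hP.1 _))
    simp_rw [mul_left_comm _ (1 / 2 : ℝ)]
    rw [← Finset.mul_sum, sum_exists_eq hP k fun x' => metricN q x y ≤ metricN q x' y]
    have := min_le_one_sub_pow (beatProb_nonneg q hP.1 x y) (beatProb_le_one q hP x y) k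
    unfold beatProb at this ⊢
    linarith
  have h2 := Finset.card_nsmul_le_sum _ _ _ this
  rw [Finset.card_univ, Fintype.card_fin, nsmul_eq_mul] at h2
  rw [one_div, ← div_le_iff₀' (by norm_num), le_inv_mul_iff₀ (by positivity)]
  exact h2

end UnionBound

/-! ### The exponent as a minimum over a compact set -/

section Minimum

variable {X Y : Type*} [Fintype X] [Fintype Y]

theorem joint_mem {Q : X → ℝ} (hQ : Q ∈ stdSimplex ℝ X) {W : X → Y → ℝ} (hW : IsChannel W) :
    joint Q W ∈ stdSimplex ℝ (X × Y) := by
  refine ⟨fun p => mul_nonneg (hQ.1 _) ((hW _).1 _), ?_⟩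
  rw [Fintype.sum_prod_type]
  simp_rw [joint, ← Finset.mul_sum, (hW _).2, mul_one]
  exact hQ.2

theorem prodDist_mem {Q : X → ℝ} (hQ : Q ∈ stdSimplex ℝ X) {S : Y → ℝ} (hS : S ∈ stdSimplex ℝ Y) :
    prodDist Q S ∈ stdSimplex ℝ (X × Y) := by
  refine ⟨fun p => mul_nonneg (hQ.1 _) (hS.1 _), ?_⟩
  rw [Fintype.sum_prod_type]
  simp_rw [prodDist, ← Finset.mul_sum, hS.2, mul_one]
  exact hQ.2

theorem margY_mem {P : X × Y → ℝ} (hP : P ∈ stdSimplex ℝ (X × Y)) : margY P ∈ stdSimplex ℝ Y := by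
  refine ⟨fun y => Finset.sum_nonneg fun x _ => hP.1 _, ?_⟩
  rw [← hP.2, Fintype.sum_prod_type_right]
  rfl

theorem margX_joint (Q : X → ℝ) {W : X → Y → ℝ} (hW : IsChannel W) : margX (joint Q W) = Q := by
  funext x
  simp_rw [margX, joint, ← Finset.mul_sum, (hW _).2, mul_one]

theorem margX_prodDist (Q : X → ℝ) {S : Y → ℝ} (hS : S ∈ stdSimplex ℝ Y) :
    margX (prodDist Q S) = Q := by
  funext x
  simp_rw [margX, prodDist, ← Finset.mul_sum, hS.2, mul_one]

theorem margY_prodDist {Q : X → ℝ} (hQ : Q ∈ stdSimplex ℝ X) (S : Y → ℝ) :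
    margY (prodDist Q S) = S := by
  funext y
  simp_rw [margY, prodDist, ← Finset.sum_mul, hQ.2, one_mul]

theorem eq_zero_of_margY_eq_zero {P : X × Y → ℝ} (hP : ∀ p, 0 ≤ P p) {y : Y} (h : margY P y = 0)
    (x : X) : P (x, y) = 0 := by
  by_contra h'
  exact (margY_pos hP h').ne' h

theorem continuous_mean_margX (f : X → ℝ) : Continuous fun P : X × Y → ℝ => mean (margX P) f :=
  continuous_finsetSum _ fun x _ =>
    ((continuous_apply x).comp continuous_margX).mul continuous_const

theorem meanLog_of_ac {q : X → Y → ℝ} {P : X × Y → ℝ} (h : ∀ x y, q x y = 0 → P (x, y) = 0) :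
    meanLog q P = ((∑ p, P p * Real.log (q p.1 p.2) : ℝ) : EReal) := if_pos h

theorem isClosed_setOf_imp_eq_zero {α : Type*} (p : α → Prop) :
    IsClosed {P : α → ℝ | ∀ b, p b → P b = 0} := by
  simp only [Set.ofPred_forall]
  exact isClosed_iInter fun b => isClosed_iInter fun _ =>
    isClosed_eq (continuous_apply b) continuous_const

theorem continuous_sum_mul {α : Type*} [Fintype α] (f : α → ℝ) :
    Continuous fun P : α → ℝ => ∑ b, P b * f b :=
  continuous_finsetSum _ fun b _ => (continuous_apply b).mul continuous_const

/-- Upper semicontinuity of `meanLog q`: for real `c` the condition is the closed support condition,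
on which the mean is finite, together with a linear inequality. -/
theorem isClosed_setOf_le_meanLog (q : X → Y → ℝ) (c : EReal) :
    IsClosed {P : X × Y → ℝ | c ≤ meanLog q P} := by
  induction c with
  | bot => simp
  | top =>
    have : {P : X × Y → ℝ | ⊤ ≤ meanLog q P} = ∅ := by
      ext P
      simp only [meanLog, Set.mem_ofPred_eq, Set.mem_empty_iff_false, iff_false, top_le_iff]
      split_ifs <;> simp
    rw [this]
    exact isClosed_empty
  | coe c =>
    have : {P : X × Y → ℝ | (c : EReal) ≤ meanLog q P} =
        {P | ∀ p : X × Y, q p.1 p.2 = 0 → P p = 0} ∩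
          {P | c ≤ ∑ p, P p * Real.log (q p.1 p.2)} := by
      ext P
      simp only [meanLog, Set.mem_ofPred_eq, Set.mem_inter_iff, Prod.forall]
      split_ifs with h
      · rw [EReal.coe_le_coe_iff]
        exact ⟨fun h' => ⟨h, h'⟩, fun h' => h'.2⟩
      · exact ⟨fun h' => absurd h' (by simp), fun h' => absurd h'.1 h⟩
    rw [this]
    exact (isClosed_setOf_imp_eq_zero _).inter
      (isClosed_le continuous_const (continuous_sum_mul fun p : X × Y => Real.log (q p.1 p.2)))

theorem relEnt_ne_bot {α : Type*} [Fintype α] (P S : α → ℝ) : relEnt P S ≠ ⊥ := by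
  unfold relEnt; split_ifs <;> simp

theorem relEnt_eq_top {α : Type*} [Fintype α] {P S : α → ℝ} (h : ¬∀ b, S b = 0 → P b = 0) :
    relEnt P S = ⊤ := if_neg h

theorem prodDist_ac_iff {Q : X → ℝ} {P' : X × Y → ℝ} (hP : ∀ p, 0 ≤ P' p) :
    (∀ b, prodDist Q (margY P') b = 0 → P' b = 0) ↔ ∀ x y, Q x = 0 → P' (x, y) = 0 := by
  constructor
  · exact fun h x y hx => h (x, y) (by simp [prodDist, hx])
  · rintro h ⟨x, y⟩ hb
    rcases mul_eq_zero.1 hb with h0 | h0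
    · exact h x y h0
    · exact eq_zero_of_margY_eq_zero hP h0 x

/-- The real form of the objective. -/
def objR (Q : X → ℝ) (W : X → Y → ℝ) (R : ℝ) (P P' : X × Y → ℝ) : ℝ :=
  klR P (joint Q W) + max (condKL Q P' - R) 0

theorem continuous_objR (Q : X → ℝ) (W : X → Y → ℝ) (R : ℝ) :
    Continuous fun p : (X × Y → ℝ) × (X × Y → ℝ) => objR Q W R p.1 p.2 :=
  ((continuous_klR _).comp continuous_fst).add
    ((((continuous_condKL Q).comp continuous_snd).sub continuous_const).max continuous_const)

theorem objective_eq {Q : X → ℝ} {W : X → Y → ℝ} (R : ℝ) {P P' : X × Y → ℝ}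
    (hP' : ∀ p, 0 ≤ P' p) (hY : margY P' = margY P) (h1 : ∀ b, joint Q W b = 0 → P b = 0)
    (h2 : ∀ x y, Q x = 0 → P' (x, y) = 0) :
    objective Q W R P P' = (objR Q W R P P' : EReal) := by
  rw [objective, relEnt_of_ac h1, ← hY, relEnt_of_ac ((prodDist_ac_iff hP').2 h2),
    ← condKL_eq_klR hP' h2, objR, EReal.coe_add,
    EReal.coe_strictMono.monotone.map_max, EReal.coe_sub, EReal.coe_zero]

theorem objective_eq_top_of_left {Q : X → ℝ} {W : X → Y → ℝ} (R : ℝ) {P : X × Y → ℝ}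
    (P' : X × Y → ℝ) (h : ¬∀ b, joint Q W b = 0 → P b = 0) : objective Q W R P P' = ⊤ := by
  rw [objective, relEnt_eq_top h]
  exact EReal.top_add_of_ne_bot (ne_bot_of_le_ne_bot EReal.zero_ne_bot (le_max_right _ _))

theorem objective_eq_top_of_right {Q : X → ℝ} {W : X → Y → ℝ} (R : ℝ) {P P' : X × Y → ℝ}
    (hP' : ∀ p, 0 ≤ P' p) (hY : margY P' = margY P) (h : ¬∀ x y, Q x = 0 → P' (x, y) = 0) :
    objective Q W R P P' = ⊤ := by
  rw [objective, ← hY, relEnt_eq_top (fun h' => h ((prodDist_ac_iff hP').1 h')), EReal.top_sub_coe,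
    max_eq_left le_top]
  exact EReal.add_top_of_ne_bot (relEnt_ne_bot _ _)

theorem objective_nonneg {Q : X → ℝ} (hQ : Q ∈ stdSimplex ℝ X) {W : X → Y → ℝ} (hW : IsChannel W)
    (R : ℝ) {P : X × Y → ℝ} (hP : P ∈ stdSimplex ℝ (X × Y)) (P' : X × Y → ℝ) :
    0 ≤ objective Q W R P P' :=
  add_nonneg (relEnt_nonneg hP (joint_mem hQ hW)) (le_max_right _ _)

theorem isClosed_setTcost (Q : X → ℝ) (q : X → Y → ℝ) {L : ℕ} (a : Fin L → X → ℝ)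
    (P : X × Y → ℝ) : IsClosed (setTcost Q q a P) := by
  have : setTcost Q q a P = stdSimplex ℝ (X × Y) ∩
      ((⋂ l, {P' | mean (margX P') (a l) = mean Q (a l)}) ∩
        ({P' | margY P' = margY P} ∩ {P' | meanLog q P ≤ meanLog q P'})) := by
    ext P'
    simp only [setTcost, Set.mem_ofPred_eq, Set.mem_inter_iff, Set.mem_iInter]
  rw [this]
  refine (isClosed_stdSimplex ℝ _).inter (IsClosed.inter ?_ (IsClosed.inter ?_ ?_))
  · exact isClosed_iInter fun l => isClosed_eq (continuous_mean_margX _) continuous_const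
  · exact isClosed_eq continuous_margY continuous_const
  · exact isClosed_setOf_le_meanLog q _

/-- When `P ≪ Q × W`, the objective is finite and continuous on the compact part `K` of the
constraint set where `P'` charges no zero of `Q`, and is `⊤` off `K`. Otherwise it is identically
`⊤` and any element is a minimizer. -/
theorem exists_isMinOn_setTcost (Q : X → ℝ) (W q : X → Y → ℝ) (R : ℝ) {L : ℕ}
    (a : Fin L → X → ℝ) {P : X × Y → ℝ} (hP : P ∈ setScost Q a) :
    ∃ P' ∈ setTcost Q q a P, IsMinOn (objective Q W R P) (setTcost Q q a P) P' := by
  have hPT : P ∈ setTcost Q q a P := ⟨hP.1, hP.2, rfl, le_rfl⟩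
  by_cases h1 : ∀ b, joint Q W b = 0 → P b = 0
  swap
  · exact ⟨P, hPT, fun P' _ => by
      simp only [Set.mem_ofPred_eq, objective_eq_top_of_left R _ h1, le_refl]⟩
  set K : Set (X × Y → ℝ) := setTcost Q q a P ∩ {P' | ∀ b : X × Y, Q b.1 = 0 → P' b = 0} with hK
  have hKc : IsCompact K := by
    refine (isCompact_stdSimplex ℝ (X × Y)).of_isClosed_subset
      ((isClosed_setTcost Q q a P).inter (isClosed_setOf_imp_eq_zero _)) fun P' h => h.1.1
  by_cases hne : K.Nonempty
  · obtain ⟨P', hP', hmin⟩ := hKc.exists_isMinOn hne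
      ((continuous_objR Q W R).comp (Continuous.prodMk_right P)).continuousOn
    refine ⟨P', hP'.1, fun P'' hP'' => ?_⟩
    have e1 := objective_eq R hP'.1.1.1 hP'.1.2.2.1 h1 (fun x y h => hP'.2 (x, y) h)
    simp only [Set.mem_ofPred_eq]
    by_cases h2 : ∀ x y, Q x = 0 → P'' (x, y) = 0
    · rw [e1, objective_eq R hP''.1.1 hP''.2.2.1 h1 h2, EReal.coe_le_coe_iff]
      exact hmin ⟨hP'', fun b hb => h2 b.1 b.2 hb⟩
    · rw [objective_eq_top_of_right R hP''.1.1 hP''.2.2.1 h2]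
      exact le_top
  · refine ⟨P, hPT, fun P'' hP'' => ?_⟩
    have h2 : ¬∀ x y, Q x = 0 → P'' (x, y) = 0 := fun h2 =>
      hne ⟨P'', hP'', fun b hb => h2 b.1 b.2 hb⟩
    simp only [Set.mem_ofPred_eq, objective_eq_top_of_right R hP''.1.1 hP''.2.2.1 h2]
    exact le_top

/-- The pairs of distributions with finite objective, when `q > 0` on the support of `Q × W`. -/
def feasible (Q : X → ℝ) (W q : X → Y → ℝ) {L : ℕ} (a : Fin L → X → ℝ) :
    Set ((X × Y → ℝ) × (X × Y → ℝ)) :=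
  {p | (p.1 ∈ stdSimplex ℝ (X × Y) ∧ p.2 ∈ stdSimplex ℝ (X × Y)) ∧
    (∀ l, mean (margX p.1) (a l) = mean Q (a l)) ∧ (∀ l, mean (margX p.2) (a l) = mean Q (a l)) ∧
    margY p.2 = margY p.1 ∧ (∀ b, joint Q W b = 0 → p.1 b = 0) ∧
    (∀ b : X × Y, Q b.1 = 0 → p.2 b = 0) ∧ (∀ b : X × Y, q b.1 b.2 = 0 → p.2 b = 0) ∧
    ∑ b, p.1 b * Real.log (q b.1 b.2) ≤ ∑ b, p.2 b * Real.log (q b.1 b.2)}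

theorem isCompact_feasible (Q : X → ℝ) (W q : X → Y → ℝ) {L : ℕ} (a : Fin L → X → ℝ) :
    IsCompact (feasible Q W q a) := by
  have : feasible Q W q a = (stdSimplex ℝ (X × Y) ×ˢ stdSimplex ℝ (X × Y)) ∩
      ((⋂ l, {p | mean (margX p.1) (a l) = mean Q (a l)}) ∩
      ((⋂ l, {p | mean (margX p.2) (a l) = mean Q (a l)}) ∩
      ({p | margY p.2 = margY p.1} ∩ ((Prod.fst ⁻¹' {P | ∀ b, joint Q W b = 0 → P b = 0}) ∩
      ((Prod.snd ⁻¹' {P | ∀ b : X × Y, Q b.1 = 0 → P b = 0}) ∩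
      ((Prod.snd ⁻¹' {P | ∀ b : X × Y, q b.1 b.2 = 0 → P b = 0}) ∩
        {p | ∑ b, p.1 b * Real.log (q b.1 b.2) ≤ ∑ b, p.2 b * Real.log (q b.1 b.2)})))))) := by
    ext p
    simp only [feasible, Set.mem_ofPred_eq, Set.mem_inter_iff, Set.mem_prod, Set.mem_iInter,
      Set.mem_preimage]
  rw [this]
  refine ((isCompact_stdSimplex ℝ _).prod (isCompact_stdSimplex ℝ _)).inter_right ?_
  refine IsClosed.inter ?_ (IsClosed.inter ?_ (IsClosed.inter ?_ (IsClosed.inter ?_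
    (IsClosed.inter ?_ (IsClosed.inter ?_ ?_)))))
  · exact isClosed_iInter fun l =>
      isClosed_eq ((continuous_mean_margX _).comp continuous_fst) continuous_const
  · exact isClosed_iInter fun l =>
      isClosed_eq ((continuous_mean_margX _).comp continuous_snd) continuous_const
  · exact isClosed_eq (continuous_margY.comp continuous_snd) (continuous_margY.comp continuous_fst)
  · exact (isClosed_setOf_imp_eq_zero _).preimage continuous_fst
  · exact (isClosed_setOf_imp_eq_zero _).preimage continuous_snd
  · exact (isClosed_setOf_imp_eq_zero _).preimage continuous_snd
  · exact isClosed_le ((continuous_sum_mul _).comp continuous_fst)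
      ((continuous_sum_mul _).comp continuous_snd)

theorem mem_of_feasible {Q : X → ℝ} {W q : X → Y → ℝ}
    (hqW : ∀ x y, q x y = 0 → Q x * W x y = 0) {L : ℕ} {a : Fin L → X → ℝ}
    {p : (X × Y → ℝ) × (X × Y → ℝ)} (hp : p ∈ feasible Q W q a) :
    p.1 ∈ setScost Q a ∧ p.2 ∈ setTcost Q q a p.1 := by
  obtain ⟨⟨h1, h2⟩, h3, h4, h5, h6, h7, h8, h9⟩ := hp
  refine ⟨⟨h1, h3⟩, h2, h4, h5, ?_⟩
  rw [meanLog_of_ac fun x y h => h6 (x, y) (hqW x y h), meanLog_of_ac fun x y h => h8 (x, y) h]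
  exact_mod_cast h9

theorem objective_of_feasible {Q : X → ℝ} {W q : X → Y → ℝ} (R : ℝ) {L : ℕ} {a : Fin L → X → ℝ}
    {p : (X × Y → ℝ) × (X × Y → ℝ)} (hp : p ∈ feasible Q W q a) :
    objective Q W R p.1 p.2 = (objR Q W R p.1 p.2 : EReal) := by
  obtain ⟨⟨_, h2⟩, _, _, h5, h6, h7, _⟩ := hp
  exact objective_eq R h2.1 h5 h6 fun x y h => h7 (x, y) h

/-- A finite objective gives `P ≪ Q × W`, so `P` charges no zero of `q` and `meanLog q P` is real;
the metric constraint then forces `P'` to charge no zero of `q` either. -/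
theorem feasible_of_mem {Q : X → ℝ} {W q : X → Y → ℝ}
    (hqW : ∀ x y, q x y = 0 → Q x * W x y = 0) (R : ℝ) {L : ℕ} {a : Fin L → X → ℝ}
    {P P' : X × Y → ℝ} (hP : P ∈ setScost Q a) (hP' : P' ∈ setTcost Q q a P)
    (hobj : objective Q W R P P' ≠ ⊤) : (P, P') ∈ feasible Q W q a := by
  have h1 : ∀ b, joint Q W b = 0 → P b = 0 := by
    by_contra h
    exact hobj (objective_eq_top_of_left R _ h)
  have h2 : ∀ x y, Q x = 0 → P' (x, y) = 0 := by
    by_contra h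
    exact hobj (objective_eq_top_of_right R hP'.1.1 hP'.2.2.1 h)
  have h3 := hP'.2.2.2
  rw [meanLog_of_ac fun x y h => h1 (x, y) (hqW x y h)] at h3
  have h4 : ∀ x y, q x y = 0 → P' (x, y) = 0 := by
    by_contra h
    rw [meanLog, if_neg h] at h3
    exact absurd h3 (by simp)
  rw [meanLog_of_ac h4, EReal.coe_le_coe_iff] at h3
  exact ⟨⟨hP.1, hP'.1⟩, hP.2, hP'.2.1, hP'.2.2.1, h1, fun b hb => h2 b.1 b.2 hb,
    fun b hb => h4 b.1 b.2 hb, h3⟩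

theorem expCost_le {Q : X → ℝ} {W q : X → Y → ℝ} (R : ℝ) {L : ℕ} {a : Fin L → X → ℝ}
    {P P' : X × Y → ℝ} (hP : P ∈ setScost Q a) (hP' : P' ∈ setTcost Q q a P) :
    expCost Q W q R a ≤ objective Q W R P P' :=
  (iInf₂_le P hP).trans (iInf₂_le P' hP')

/-- The pair `(Q × W, Q × W)` is feasible, so the continuous `objR` has a minimum on a nonempty
compact set; the pairs left out have objective `⊤`. -/
theorem exists_feasible_min {Q : X → ℝ} (hQ : Q ∈ stdSimplex ℝ X) {W : X → Y → ℝ}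
    (hW : IsChannel W) {q : X → Y → ℝ} (hqW : ∀ x y, q x y = 0 → Q x * W x y = 0) (R : ℝ) {L : ℕ}
    (a : Fin L → X → ℝ) :
    ∃ p ∈ feasible Q W q a, (∀ p' ∈ feasible Q W q a, objR Q W R p.1 p.2 ≤ objR Q W R p'.1 p'.2) ∧
      expCost Q W q R a = (objR Q W R p.1 p.2 : EReal) := by
  have hne : (feasible Q W q a).Nonempty := by
    refine ⟨(joint Q W, joint Q W), ⟨joint_mem hQ hW, joint_mem hQ hW⟩, ?_, ?_, rfl, fun _ h => h,
      fun b h => by simp [joint, h], fun b h => hqW _ _ h, le_rfl⟩ <;>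
    · intro l; simp only [margX_joint Q hW]
  obtain ⟨p, hp, hmin⟩ := (isCompact_feasible Q W q a).exists_isMinOn hne
    (continuous_objR Q W R).continuousOn
  refine ⟨p, hp, fun p' hp' => hmin hp', le_antisymm ?_ ?_⟩
  · rw [← objective_of_feasible R hp]
    exact expCost_le R (mem_of_feasible hqW hp).1 (mem_of_feasible hqW hp).2
  · refine le_iInf₂ fun P hP => le_iInf₂ fun P' hP' => ?_
    by_cases htop : objective Q W R P P' = ⊤
    · rw [htop]; exact le_top
    · have hf := feasible_of_mem hqW R hP hP' htop
      rw [objective_of_feasible R hf, EReal.coe_le_coe_iff]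
      exact hmin hf

/-- If `Q × W` charges a zero of `q`, the exponent vanishes. -/
theorem exists_min_of_zero {Q : X → ℝ} (hQ : Q ∈ stdSimplex ℝ X) {W : X → Y → ℝ}
    (hW : IsChannel W) {q : X → Y → ℝ} (hqW : ¬∀ x y, q x y = 0 → Q x * W x y = 0) {R : ℝ}
    (hR : 0 < R) {L : ℕ} (a : Fin L → X → ℝ) :
    expCost Q W q R a = 0 ∧ ∃ P ∈ setScost Q a, ∃ P' ∈ setTcost Q q a P,
      objective Q W R P P' = 0 := by
  have hY := margY_mem (joint_mem hQ hW)
  have hS : joint Q W ∈ setScost Q a :=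
    ⟨joint_mem hQ hW, fun l => by rw [margX_joint Q hW]⟩
  -- With `meanLog q (Q × W) = ⊥` the metric constraint is void, so the competitor may be
  -- independent of the output, at zero relative entropy.
  have hT : prodDist Q (margY (joint Q W)) ∈ setTcost Q q a (joint Q W) := by
    refine ⟨prodDist_mem hQ hY, fun l => by rw [margX_prodDist Q hY], margY_prodDist hQ _, ?_⟩
    have : meanLog q (joint Q W) = ⊥ := if_neg hqW
    rw [this]
    exact bot_le
  have h0 : objective Q W R (joint Q W) (prodDist Q (margY (joint Q W))) = 0 := by
    rw [objective, relEnt_of_ac (fun _ h => h), relEnt_of_ac (fun _ h => h), klR_self, klR_self]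
    norm_num
    exact_mod_cast hR.le
  refine ⟨le_antisymm (h0 ▸ expCost_le R hS hT) ?_, _, hS, _, hT, h0⟩
  exact le_iInf₂ fun P hP => le_iInf₂ fun P' _ => objective_nonneg hQ hW R hP.1 P'

theorem expCost_attained {Q : X → ℝ} (hQ : Q ∈ stdSimplex ℝ X) {W : X → Y → ℝ}
    (hW : IsChannel W) (q : X → Y → ℝ) {R : ℝ} (hR : 0 < R) {L : ℕ} (a : Fin L → X → ℝ) :
    (∃ P ∈ setScost (Y := Y) Q a, ∃ P' ∈ setTcost Q q a P,
      objective Q W R P P' = expCost Q W q R a) ∧ expCost Q W q R a ≠ ⊤ := by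
  by_cases hqW : ∀ x y, q x y = 0 → Q x * W x y = 0
  · obtain ⟨p, hp, -, he⟩ := exists_feasible_min hQ hW hqW R a
    obtain ⟨h1, h2⟩ := mem_of_feasible hqW hp
    exact ⟨⟨p.1, h1, p.2, h2, by rw [he, objective_of_feasible R hp]⟩, he ▸ EReal.coe_ne_top _⟩
  · obtain ⟨h0, P, hP, P', hP', h⟩ := exists_min_of_zero hQ hW hqW hR a
    exact ⟨⟨P, hP, P', hP', by rw [h, h0]⟩, h0 ▸ EReal.zero_ne_top⟩

/-! ### The special costs -/

theorem expCost_eq_expIid (Q : X → ℝ) (W q : X → Y → ℝ) (R : ℝ) (a : Fin 0 → X → ℝ) :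
    expCost Q W q R a = expIid Q W q R := by
  simp only [expCost, expIid, setScost, setTcost, objective, IsEmpty.forall_iff, and_true, true_and,
    Set.mem_ofPred_eq]

theorem mean_indicator_eq_iff {L : ℕ} (e : Fin L ≃ X) (P Q : X → ℝ) :
    (∀ l, mean P (fun x => if x = e l then (1 : ℝ) else 0) =
      mean Q (fun x => if x = e l then (1 : ℝ) else 0)) ↔ P = Q := by
  constructor
  · intro h
    funext x
    simpa [mean] using h (e.symm x)
  · rintro rfl l; rfl

/-- The indicator costs fix both `X`-marginals to `Q`, and then `D(P'‖Q × P_Y)` is the mutual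
information of `P'`. -/
theorem expCost_eq_expCC (Q : X → ℝ) (W q : X → Y → ℝ) (R : ℝ) {L : ℕ} (e : Fin L ≃ X) :
    expCost Q W q R (fun l x => if x = e l then (1 : ℝ) else 0) = expCC Q W q R := by
  unfold expCost expCC setScost setTcost
  simp only [mean_indicator_eq_iff e]
  refine iInf_congr fun P => iInf_congr fun _ => iInf_congr fun P' => iInf_congr fun hP' => ?_
  rw [objective, mutualInfo, hP'.2.1, hP'.2.2.1]

end Minimum

/-! ### Ensembles of i.i.d. words conditioned on a set -/

section Ensemble

variable {X Y : Type*} [Fintype X] [Fintype Y]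

/-- The i.i.d. probability of a set of words. -/
def condMass (Q : X → ℝ) {n : ℕ} (D : Set (Fin n → X)) : ℝ :=
  ∑ x : Fin n → X, if x ∈ D then iidDist Q x else 0

/-- The i.i.d. distribution conditioned on a set of words. -/
def condDist (Q : X → ℝ) {n : ℕ} (D : Set (Fin n → X)) (x : Fin n → X) : ℝ :=
  if x ∈ D then iidDist Q x / condMass Q D else 0

/-- The properties of the conditioning sets on which the exponent of the ensemble depends. -/
structure IsEnsemble (Q : X → ℝ) {L : ℕ} (a : Fin L → X → ℝ) (D : ∀ n, Set (Fin n → X)) :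
    Prop where
  inv : ∀ n (x x' : Fin n → X), cnt x = cnt x' → x ∈ D n → x' ∈ D n
  mass : ∀ ε > 0, ∀ᶠ n : ℕ in atTop, Real.exp (-(n * ε)) ≤ condMass Q (D n)
  cost : ∀ ε > 0, ∀ᶠ n : ℕ in atTop, ∀ x ∈ D n, ∀ l,
    |mean (wordType x) (a l) - mean Q (a l)| ≤ ε
  -- Robustness for the lower bound: a nearly `Q`-typical word of `D n` such that cost changes below
  -- `η`, with `η` independent of `n`, stay in `D n`.
  slack : ∃ η > 0, ∀ ε > 0, ∀ᶠ n : ℕ in atTop, ∃ x ∈ D n, (∀ b, |wordType x b - Q b| ≤ ε) ∧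
    (∀ i, Q (x i) ≠ 0) ∧ ∀ x' : Fin n → X, (∀ i, Q (x' i) ≠ 0) →
      (∀ l, |∑ i, a l (x' i) - ∑ i, a l (x i)| < η) → x' ∈ D n

theorem iidDist_nonneg {Q : X → ℝ} (hQ : ∀ x, 0 ≤ Q x) {n : ℕ} (x : Fin n → X) :
    0 ≤ iidDist Q x := Finset.prod_nonneg fun _ _ => hQ _

theorem condMass_le_one {Q : X → ℝ} (hQ : Q ∈ stdSimplex ℝ X) {n : ℕ} (D : Set (Fin n → X)) :
    condMass Q D ≤ 1 := by
  calc condMass Q D ≤ ∑ x : Fin n → X, iidDist Q x :=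
        Finset.sum_le_sum fun x _ => by split_ifs <;> simp [iidDist_nonneg hQ.1]
    _ = 1 := by unfold iidDist; rw [sum_prod_word, hQ.2, one_pow]

theorem condDist_mem {Q : X → ℝ} (hQ : Q ∈ stdSimplex ℝ X) {n : ℕ} {D : Set (Fin n → X)}
    (hD : 0 < condMass Q D) : condDist Q D ∈ stdSimplex ℝ (Fin n → X) := by
  refine ⟨fun x => ?_, ?_⟩
  · unfold condDist
    split_ifs
    · exact div_nonneg (iidDist_nonneg hQ.1 x) hD.le
    · exact le_rfl
  · have : ∀ x, condDist Q D x = (if x ∈ D then iidDist Q x else 0) / condMass Q D := fun x => by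
      unfold condDist; split_ifs <;> simp
    simp_rw [this]
    rw [← Finset.sum_div]
    exact div_self hD.ne'

theorem iidDist_mul_chanN (Q : X → ℝ) (W : X → Y → ℝ) {n : ℕ} (x : Fin n → X) (y : Fin n → Y) :
    iidDist Q x * chanN W x y = ∏ i, joint Q W (pairW x y i) := by
  unfold iidDist chanN joint pairW
  rw [← Finset.prod_mul_distrib]

theorem sum_sum_pairW {n : ℕ} (f : (Fin n → X × Y) → ℝ) :
    ∑ x : Fin n → X, ∑ y : Fin n → Y, f (pairW x y) = ∑ w, f w := by
  rw [← Fintype.sum_prod_type' fun (x : Fin n → X) (y : Fin n → Y) => f (pairW x y)]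
  exact Equiv.sum_comp (Equiv.arrowProdEquivProdArrow (Fin n) (fun _ => X) (fun _ => Y)).symm f

/-- Upper bound on the union bound in terms of the types that can occur. -/
theorem rcu_le_exp {Q : X → ℝ} (hQ : Q ∈ stdSimplex ℝ X) {W : X → Y → ℝ} (hW : IsChannel W)
    (q : X → Y → ℝ) {R E : ℝ} {n k : ℕ} (hk : (k : ℝ) ≤ 2 * Real.exp (n * R))
    {D : Set (Fin n → X)} (hD : 0 < condMass Q D)
    (hE : ∀ x ∈ D, ∀ x' ∈ D, ∀ y : Fin n → Y, (∀ i, 0 < joint Q W (pairW x y i)) →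
      (∀ i, 0 < Q (x' i)) → metricN q x y ≤ metricN q x' y →
      E ≤ objR Q W R (wordType (pairW x y)) (wordType (pairW x' y))) :
    rcu W q k (condDist Q D) ≤ 2 * ((n : ℝ) + 1) ^ (2 * Fintype.card (X × Y)) /
      condMass Q D ^ 2 * Real.exp (-(n * E)) := by
  set μ := condMass Q D with hμ
  set c := Fintype.card (X × Y) with hc
  have hμ1 : μ ≤ 1 := condMass_le_one hQ D
  -- the bound for a given pair of words
  have key : ∀ x ∈ D, ∀ y : Fin n → Y, (∀ i, 0 < joint Q W (pairW x y i)) →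
      min 1 (k * beatProb q (condDist Q D) x y) ≤ 2 * ((n : ℝ) + 1) ^ c / μ *
        Real.exp (-(n * (E - klR (wordType (pairW x y)) (joint Q W)))) := by
    intro x hx y hxy
    set g := klR (wordType (pairW x y)) (joint Q W) with hg
    have hpoly : 1 ≤ ((n : ℝ) + 1) ^ c := one_le_pow₀ (by linarith [n.cast_nonneg (α := ℝ)])
    rcases le_or_gt E g with hEg | hEg
    · refine (min_le_left _ _).trans ?_
      have h1 : 1 ≤ Real.exp (-(n * (E - g))) := Real.one_le_exp (by
        have : (n : ℝ) * (E - g) ≤ 0 := mul_nonpos_of_nonneg_of_nonpos (by positivity) (by linarith)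
        linarith)
      have h2 : 1 ≤ 2 * ((n : ℝ) + 1) ^ c / μ := by
        rw [le_div_iff₀ hD]; linarith
      nlinarith
    · refine (min_le_right _ _).trans ?_
      have h1 : beatProb q (condDist Q D) x y = ∑ N ∈ counts (X × Y) n, ∑ x' ∈ condCls N y,
          if metricN q x y ≤ metricN q x' y then condDist Q D x' else 0 := by
        have := Finset.sum_fiberwise_of_maps_to (s := (Finset.univ : Finset (Fin n → X)))
          (t := counts (X × Y) n) (g := fun x' => cnt (pairW x' y))
          (fun x' _ => cnt_mem_counts _)
          (fun x' => if metricN q x y ≤ metricN q x' y then condDist Q D x' else 0)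
        exact this.symm
      have h2 : ∀ N ∈ counts (X × Y) n, (k : ℝ) * ∑ x' ∈ condCls N y,
          (if metricN q x y ≤ metricN q x' y then condDist Q D x' else 0) ≤
          2 / μ * Real.exp (-(n * (E - g))) := by
        intro N _
        by_cases hex : ∃ x' ∈ condCls N y, x' ∈ D ∧ metricN q x y ≤ metricN q x' y ∧
            ∀ i, 0 < Q (x' i)
        · obtain ⟨x', hx'N, hx'D, hx'm, hx'Q⟩ := hex
          have h3 := hE x hx x' hx'D y hxy hx'Q hx'm
          rw [objR, ← hg, wordType_of_mem_condCls hx'N] at h3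
          set g2 := condKL Q fun b => (N b : ℝ) / n with hg2
          -- In this case `E - g` is positive, so it can only be bounded by the unclipped branch of
          -- the maximum.
          have h4 : E - g ≤ g2 - R := by
            by_contra h
            rcases le_max_iff.1 (show E - g ≤ max (g2 - R) 0 by linarith) with h' | h'
            · exact h h'
            · linarith
          have h5 : ∑ x' ∈ condCls N y,
              (if metricN q x y ≤ metricN q x' y then condDist Q D x' else 0) ≤
              (∑ x' ∈ condCls N y, ∏ i, Q (x' i)) / μ := by
            rw [Finset.sum_div]
            refine Finset.sum_le_sum fun x' _ => ?_
            have : 0 ≤ (∏ i, Q (x' i)) / μ := div_nonneg (iidDist_nonneg hQ.1 x') hD.le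
            unfold condDist
            split_ifs
            · exact le_rfl
            · exact this
            · exact this
          have h6 := sum_condCls_le hQ.1 N y
          calc (k : ℝ) * _ ≤ (2 * Real.exp (n * R)) * (Real.exp (-(n * g2)) / μ) := by
                refine mul_le_mul hk (h5.trans ?_) ?_ (by positivity)
                · gcongr
                · refine Finset.sum_nonneg fun x' _ => ?_
                  split_ifs
                  · exact (condDist_mem hQ hD).1 x'
                  · exact le_rfl
            _ = 2 / μ * (Real.exp (n * R) * Real.exp (-(n * g2))) := by ring
            _ ≤ 2 / μ * Real.exp (-(n * (E - g))) := by
                rw [← Real.exp_add]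
                gcongr
                have := mul_le_mul_of_nonneg_left h4 (n.cast_nonneg (α := ℝ))
                linarith
        · rw [Finset.sum_eq_zero, mul_zero]
          · positivity
          · intro x' hx'
            split_ifs with hm
            · unfold condDist
              split_ifs with hx'D
              · by_cases hpos : ∀ i, 0 < Q (x' i)
                · exact absurd ⟨x', hx', hx'D, hm, hpos⟩ hex
                · push Not at hpos
                  obtain ⟨i, hi⟩ := hpos
                  rw [iidDist, Finset.prod_eq_zero (Finset.mem_univ i) (le_antisymm hi (hQ.1 _)),
                    zero_div]
              · rfl
            · rfl
      rw [h1, Finset.mul_sum]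
      refine (Finset.sum_le_card_nsmul _ _ _ h2).trans (le_of_eq ?_)
      rw [card_counts, nsmul_eq_mul]
      push_cast
      ring
  set F : (Fin n → X × Y) → ℝ := fun w => (∏ i, joint Q W (w i)) *
    (2 * ((n : ℝ) + 1) ^ c / μ ^ 2 * Real.exp (-(n * (E - klR (wordType w) (joint Q W))))) with hF
  have hJ := joint_mem hQ hW
  have step1 : rcu W q k (condDist Q D) ≤ ∑ x : Fin n → X, ∑ y : Fin n → Y, F (pairW x y) := by
    refine Finset.sum_le_sum fun x _ => Finset.sum_le_sum fun y _ => ?_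
    have hF0 : 0 ≤ F (pairW x y) :=
      mul_nonneg (Finset.prod_nonneg fun i _ => hJ.1 _) (by positivity)
    by_cases hx : x ∈ D
    · by_cases hpos : ∀ i, 0 < joint Q W (pairW x y i)
      · rw [condDist, if_pos hx, div_mul_eq_mul_div, iidDist_mul_chanN]
        have := mul_le_mul_of_nonneg_left (key x hx y hpos)
          (div_nonneg (Finset.prod_nonneg fun i _ => hJ.1 (pairW x y i)) hD.le :
            0 ≤ (∏ i, joint Q W (pairW x y i)) / μ)
        refine this.trans (le_of_eq ?_)
        simp only [hF]
        field_simp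
      · push Not at hpos
        obtain ⟨i, hi⟩ := hpos
        rw [condDist, if_pos hx, div_mul_eq_mul_div, iidDist_mul_chanN,
          Finset.prod_eq_zero (Finset.mem_univ i) (le_antisymm hi (hJ.1 _)), zero_div, zero_mul]
        exact hF0
    · rw [condDist, if_neg hx, zero_mul, zero_mul]
      exact hF0
  rw [sum_sum_pairW, ← sum_counts] at step1
  have step2 : ∀ N ∈ counts (X × Y) n, ∑ w ∈ cls N n, F w ≤
      2 * ((n : ℝ) + 1) ^ c / μ ^ 2 * Real.exp (-(n * E)) := by
    intro N _
    have h1 : ∑ w ∈ cls N n, F w = clsProb (joint Q W) N n * (2 * ((n : ℝ) + 1) ^ c / μ ^ 2 *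
        Real.exp (-(n * (E - klR (fun b => (N b : ℝ) / n) (joint Q W))))) := by
      unfold clsProb
      rw [Finset.sum_mul]
      refine Finset.sum_congr rfl fun w hw => ?_
      simp only [hF]
      rw [wordType_of_mem_cls hw]
    rw [h1]
    set g := klR (fun b => (N b : ℝ) / n) (joint Q W) with hg
    calc _ ≤ Real.exp (-(n * g)) * (2 * ((n : ℝ) + 1) ^ c / μ ^ 2 * Real.exp (-(n * (E - g)))) := by
          gcongr
          exact clsProb_le hJ.1 N
      _ = 2 * ((n : ℝ) + 1) ^ c / μ ^ 2 * (Real.exp (-(n * g)) * Real.exp (-(n * (E - g)))) := by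
          ring
      _ = _ := by rw [← Real.exp_add]; congr 2; ring
  refine step1.trans ((Finset.sum_le_card_nsmul _ _ _ step2).trans (le_of_eq ?_))
  rw [card_counts, nsmul_eq_mul]
  push_cast
  ring

theorem log_metricN {q : X → Y → ℝ} {n : ℕ} (x : Fin n → X) (y : Fin n → Y)
    (h : ∀ i, 0 < q (x i) (y i)) :
    Real.log (metricN q x y) = n * ∑ b, wordType (pairW x y) b * Real.log (q b.1 b.2) := by
  rw [metricN, Real.log_prod fun i _ => (h i).ne']
  exact sum_word_wordType (pairW x y) fun b => Real.log (q b.1 b.2)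

theorem wordType_eq_zero {α : Type*} {n : ℕ} {w : Fin n → α} {b : α} (h : ∀ i, w i ≠ b) :
    wordType w b = 0 := by
  simp [wordType, h]

/-- The metric of `(x, y)` is positive, hence so is that of `(x', y)`, which therefore meets no zero
of `q`; the logarithm turns the metric inequality into the linear constraint. Costs are left out, as
at finite `n` they match only approximately. -/
theorem wordType_feasible {Q : X → ℝ} {W q : X → Y → ℝ} (hq : ∀ x y, 0 ≤ q x y)
    (hqW : ∀ x y, q x y = 0 → Q x * W x y = 0) (a : Fin 0 → X → ℝ) {n : ℕ} (hn : 0 < n)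
    {x x' : Fin n → X} {y : Fin n → Y} (h1 : ∀ i, 0 < joint Q W (pairW x y i))
    (h2 : ∀ i, 0 < Q (x' i)) (h3 : metricN q x y ≤ metricN q x' y) :
    (wordType (pairW x y), wordType (pairW x' y)) ∈ feasible Q W q a := by
  have h4 : ∀ i, 0 < q (x i) (y i) := fun i =>
    lt_of_le_of_ne (hq _ _) fun h => (h1 i).ne' (hqW _ _ h.symm)
  have h5 : 0 < metricN q x y := Finset.prod_pos fun i _ => h4 i
  have h6 : ∀ i, 0 < q (x' i) (y i) := fun i =>
    lt_of_le_of_ne (hq _ _) fun h => (h5.trans_le h3).ne'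
      (Finset.prod_eq_zero (Finset.mem_univ i) h.symm)
  refine ⟨⟨wordType_mem hn _, wordType_mem hn _⟩, fun l => l.elim0, fun l => l.elim0, ?_, ?_, ?_,
    ?_, ?_⟩
  · rw [margY_wordType, margY_wordType]
  · exact fun b hb => wordType_eq_zero fun i hi => (h1 i).ne' (hi ▸ hb)
  · exact fun b hb => wordType_eq_zero fun i hi => (h2 i).ne' (by rw [← hi] at hb; exact hb)
  · exact fun b hb => wordType_eq_zero fun i hi => (h6 i).ne' (by rw [← hi] at hb; exact hb)
  · have := Real.log_le_log h5 h3
    rw [log_metricN x y h4, log_metricN x' y h6] at this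
    exact le_of_mul_le_mul_left this (by positivity)

/-- Below the exponent no pair of types of the ensemble can occur, for large `n`. -/
theorem eventually_le_objR {Q : X → ℝ} {W q : X → Y → ℝ} (hq : ∀ x y, 0 ≤ q x y)
    (hqW : ∀ x y, q x y = 0 → Q x * W x y = 0) (R : ℝ) {L : ℕ} {a : Fin L → X → ℝ}
    {D : ∀ n, Set (Fin n → X)} (hD : ∀ ε > 0, ∀ᶠ n : ℕ in atTop, ∀ x ∈ D n, ∀ l,
      |mean (wordType x) (a l) - mean Q (a l)| ≤ ε) {E : ℝ}
    (hE : ∀ p ∈ feasible Q W q a, E < objR Q W R p.1 p.2) :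
    ∀ᶠ n : ℕ in atTop, ∀ x ∈ D n, ∀ x' ∈ D n, ∀ y : Fin n → Y,
      (∀ i, 0 < joint Q W (pairW x y i)) → (∀ i, 0 < Q (x' i)) →
      metricN q x y ≤ metricN q x' y →
      E ≤ objR Q W R (wordType (pairW x y)) (wordType (pairW x' y)) := by
  by_contra hcon
  obtain ⟨φ, hφ, hbad⟩ := extraction_of_frequently_atTop
    ((not_eventually.1 hcon).and_eventually (eventually_gt_atTop 0))
  push Not at hbad
  choose hbad hpos using hbad
  choose x hx x' hx' y h1 h2 h3 h4 using hbad
  -- Compactness is used without costs, since the types at finite `n` need not meet them exactly;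
  -- the cost constraints reappear in the limit.
  let a0 : Fin 0 → X → ℝ := fun l => l.elim0
  have hf : ∀ j, (wordType (pairW (x j) (y j)), wordType (pairW (x' j) (y j))) ∈
      feasible Q W q a0 := fun j => wordType_feasible hq hqW a0 (hpos j) (h1 j) (h2 j) (h3 j)
  obtain ⟨p, hp, ψ, hψ, hlim⟩ := (isCompact_feasible Q W q a0).tendsto_subseq hf
  have hto : Tendsto (fun j => φ (ψ j)) atTop atTop := hφ.tendsto_atTop.comp hψ.tendsto_atTop
  have hlim1 := (continuous_fst.tendsto p).comp hlim
  have hlim2 := (continuous_snd.tendsto p).comp hlim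
  have hmean : ∀ (P : X × Y → ℝ) (z : ∀ j, Fin (φ j) → X) (hz : ∀ j, z j ∈ D (φ j)),
      Tendsto (fun j => wordType (pairW (z (ψ j)) (y (ψ j)))) atTop (𝓝 P) →
      ∀ l, mean (margX P) (a l) = mean Q (a l) := by
    intro P z hz hP l
    have t1 := ((continuous_mean_margX (Y := Y) (a l)).tendsto P).comp hP
    have t2 : Tendsto (fun j => mean (wordType (z (ψ j))) (a l)) atTop (𝓝 (mean Q (a l))) := by
      rw [Metric.tendsto_nhds]
      intro ε hε
      filter_upwards [hto.eventually (hD (ε / 2) (by linarith))] with j hj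
      rw [Real.dist_eq]
      exact (hj _ (hz (ψ j)) l).trans_lt (by linarith)
    refine tendsto_nhds_unique t1 (t2.congr fun j => ?_)
    simp only [Function.comp, margX_wordType]
  have hfeas : p ∈ feasible Q W q a :=
    ⟨hp.1, hmean p.1 x hx hlim1, hmean p.2 x' hx' hlim2, hp.2.2.2⟩
  have hobj := ((continuous_objR Q W R).tendsto p).comp hlim
  exact absurd (le_of_tendsto hobj (Eventually.of_forall fun j => (h4 (ψ j)).le))
    (not_le.2 (hE p hfeas))

theorem eventually_poly_le_exp (A : ℝ) (c : ℕ) {ε : ℝ} (hε : 0 < ε) :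
    ∀ᶠ n : ℕ in atTop, A * ((n : ℝ) + 1) ^ c ≤ Real.exp (n * ε) := by
  have h := isLittleO_pow_exp_pos_mul_atTop c hε
  have h2 := h.bound (show 0 < (1 / ((|A| + 1) * Real.exp ε)) by positivity)
  have h3 : Tendsto (fun n : ℕ => (n : ℝ) + 1) atTop atTop :=
    tendsto_atTop_add_const_right _ _ tendsto_natCast_atTop_atTop
  filter_upwards [h3.eventually h2] with n hn
  rw [Real.norm_of_nonneg (by positivity), Real.norm_of_nonneg (by positivity)] at hn
  have h4 : Real.exp (ε * ((n : ℝ) + 1)) = Real.exp (n * ε) * Real.exp ε := by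
    rw [← Real.exp_add]; congr 1; ring
  rw [h4] at hn
  have h5 : 0 < Real.exp ε := Real.exp_pos _
  calc A * ((n : ℝ) + 1) ^ c ≤ (|A| + 1) * ((n : ℝ) + 1) ^ c := by
        gcongr; linarith [le_abs_self A]
    _ ≤ (|A| + 1) * (1 / ((|A| + 1) * Real.exp ε) * (Real.exp (n * ε) * Real.exp ε)) := by gcongr
    _ = Real.exp (n * ε) := by field_simp

theorem eventually_rcu_le {Q : X → ℝ} (hQ : Q ∈ stdSimplex ℝ X) {W : X → Y → ℝ} (hW : IsChannel W)
    {q : X → Y → ℝ} (hq : ∀ x y, 0 ≤ q x y) (hqW : ∀ x y, q x y = 0 → Q x * W x y = 0) {R : ℝ}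
    {k : ℕ → ℕ} (hk : ∀ n, (k n : ℝ) ≤ 2 * Real.exp (n * R)) {L : ℕ} {a : Fin L → X → ℝ}
    {D : ∀ n, Set (Fin n → X)} (hD : IsEnsemble Q a D) {E ε : ℝ} (hε : 0 < ε)
    (hE : ∀ p ∈ feasible Q W q a, E ≤ objR Q W R p.1 p.2) :
    ∀ᶠ n : ℕ in atTop, rcu W q (k n) (condDist Q (D n)) ≤ Real.exp (-(n * (E - ε))) := by
  filter_upwards [eventually_le_objR hq hqW R hD.cost (E := E - ε / 2)
      (fun p hp => by linarith [hE p hp]), hD.mass (ε / 8) (by linarith),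
    eventually_poly_le_exp 2 (2 * Fintype.card (X × Y)) (show 0 < ε / 4 by linarith)]
    with n h1 h2 h3
  have hμ : 0 < condMass Q (D n) := (Real.exp_pos _).trans_le h2
  refine (rcu_le_exp hQ hW q (hk n) hμ h1).trans ?_
  -- The budget `ε` is spent as `ε / 4` on the polynomial, `2 * (ε / 8)` on the squared mass and `ε
  -- / 2` on the exponent.
  calc _ ≤ Real.exp (n * (ε / 4)) / Real.exp (-(n * (ε / 8))) ^ 2 *
        Real.exp (-(n * (E - ε / 2))) := by gcongr
    _ = Real.exp (-(n * (E - ε))) := by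
        rw [← Real.exp_nat_mul, ← Real.exp_sub, ← Real.exp_add]
        congr 1
        push_cast
        ring

theorem hasExponent_of_bounds {p : ℕ → ℝ} {E : ℝ}
    (h1 : ∀ ε > 0, ∀ᶠ n : ℕ in atTop, p n ≤ Real.exp (-(n * (E - ε))))
    (h2 : ∀ ε > 0, ∀ᶠ n : ℕ in atTop, Real.exp (-(n * (E + ε))) ≤ p n) :
    HasExponent p E := by
  refine ⟨?_, ?_⟩
  · filter_upwards [h2 1 one_pos] with n hn
    exact (Real.exp_pos _).trans_le hn
  · refine (continuous_coe_real_ereal.tendsto E).comp ?_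
    rw [Metric.tendsto_nhds]
    intro ε hε
    filter_upwards [h1 (ε / 2) (by linarith), h2 (ε / 2) (by linarith), eventually_gt_atTop 0]
      with n hn1 hn2 hn
    have hp : 0 < p n := (Real.exp_pos _).trans_le hn2
    have l1 := Real.log_le_log hp hn1
    have l2 := Real.log_le_log (Real.exp_pos _) hn2
    rw [Real.log_exp] at l1 l2
    have hn' : (0 : ℝ) < n := by exact_mod_cast hn
    rw [Real.dist_eq]
    have e : -(1 / (n : ℝ)) * Real.log (p n) - E = (-Real.log (p n) - n * E) / n := by
      field_simp
    rw [e, abs_div, abs_of_pos hn', div_lt_iff₀ hn']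
    refine lt_of_le_of_lt (b := n * (ε / 2)) (abs_le.2 ⟨by linarith, by linarith⟩) ?_
    nlinarith

/-- If `Q × W` charges a zero of `q`, then the metric of the sent word vanishes with high
probability. -/
theorem eventually_le_rcu_of_zero {Q : X → ℝ} (hQ : Q ∈ stdSimplex ℝ X) {W : X → Y → ℝ}
    (hW : IsChannel W) {q : X → Y → ℝ} (hq : ∀ x y, 0 ≤ q x y)
    (hqW : ¬∀ x y, q x y = 0 → Q x * W x y = 0) {k : ℕ → ℕ} (hk : ∀ᶠ n in atTop, 1 ≤ k n)
    {D : ∀ n, Set (Fin n → X)} (hD : ∀ ε > 0, ∀ᶠ n : ℕ in atTop,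
      Real.exp (-(n * ε)) ≤ condMass Q (D n)) :
    ∀ᶠ n : ℕ in atTop, 1 / 2 ≤ rcu W q (k n) (condDist Q (D n)) := by
  have hJ := joint_mem hQ hW
  -- The part of `Q × W` where `q` is nonzero. Its mass is `1 - θ`, so the sent word keeps a nonzero
  -- metric with probability `(1 - θ) ^ n` before conditioning, and conditioning divides this by at
  -- most `exp (-(n * (θ / 2)))`.
  set J' : X × Y → ℝ := fun b => if q b.1 b.2 = 0 then 0 else joint Q W b with hJ'
  set θ : ℝ := 1 - ∑ b, J' b with hθ
  have hθ0 : 0 < θ := by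
    push Not at hqW
    obtain ⟨x, y, h0, h1⟩ := hqW
    have : ∑ b, J' b < ∑ b, joint Q W b := by
      refine Finset.sum_lt_sum (fun b _ => ?_) ⟨(x, y), Finset.mem_univ _, ?_⟩
      · simp only [hJ']; split_ifs
        · exact hJ.1 b
        · exact le_rfl
      · simp only [hJ', h0, if_true]
        exact lt_of_le_of_ne (hJ.1 _) (Ne.symm h1)
    rw [hJ.2] at this
    linarith
  have hJ0 : 0 ≤ ∑ b, J' b := Finset.sum_nonneg fun b _ => by
    simp only [hJ']; split_ifs
    · exact le_rfl
    · exact hJ.1 b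
  filter_upwards [hk, hD (θ / 2) (by linarith),
    eventually_poly_le_exp 2 0 (show 0 < θ / 2 by linarith)] with n h1 h2 h3
  have hμ : 0 < condMass Q (D n) := (Real.exp_pos _).trans_le h2
  have hP := condDist_mem hQ hμ
  have step : ∀ (x : Fin n → X) (y : Fin n → Y), condDist Q (D n) x * chanN W x y -
      (∏ i, J' (pairW x y i)) / condMass Q (D n) ≤ condDist Q (D n) x * chanN W x y *
        min 1 (k n * beatProb q (condDist Q (D n)) x y) := by
    intro x y
    have hnn : 0 ≤ condDist Q (D n) x * chanN W x y := mul_nonneg (hP.1 x) (chanN_nonneg hW x y)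
    by_cases hm : metricN q x y = 0
    · have hb : beatProb q (condDist Q (D n)) x y = 1 := by
        rw [← hP.2]
        refine Finset.sum_congr rfl fun x' _ => if_pos ?_
        rw [hm]
        exact Finset.prod_nonneg fun i _ => hq _ _
      have hmin : min 1 ((k n : ℝ) * beatProb q (condDist Q (D n)) x y) = 1 := by
        rw [hb, mul_one]
        exact min_eq_left (by exact_mod_cast h1)
      rw [hmin, mul_one]
      have : 0 ≤ (∏ i, J' (pairW x y i)) / condMass Q (D n) :=
        div_nonneg (Finset.prod_nonneg fun i _ => by
          simp only [hJ']; split_ifs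
          · exact le_rfl
          · exact hJ.1 _) hμ.le
      linarith
    · have e1 : ∏ i, J' (pairW x y i) = iidDist Q x * chanN W x y := by
        rw [iidDist_mul_chanN]
        refine Finset.prod_congr rfl fun i _ => if_neg fun h => hm ?_
        exact Finset.prod_eq_zero (Finset.mem_univ i) h
      have e2 : condDist Q (D n) x * chanN W x y ≤
          (∏ i, J' (pairW x y i)) / condMass Q (D n) := by
        rw [e1, ← div_mul_eq_mul_div]
        refine mul_le_mul_of_nonneg_right ?_ (chanN_nonneg hW x y)
        unfold condDist
        split_ifs
        · exact le_rfl
        · exact div_nonneg (iidDist_nonneg hQ.1 x) hμ.le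
      have : 0 ≤ condDist Q (D n) x * chanN W x y *
          min 1 (k n * beatProb q (condDist Q (D n)) x y) :=
        mul_nonneg hnn (le_min zero_le_one
          (mul_nonneg (by positivity) (beatProb_nonneg q hP.1 x y)))
      linarith
  have hsum := Finset.sum_le_sum fun x (_ : x ∈ (Finset.univ : Finset (Fin n → X))) =>
    Finset.sum_le_sum fun y (_ : y ∈ (Finset.univ : Finset (Fin n → Y))) => step x y
  simp_rw [Finset.sum_sub_distrib] at hsum
  have s1 : ∑ x : Fin n → X, ∑ y : Fin n → Y, condDist Q (D n) x * chanN W x y = 1 := by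
    rw [← hP.2]
    refine Finset.sum_congr rfl fun x _ => ?_
    rw [← Finset.mul_sum]
    have := Finset.prod_univ_sum (fun _ : Fin n => (Finset.univ : Finset Y)) (fun i b => W (x i) b)
    simp only [(hW _).2, Finset.prod_const_one, Fintype.piFinset_univ] at this
    unfold chanN
    rw [← this, mul_one]
  have s2 : ∑ x : Fin n → X, ∑ y : Fin n → Y, (∏ i, J' (pairW x y i)) / condMass Q (D n) =
      (1 - θ) ^ n / condMass Q (D n) := by
    rw [sum_sum_pairW fun w => (∏ i, J' (w i)) / condMass Q (D n), ← Finset.sum_div, sum_prod_word]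
    congr 2
    linarith
  rw [s1, s2] at hsum
  have s3 : (1 - θ) ^ n / condMass Q (D n) ≤ 1 / 2 := by
    rw [div_le_iff₀ hμ]
    have e1 : (1 - θ) ^ n ≤ Real.exp (-(n * θ)) := by
      rw [← mul_neg, Real.exp_nat_mul]
      exact pow_le_pow_left₀ (by linarith) (by linarith [Real.add_one_le_exp (-θ)]) n
    have e2 : Real.exp (-(n * θ)) * Real.exp (n * (θ / 2)) = Real.exp (-(n * (θ / 2))) := by
      rw [← Real.exp_add]; congr 1; ring
    have e3 := mul_le_mul_of_nonneg_left h3 (Real.exp_pos (-(n * θ))).le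
    rw [e2, pow_zero, mul_one] at e3
    linarith
  unfold rcu
  linarith

end Ensemble

/-! ### Simultaneous approximation of multiples by integer vectors -/

section Recurrence

variable {ι : Type*} [Fintype ι]

/-- Pigeonhole on the torus: cut it into finitely many cells and fix, for every visited cell, one
time at which the orbit of `d` is there. The difference of `n` and the fixed time of its cell is a
near-period, and the fixed times are bounded. -/
theorem exists_int_near_mul (d : ι → ℝ) {η : ℝ} (hη : 0 < η) :
    ∃ C : ℕ, ∀ n : ℕ, ∃ (k : ℤ) (z : ι → ℤ), |k - n| ≤ C ∧ ∀ i, |(z i : ℝ) - k * d i| < η := by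
  obtain ⟨m, hm⟩ := exists_nat_one_div_lt hη
  set cell : ℕ → ι → Fin (m + 1) := fun n i =>
    ⟨⌊Int.fract (n * d i) * ((m : ℝ) + 1)⌋₊, by
      rw [Nat.floor_lt (mul_nonneg (Int.fract_nonneg _) (by positivity))]
      push_cast
      exact mul_lt_of_lt_one_left (by positivity) (Int.fract_lt_one _)⟩ with hcell
  set rep : (ι → Fin (m + 1)) → ℕ := fun c => if h : ∃ n, cell n = c then h.choose else 0 with hrep
  have hrep' : ∀ n, cell (rep (cell n)) = cell n := fun n => by
    have h : ∃ n', cell n' = cell n := ⟨n, rfl⟩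
    simp only [hrep, dif_pos h]
    exact h.choose_spec
  refine ⟨Finset.univ.sup rep, fun n => ⟨n - rep (cell n),
    fun i => ⌊n * d i⌋ - ⌊(rep (cell n) : ℝ) * d i⌋, ?_, fun i => ?_⟩⟩
  · have := Finset.le_sup (f := rep) (Finset.mem_univ (cell n))
    rw [sub_sub_cancel_left, abs_neg, Nat.abs_cast]
    exact_mod_cast this
  · have h1 := congrArg Fin.val (congrFun (hrep' n) i)
    simp only [hcell] at h1
    set u := Int.fract ((rep (cell n) : ℝ) * d i) with hu
    set v := Int.fract ((n : ℝ) * d i) with hv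
    have hu0 : 0 ≤ u * ((m : ℝ) + 1) := mul_nonneg (Int.fract_nonneg _) (by positivity)
    have hv0 : 0 ≤ v * ((m : ℝ) + 1) := mul_nonneg (Int.fract_nonneg _) (by positivity)
    have h2 : |u * ((m : ℝ) + 1) - v * ((m : ℝ) + 1)| < 1 := by
      have a1 := Nat.floor_le hu0
      have a2 := Nat.lt_floor_add_one (u * ((m : ℝ) + 1))
      have a3 := Nat.floor_le hv0
      have a4 := Nat.lt_floor_add_one (v * ((m : ℝ) + 1))
      rw [h1] at a1 a2
      exact abs_lt.2 ⟨by linarith, by linarith⟩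
    rw [← sub_mul, abs_mul, abs_of_pos (show (0 : ℝ) < m + 1 by positivity),
      ← lt_div_iff₀ (by positivity)] at h2
    refine lt_trans (lt_of_eq_of_lt ?_ h2) hm
    congr 1
    have e1 := Int.self_sub_floor ((n : ℝ) * d i)
    have e2 := Int.self_sub_floor ((rep (cell n) : ℝ) * d i)
    push_cast
    rw [hu, hv, ← e1, ← e2]
    ring

theorem abs_sum_mul_le {f : ι → ℝ} {η : ℝ} (c : ι → ℝ) (h : ∀ i, |f i| < η) :
    |∑ i, f i * c i| ≤ η * ∑ i, |c i| := by
  rw [Finset.mul_sum]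
  refine (Finset.abs_sum_le_sum_abs _ _).trans (Finset.sum_le_sum fun i _ => ?_)
  rw [abs_mul]
  exact mul_le_mul_of_nonneg_right (h i).le (abs_nonneg _)

/-- Approximation alone bounds `∑ z B` below only by a small negative number. If some near-period
`z₀` has positive value, adding it repairs the sign. If none has, then none has a negative value
either, because the negative of a near-period is again one. -/
theorem exists_int_near_mul_nonneg (d B : ι → ℝ) (hB : 0 ≤ ∑ i, d i * B i) {η : ℝ} (hη : 0 < η) :
    ∃ C : ℕ, ∀ n : ℕ, C ≤ n → ∃ (k : ℤ) (z : ι → ℤ), |k - n| ≤ C ∧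
      (∀ i, |(z i : ℝ) - k * d i| < η) ∧ 0 ≤ ∑ i, (z i : ℝ) * B i := by
  by_cases h : ∃ (k : ℤ) (z : ι → ℤ), (∀ i, |(z i : ℝ) - k * d i| < η / 2) ∧
      0 < ∑ i, (z i : ℝ) * B i
  · obtain ⟨k₀, z₀, hz₀, hB₀⟩ := h
    set β := ∑ i, (z₀ i : ℝ) * B i with hβ
    set S := ∑ i, |B i| with hS
    have hS0 : 0 ≤ S := Finset.sum_nonneg fun i _ => abs_nonneg _
    -- The first bound keeps `z + z₀` within `η`; the second keeps the error in `∑ z B` at most the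
    -- gain `β`.
    set η' := min (η / 2) (β / (S + 1)) with hη'
    have hη'0 : 0 < η' := lt_min (by linarith) (by positivity)
    obtain ⟨C, hC⟩ := exists_int_near_mul d hη'0
    refine ⟨C + k₀.natAbs, fun n hn => ?_⟩
    obtain ⟨k, z, hk, hz⟩ := hC n
    refine ⟨k + k₀, fun i => z i + z₀ i, ?_, fun i => ?_, ?_⟩
    · have := abs_add_le (k - n : ℤ) k₀
      rw [show k + k₀ - (n : ℤ) = (k - n) + k₀ by ring]
      push_cast
      omega
    · have h1 := hz i
      have h2 := hz₀ i
      have h3 : η' ≤ η / 2 := min_le_left _ _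
      rw [abs_lt] at h1 h2 ⊢
      push_cast
      constructor <;> nlinarith
    · have hk0 : (0 : ℝ) ≤ k := by
        have : 0 ≤ k := by have := abs_le.1 hk; omega
        exact_mod_cast this
      have h1 := abs_le.1 (abs_sum_mul_le B hz)
      have h2 : ∑ i, ((z i : ℝ) - k * d i) * B i =
          ∑ i, (z i : ℝ) * B i - k * ∑ i, d i * B i := by
        rw [Finset.mul_sum, ← Finset.sum_sub_distrib]
        exact Finset.sum_congr rfl fun i _ => by ring
      have h3 : η' * S ≤ β := by
        have : η' ≤ β / (S + 1) := min_le_right _ _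
        rw [le_div_iff₀ (by linarith)] at this
        nlinarith
      have h4 : ∑ i, ((z i + z₀ i : ℤ) : ℝ) * B i = ∑ i, (z i : ℝ) * B i + β := by
        rw [hβ, ← Finset.sum_add_distrib]
        exact Finset.sum_congr rfl fun i _ => by push_cast; ring
      rw [h4]
      have h5 := mul_nonneg hk0 hB
      linarith [h1.1]
  · push Not at h
    obtain ⟨C, hC⟩ := exists_int_near_mul d (show 0 < η / 2 by linarith)
    refine ⟨C, fun n _ => ?_⟩
    obtain ⟨k, z, hk, hz⟩ := hC n
    refine ⟨k, z, hk, fun i => (hz i).trans (by linarith), ?_⟩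
    have := h (-k) (fun i => -z i) (fun i => by
      have e : (((-z i : ℤ) : ℝ)) - ((-k : ℤ) : ℝ) * d i = -((z i : ℝ) - k * d i) := by
        push_cast; ring
      rw [e, abs_neg]
      exact hz i)
    simp only [Int.cast_neg, neg_mul, Finset.sum_neg_distrib] at this
    linarith

end Recurrence

/-! ### Lower bound on the error probability from a realizable pair of types -/

section Converse

variable {X Y : Type*} [Fintype X] [Fintype Y]

/-- The image of a weight under a map. -/
def push {α β : Type*} [Fintype α] (f : α → β) (V : α → ℝ) (b : β) : ℝ :=
  ∑ z, V z * if f z = b then 1 else 0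

theorem continuous_push {α β : Type*} [Fintype α] (f : α → β) :
    Continuous fun V : α → ℝ => push f V :=
  continuous_pi fun _ => continuous_sum_mul _

theorem wordType_comp {α β : Type*} [Fintype α] [Fintype β] {n : ℕ} (f : α → β) (w : Fin n → α) :
    wordType (fun i => f (w i)) = push f (wordType w) := by
  funext b
  rw [wordType_eq, cnt_comp, push, Nat.cast_sum, Finset.sum_div]
  refine Finset.sum_congr rfl fun z _ => ?_
  rw [wordType_eq]
  split_ifs <;> simp

theorem metricN_eq (q : X → Y → ℝ) {n : ℕ} (x : Fin n → X) (y : Fin n → Y) :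
    metricN q x y = ∏ b, q b.1 b.2 ^ cnt (pairW x y) b :=
  prod_word (pairW x y) fun b => q b.1 b.2

theorem cnt_fst_eq {n : ℕ} {x x' : Fin n → X} {y y' : Fin n → Y}
    (h : cnt (pairW x y) = cnt (pairW x' y')) : cnt x = cnt x' := by
  funext b
  have h1 := cnt_comp (pairW x y) Prod.fst b
  have h2 := cnt_comp (pairW x' y') Prod.fst b
  rw [h, ← h2] at h1
  exact h1

/-- One triple of words is enough: metrics and membership in `D` depend only on joint counts, so
each `(u, v)` with the joint type of `(x, y)` is beaten by every word having with `v` the joint type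
of `(x', y)`, and the lower bounds on both classes apply. -/
theorem exp_le_rcu {Q : X → ℝ} (hQ : Q ∈ stdSimplex ℝ X) {W : X → Y → ℝ} (hW : IsChannel W)
    (q : X → Y → ℝ) {R : ℝ} {n k : ℕ} (hk : Real.exp (n * R) ≤ 2 * k)
    {D : Set (Fin n → X)} (hD : 0 < condMass Q D)
    (hinv : ∀ x x' : Fin n → X, cnt x = cnt x' → x ∈ D → x' ∈ D)
    {x x' : Fin n → X} {y : Fin n → Y} (hx : x ∈ D) (hx' : x' ∈ D)
    (h1 : ∀ i, joint Q W (pairW x y i) ≠ 0) (h2 : ∀ i, Q (x' i) ≠ 0)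
    (h3 : metricN q x y ≤ metricN q x' y) :
    Real.exp (-(n * objR Q W R (wordType (pairW x y)) (wordType (pairW x' y)))) ≤
      2 * ((n : ℝ) + 1) ^ (2 * Fintype.card (X × Y)) * rcu W q k (condDist Q D) := by
  set μ := condMass Q D with hμ
  set c := Fintype.card (X × Y) with hc
  have hμ1 : μ ≤ 1 := condMass_le_one hQ D
  have hJ := joint_mem hQ hW
  have hP := condDist_mem hQ hD
  set N := cnt (pairW x y) with hN
  set N' := cnt (pairW x' y) with hN'
  set g2 := condKL Q (wordType (pairW x' y)) with hg2
  have hpoly : 1 ≤ ((n : ℝ) + 1) ^ c := one_le_pow₀ (by linarith [n.cast_nonneg (α := ℝ)])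
  -- Conditioning only increases probabilities inside `D`, so no lower bound on the mass is needed
  -- beyond positivity.
  have hQcond : ∀ z ∈ D, iidDist Q z ≤ condDist Q D z := fun z hz => by
    rw [condDist, if_pos hz]
    exact le_div_self (iidDist_nonneg hQ.1 z) hD hμ1
  have key : ∀ (u : Fin n → X) (v : Fin n → Y), cnt (pairW u v) = N →
      Real.exp (-(n * max (g2 - R) 0)) ≤
        2 * ((n : ℝ) + 1) ^ c * min 1 (k * beatProb q (condDist Q D) u v) := by
    intro u v huv
    obtain ⟨σ, hσ⟩ := exists_perm_of_cnt_eq (hN.symm.trans huv.symm)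
    have hv : ∀ i, v i = y (σ i) := fun i => congrArg Prod.snd (congrFun hσ i)
    have hcnt : cnt (pairW (x' ∘ σ) v) = N' := by
      rw [hN', ← cnt_comp_perm (pairW x' y) σ]
      congr 1
      funext i
      simp [pairW, hv i]
    have h4 := sum_condCls_ge hQ.1 hcnt fun a b h0 => by
      by_contra hne
      obtain ⟨i, hi⟩ := (cnt_pos_iff _ _).1 (Nat.pos_of_ne_zero hne)
      exact h2 i (by rw [show x' i = a from congrArg Prod.fst hi, h0])
    have ht : (fun b => (N' b : ℝ) / n) = wordType (pairW x' y) := rfl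
    rw [ht, ← hg2] at h4
    have h5 : ∑ z ∈ condCls N' v, ∏ i, Q (z i) ≤ beatProb q (condDist Q D) u v := by
      unfold beatProb
      rw [← Finset.sum_filter]
      refine le_trans (Finset.sum_le_sum fun z hz => ?_) (Finset.sum_le_sum_of_subset_of_nonneg
        (s := condCls N' v) (f := condDist Q D) ?_ fun z _ _ => hP.1 z)
      · exact hQcond z (hinv x' z (cnt_fst_eq (mem_condCls.1 hz)).symm hx')
      · intro z hz
        rw [Finset.mem_filter]
        refine ⟨Finset.mem_univ _, ?_⟩
        rw [metricN_eq, metricN_eq q z, mem_condCls.1 hz, huv, hN, hN', ← metricN_eq, ← metricN_eq]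
        exact h3
    have h6 : Real.exp (-(n * g2)) ≤ ((n : ℝ) + 1) ^ c * beatProb q (condDist Q D) u v :=
      h4.trans (by gcongr)
    rw [mul_min_of_nonneg _ _ (by positivity)]
    refine le_min ?_ ?_
    · have : Real.exp (-(n * max (g2 - R) 0)) ≤ 1 := Real.exp_le_one_iff.2 (by
        have : 0 ≤ (n : ℝ) * max (g2 - R) 0 := mul_nonneg (by positivity) (le_max_right _ _)
        linarith)
      linarith
    · calc Real.exp (-(n * max (g2 - R) 0)) ≤ Real.exp (n * R) * Real.exp (-(n * g2)) := by
            rw [← Real.exp_add]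
            refine Real.exp_le_exp.2 ?_
            have := mul_le_mul_of_nonneg_left (le_max_left (g2 - R) 0) (n.cast_nonneg (α := ℝ))
            linarith
        _ ≤ (2 * k) * (((n : ℝ) + 1) ^ c * beatProb q (condDist Q D) u v) := by gcongr
        _ = _ := by ring
  have hsupp : ∀ b, joint Q W b = 0 → N b = 0 := fun b hb => by
    by_contra hne
    obtain ⟨i, hi⟩ := (cnt_pos_iff _ _).1 (Nat.pos_of_ne_zero hne)
    exact h1 i (hi ▸ hb)
  have h7 := clsProb_ge hJ.1 N (sum_cnt _) hsupp
  have ht : (fun b => (N b : ℝ) / n) = wordType (pairW x y) := rfl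
  rw [ht] at h7
  set g1 := klR (wordType (pairW x y)) (joint Q W) with hg1
  have h8 : clsProb (joint Q W) N n * Real.exp (-(n * max (g2 - R) 0)) ≤
      2 * ((n : ℝ) + 1) ^ c * rcu W q k (condDist Q D) := by
    have e1 : clsProb (joint Q W) N n = ∑ u : Fin n → X, ∑ v : Fin n → Y,
        if cnt (pairW u v) = N then ∏ i, joint Q W (pairW u v i) else 0 := by
      rw [sum_sum_pairW fun w => if cnt w = N then ∏ i, joint Q W (w i) else 0, clsProb, cls,
        Finset.sum_filter]
    rw [e1, Finset.sum_mul, rcu, Finset.mul_sum]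
    refine Finset.sum_le_sum fun u _ => ?_
    rw [Finset.sum_mul, Finset.mul_sum]
    refine Finset.sum_le_sum fun v _ => ?_
    have hmin : 0 ≤ min 1 ((k : ℝ) * beatProb q (condDist Q D) u v) :=
      le_min zero_le_one (mul_nonneg (by positivity) (beatProb_nonneg q hP.1 u v))
    split_ifs with huv
    · have hu : u ∈ D := hinv x u (cnt_fst_eq huv).symm hx
      rw [← iidDist_mul_chanN]
      calc iidDist Q u * chanN W u v * Real.exp (-(n * max (g2 - R) 0))
          ≤ (condDist Q D u * chanN W u v) * (2 * ((n : ℝ) + 1) ^ c *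
            min 1 (k * beatProb q (condDist Q D) u v)) := by
            refine mul_le_mul (mul_le_mul_of_nonneg_right (hQcond u hu) (chanN_nonneg hW u v))
              (key u v huv) (Real.exp_nonneg _) (mul_nonneg (hP.1 u) (chanN_nonneg hW u v))
        _ = _ := by ring
    · rw [zero_mul]
      exact mul_nonneg (by positivity)
        (mul_nonneg (mul_nonneg (hP.1 u) (chanN_nonneg hW u v)) hmin)
  calc Real.exp (-(n * objR Q W R (wordType (pairW x y)) (wordType (pairW x' y))))
      = Real.exp (-(n * g1)) * Real.exp (-(n * max (g2 - R) 0)) := by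
        rw [← Real.exp_add, objR]; congr 1; ring
    _ ≤ (((n : ℝ) + 1) ^ c * clsProb (joint Q W) N n) * Real.exp (-(n * max (g2 - R) 0)) := by
        gcongr
    _ = ((n : ℝ) + 1) ^ c * (clsProb (joint Q W) N n * Real.exp (-(n * max (g2 - R) 0))) := by ring
    _ ≤ ((n : ℝ) + 1) ^ c * (2 * ((n : ℝ) + 1) ^ c * rcu W q k (condDist Q D)) := by gcongr
    _ = _ := by rw [two_mul c, pow_add]; ring

/-! ### Realizing a feasible pair by words of the ensemble -/

/-- The weight on triples that puts mass `c x` at `(x, x, y₀ x)`. -/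
def diagW (y₀ : X → Y) (c : X → ℝ) (z : X × X × Y) : ℝ := if z.2 = (z.1, y₀ z.1) then c z.1 else 0

theorem sum_diagW (y₀ : X → Y) (c : X → ℝ) (f : X × X × Y → ℝ) :
    ∑ z, diagW y₀ c z * f z = ∑ x, c x * f (x, x, y₀ x) := by
  rw [Fintype.sum_prod_type]
  refine Finset.sum_congr rfl fun x _ => ?_
  rw [Finset.sum_eq_single (x, y₀ x)]
  · simp [diagW]
  · intro b _ hb
    simp [diagW, hb]
  · simp

/-- The coupling of `P` and `P'` along `Y`, conditionally independent given `Y`. -/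
def couple (P P' : X × Y → ℝ) (z : X × X × Y) : ℝ := P (z.1, z.2.2) * P' z.2 / margY P z.2.2

theorem sum_couple_left {P P' : X × Y → ℝ} (hP : ∀ b, 0 ≤ P b) (hY : margY P' = margY P)
    (f : X × Y → ℝ) : ∑ z : X × X × Y, couple P P' z * f (z.1, z.2.2) = ∑ b, P b * f b := by
  rw [Fintype.sum_prod_type, Fintype.sum_prod_type]
  refine Finset.sum_congr rfl fun x _ => ?_
  rw [Fintype.sum_prod_type_right]
  refine Finset.sum_congr rfl fun y _ => ?_
  have h1 : ∑ x', couple P P' (x, x', y) * f (x, y) =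
      (P (x, y) * f (x, y) / margY P y) * margY P' y := by
    rw [show margY P' y = ∑ x', P' (x', y) from rfl, Finset.mul_sum]
    refine Finset.sum_congr rfl fun x' _ => ?_
    simp only [couple]
    ring
  simp only at h1 ⊢
  rw [h1, hY]
  by_cases h0 : margY P y = 0
  · simp [eq_zero_of_margY_eq_zero hP h0 x]
  · field_simp

theorem sum_couple_right {P P' : X × Y → ℝ} (hP' : ∀ b, 0 ≤ P' b) (hY : margY P' = margY P)
    (f : X × Y → ℝ) : ∑ z : X × X × Y, couple P P' z * f z.2 = ∑ b, P' b * f b := by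
  rw [Fintype.sum_prod_type_right]
  refine Finset.sum_congr rfl fun b _ => ?_
  have h1 : ∑ x, couple P P' (x, b) * f b = (P' b * f b / margY P b.2) * margY P b.2 := by
    nth_rw 2 [margY]
    rw [Finset.mul_sum]
    refine Finset.sum_congr rfl fun x _ => ?_
    simp only [couple]
    ring
  rw [h1]
  by_cases h0 : margY P b.2 = 0
  · have : P' b = 0 := eq_zero_of_margY_eq_zero hP' (hY ▸ h0) b.1
    simp [this]
  · field_simp

theorem mean_margX (P : X × Y → ℝ) (f : X → ℝ) : mean (margX P) f = ∑ b, P b * f b.1 := by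
  rw [Fintype.sum_prod_type]
  exact Finset.sum_congr rfl fun x _ => Finset.sum_mul _ _ _

/-- The words come from integer counts on triples `(x, x', y)`. The base triple is `(x₀, x₀, y₀ x₀)`
with `x₀` from `slack` and `W x (y₀ x) ≠ 0`; its type is close to `V0` and both its metrics agree.
Adding `z ≈ k • d` with `k ≈ n` brings the type close to `V = V0 + d`, which is close to the
coupling `Vs` of the given pair. Mixing some `V0` into `V` keeps `V` positive wherever the base
triple has letters, so no count becomes negative. -/
theorem eventually_exists_words {Q : X → ℝ} (hQ : Q ∈ stdSimplex ℝ X) {W : X → Y → ℝ}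
    (hW : IsChannel W) {q : X → Y → ℝ} (hq : ∀ x y, 0 ≤ q x y)
    (hqW : ∀ x y, q x y = 0 → Q x * W x y = 0) {R : ℝ} {L : ℕ} {a : Fin L → X → ℝ}
    {D : ∀ n, Set (Fin n → X)} (hD : IsEnsemble Q a D) {p : (X × Y → ℝ) × (X × Y → ℝ)}
    (hp : p ∈ feasible Q W q a) {ε : ℝ} (hε : 0 < ε) :
    ∀ᶠ n : ℕ in atTop, ∃ x ∈ D n, ∃ x' ∈ D n, ∃ y : Fin n → Y,
      (∀ i, joint Q W (pairW x y i) ≠ 0) ∧ (∀ i, Q (x' i) ≠ 0) ∧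
      metricN q x y ≤ metricN q x' y ∧
      objR Q W R (wordType (pairW x y)) (wordType (pairW x' y)) < objR Q W R p.1 p.2 + ε := by
  obtain ⟨P, P'⟩ := p
  obtain ⟨⟨hP, hP'⟩, hc1, hc2, hY, hac1, hac2, hac3, hlog⟩ := hp
  simp only at hP hP' hc1 hc2 hY hac1 hac2 hac3 hlog ⊢
  have hy₀ : ∀ x, ∃ y, W x y ≠ 0 := fun x => by
    by_contra h
    push Not at h
    have := (hW x).2
    simp [h] at this
  choose y₀ hy₀ using hy₀
  -- the two marginals as functions of the weight on triples
  let f1 : X × X × Y → X × Y := fun z => (z.1, z.2.2)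
  let f2 : X × X × Y → X × Y := fun z => z.2
  let F : (X × X × Y → ℝ) → ℝ := fun V => objR Q W R (push f1 V) (push f2 V)
  have hF : Continuous F :=
    (continuous_objR Q W R).comp ((continuous_push f1).prodMk (continuous_push f2))
  set Vs : X × X × Y → ℝ := couple P P' with hVs
  set V0 : X × X × Y → ℝ := diagW y₀ Q with hV0
  have hFs : F Vs = objR Q W R P P' := by
    have e1 : push f1 Vs = P := by
      funext b
      have := sum_couple_left hP.1 hY fun b' => if b' = b then 1 else 0
      simpa [push] using this
    have e2 : push f2 Vs = P' := by
      funext b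
      have := sum_couple_right hP'.1 hY fun b' => if b' = b then 1 else 0
      simpa [push] using this
    simp only [F, e1, e2]
  have hVs0 : ∀ z, 0 ≤ Vs z := fun z =>
    div_nonneg (mul_nonneg (hP.1 _) (hP'.1 _)) ((margY_mem hP).1 _)
  have hV00 : ∀ z, 0 ≤ V0 z := fun z => by
    simp only [hV0, diagW]; split_ifs
    · exact hQ.1 _
    · exact le_rfl
  -- a mixture close to `Vs`
  obtain ⟨s, hs0, hs1, hs⟩ : ∃ s : ℝ, 0 < s ∧ s < 1 ∧
      F (fun z => (1 - s) * Vs z + s * V0 z) < objR Q W R P P' + ε := by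
    have hcont : Continuous fun s : ℝ => F fun z => (1 - s) * Vs z + s * V0 z :=
      hF.comp (continuous_pi fun z => by fun_prop)
    have h0 : (fun s : ℝ => F fun z => (1 - s) * Vs z + s * V0 z) 0 < objR Q W R P P' + ε := by
      simp only [sub_zero, one_mul, zero_mul, add_zero]
      rw [hFs]
      linarith
    have := (hcont.tendsto 0).eventually (gt_mem_nhds h0)
    obtain ⟨r, hr, hball⟩ := Metric.eventually_nhds_iff.1 this
    refine ⟨min (r / 2) (1 / 2), lt_min (by linarith) (by norm_num),
      (min_le_right _ _).trans_lt (by norm_num), hball ?_⟩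
    rw [Real.dist_eq, sub_zero, abs_of_pos (lt_min (by linarith) (by norm_num))]
    exact (min_le_left _ _).trans_lt (by linarith)
  set V : X × X × Y → ℝ := fun z => (1 - s) * Vs z + s * V0 z with hV
  obtain ⟨ρ, hρ, hball⟩ := Metric.eventually_nhds_iff.1 ((hF.tendsto V).eventually (gt_mem_nhds hs))
  have hVnn : ∀ z, 0 ≤ V z := fun z =>
    add_nonneg (mul_nonneg (by linarith) (hVs0 z)) (mul_nonneg hs0.le (hV00 z))
  have hVsupp : ∀ z, V z ≠ 0 → Vs z ≠ 0 ∨ V0 z ≠ 0 := fun z hz => by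
    by_contra h
    push Not at h
    exact hz (by simp [hV, h.1, h.2])
  have hVsupp' : ∀ z, V z = 0 → Vs z = 0 ∧ V0 z = 0 := fun z hz => by
    have h1 : 0 ≤ (1 - s) * Vs z := mul_nonneg (by linarith) (hVs0 z)
    have h2 : 0 ≤ s * V0 z := mul_nonneg hs0.le (hV00 z)
    have h3 : (1 - s) * Vs z + s * V0 z = 0 := hz
    constructor
    · exact (mul_eq_zero.1 (show (1 - s) * Vs z = 0 by linarith)).resolve_left (by linarith)
    · exact (mul_eq_zero.1 (show s * V0 z = 0 by linarith)).resolve_left hs0.ne'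
  obtain ⟨v, hv0, hv⟩ : ∃ v > 0, ∀ z, V z ≠ 0 → v ≤ V z := by
    by_cases hne : (Finset.univ.filter fun z => V z ≠ 0).Nonempty
    · obtain ⟨z0, hz0, hmin⟩ := Finset.exists_min_image _ V hne
      refine ⟨V z0, lt_of_le_of_ne (hVnn _) (Finset.mem_filter.1 hz0).2.symm, fun z hz => ?_⟩
      exact hmin z (Finset.mem_filter.2 ⟨Finset.mem_univ _, hz⟩)
    · refine ⟨1, one_pos, fun z hz => ?_⟩
      exact absurd ⟨z, Finset.mem_filter.2 ⟨Finset.mem_univ _, hz⟩⟩ hne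
  set d : X × X × Y → ℝ := fun z => V z - V0 z with hd
  have hd' : ∀ z, d z = (1 - s) * (Vs z - V0 z) := fun z => by simp only [hd, hV]; ring
  have hdsum : ∀ f : X × X × Y → ℝ,
      ∑ z, d z * f z = (1 - s) * (∑ z, Vs z * f z - ∑ z, V0 z * f z) := fun f => by
    rw [← Finset.sum_sub_distrib, Finset.mul_sum]
    exact Finset.sum_congr rfl fun z _ => by rw [hd']; ring
  have hd1 : ∑ z, d z = 0 := by
    have e1 := sum_couple_left hP.1 hY fun _ => 1
    have e2 := sum_diagW y₀ Q fun _ => 1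
    have e3 := hdsum fun _ => 1
    simp only [mul_one] at e1 e2 e3
    rw [e3, hVs, hV0, e1, e2, hP.2, hQ.2]
    ring
  have hdA1 : ∀ l, ∑ z, d z * a l z.1 = 0 := fun l => by
    have e1 := sum_couple_left hP.1 hY fun b => a l b.1
    have e2 := sum_diagW y₀ Q fun z => a l z.1
    rw [hdsum, hVs, hV0, e1, e2, ← mean_margX, hc1 l, mean]
    ring
  have hdA2 : ∀ l, ∑ z, d z * a l z.2.1 = 0 := fun l => by
    have e1 := sum_couple_right hP'.1 hY fun b => a l b.1
    have e2 := sum_diagW y₀ Q fun z => a l z.2.1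
    rw [hdsum, hVs, hV0, e1, e2, ← mean_margX, hc2 l, mean]
    ring
  -- The metric advantage of `x'` over `x` per letter: it vanishes on the base triple and has
  -- nonnegative pairing with `d`, so the exact metric inequality reduces to `0 ≤ ∑ z B`.
  set B : X × X × Y → ℝ := fun z => Real.log (q z.2.1 z.2.2) - Real.log (q z.1 z.2.2) with hB
  have hdB : 0 ≤ ∑ z, d z * B z := by
    have e1 := sum_couple_left hP.1 hY fun b => Real.log (q b.1 b.2)
    have e2 := sum_couple_right hP'.1 hY fun b => Real.log (q b.1 b.2)
    have e3 := sum_diagW y₀ Q B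
    have e4 : ∑ z, couple P P' z * B z = ∑ b, P' b * Real.log (q b.1 b.2) -
        ∑ b, P b * Real.log (q b.1 b.2) := by
      rw [← e1, ← e2, ← Finset.sum_sub_distrib]
      exact Finset.sum_congr rfl fun z _ => mul_sub _ _ _
    have e5 : ∑ x, Q x * B (x, x, y₀ x) = 0 := by simp [hB]
    rw [hdsum, hVs, hV0, e3, e4, e5, sub_zero]
    exact mul_nonneg (by linarith) (by linarith)
  obtain ⟨η, hη, hslack⟩ := hD.slack
  -- the precision of the integer approximation
  set K : ℝ := 1 + (Fintype.card (X × X × Y) +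
    ∑ l, (∑ z : X × X × Y, |a l z.1| + ∑ z : X × X × Y, |a l z.2.1|)) with hK
  have hKl : ∀ l, ∑ z : X × X × Y, |a l z.1| + ∑ z : X × X × Y, |a l z.2.1| ≤ K - 1 := fun l => by
    have := Finset.single_le_sum (f := fun l => ∑ z : X × X × Y, |a l z.1| +
      ∑ z : X × X × Y, |a l z.2.1|) (fun l _ => by positivity) (Finset.mem_univ l)
    have h2 : (0 : ℝ) ≤ Fintype.card (X × X × Y) := by positivity
    linarith
  have hKc : (Fintype.card (X × X × Y) : ℝ) ≤ K - 1 := by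
    have : 0 ≤ ∑ l, (∑ z : X × X × Y, |a l z.1| + ∑ z : X × X × Y, |a l z.2.1|) := by positivity
    linarith
  have hK1 : 1 ≤ K := by
    have : (0 : ℝ) ≤ Fintype.card (X × X × Y) := by positivity
    linarith
  set η' : ℝ := min η 1 / K with hη'
  have hη'0 : 0 < η' := div_pos (lt_min hη one_pos) (by linarith)
  have hη'K : η' * K = min η 1 := div_mul_cancel₀ _ (by linarith)
  have hη'1 : η' ≤ 1 := by
    have := min_le_right η 1
    nlinarith
  have hη'lt : ∀ t, t ≤ K - 1 → η' * t < min η 1 := fun t ht => by nlinarith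
  obtain ⟨C, hC⟩ := exists_int_near_mul_nonneg d B hdB hη'0
  -- The radius `ρ` keeps `objR` below the target, and `v`, a lower bound of `V` on its support,
  -- keeps the counts positive there.
  set ρ' := min ρ v with hρ'
  have hρ'0 : 0 < ρ' := lt_min hρ hv0
  -- The deviation of `z` from `n • d` is bounded by `1 + C * ∑ |d|` uniformly in `n`, hence
  -- negligible after division by `n`.
  obtain ⟨n₀, hn₀⟩ := exists_nat_gt ((1 + C * ∑ z, |d z|) / (ρ' / 2))
  filter_upwards [eventually_ge_atTop C, eventually_gt_atTop 0, eventually_ge_atTop n₀,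
    hslack (ρ' / 4) (by linarith)] with n hnC hnpos hn hx₀
  obtain ⟨x₀, hx₀D, hx₀t, hx₀Q, hx₀s⟩ := hx₀
  obtain ⟨k, z, hk, hz, hzB⟩ := hC n hnC
  have hn' : (0 : ℝ) < n := by exact_mod_cast hnpos
  -- A functional vanishing on `d` sees only the rounding error of `z`. This is used for the costs
  -- and for the total count, where an integer smaller than 1 must be 0.
  have hzsum : ∀ f : X × X × Y → ℝ, ∑ w, d w * f w = 0 → ∑ w, |f w| ≤ K - 1 →
      |∑ w, (z w : ℝ) * f w| < min η 1 := fun f hf hfK => by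
    have e : ∑ w, (z w : ℝ) * f w = ∑ w, ((z w : ℝ) - k * d w) * f w := by
      have : ∑ w, ((z w : ℝ) - k * d w) * f w =
          ∑ w, (z w : ℝ) * f w - k * ∑ w, d w * f w := by
        rw [Finset.mul_sum, ← Finset.sum_sub_distrib]
        exact Finset.sum_congr rfl fun i _ => by ring
      rw [this, hf]; ring
    rw [e]
    exact (abs_sum_mul_le f hz).trans_lt (hη'lt _ hfK)
  have hzd : ∀ w, |(z w : ℝ) / n - d w| < ρ' / 2 := fun w => by
    have e : (z w : ℝ) / n - d w = (((z w : ℝ) - k * d w) + (k - n) * d w) / n := by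
      field_simp; ring
    rw [e, abs_div, abs_of_pos hn', div_lt_iff₀ hn']
    have h1 : |((k : ℝ) - n) * d w| ≤ C * ∑ z, |d z| := by
      rw [abs_mul]
      refine mul_le_mul (by exact_mod_cast hk) ?_ (abs_nonneg _) (by positivity)
      exact Finset.single_le_sum (f := fun z => |d z|) (fun _ _ => abs_nonneg _) (Finset.mem_univ w)
    have h2 : (1 + C * ∑ z, |d z|) < n * (ρ' / 2) := by
      rw [← div_lt_iff₀ (by linarith)]
      exact hn₀.trans_le (by exact_mod_cast hn)
    have h3 := (abs_add_le ((z w : ℝ) - k * d w) ((k - n) * d w))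
    have h4 := hz w
    linarith
  -- the counts of the triple
  set N : X × X × Y → ℤ := fun w => (if w.2 = (w.1, y₀ w.1) then (cnt x₀ w.1 : ℤ) else 0) + z w
    with hN
  have hNcast : ∀ w, (N w : ℝ) = diagW y₀ (fun b => (cnt x₀ b : ℝ)) w + z w := fun w => by
    simp only [hN, diagW]
    push_cast
    split_ifs <;> simp
  have hNV : ∀ w, |(N w : ℝ) / n - V w| < ρ' := fun w => by
    have e : (N w : ℝ) / n - V w =
        (diagW y₀ (fun b => (cnt x₀ b : ℝ)) w / n - V0 w) + ((z w : ℝ) / n - d w) := by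
      rw [hNcast]; simp only [hd]; ring
    have h1 : |diagW y₀ (fun b => (cnt x₀ b : ℝ)) w / n - V0 w| ≤ ρ' / 4 := by
      simp only [hV0, diagW]
      split_ifs
      · exact hx₀t w.1
      · simp; linarith
    rw [e]
    have h2 := abs_add_le (diagW y₀ (fun b => (cnt x₀ b : ℝ)) w / n - V0 w) ((z w : ℝ) / n - d w)
    have h3 := hzd w
    linarith
  -- Off the support of `V` also `d` vanishes, so `z` is an integer within `η' ≤ 1` of 0, hence 0.
  have hN0 : ∀ w, V w = 0 → N w = 0 := fun w hw => by
    obtain ⟨h1, h2⟩ := hVsupp' w hw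
    have h3 : d w = 0 := by rw [hd', h1, h2]; ring
    have h4 := hz w
    rw [h3, mul_zero, sub_zero] at h4
    have h5 : z w = 0 := by
      have h6 : |(z w : ℝ)| < 1 := h4.trans_le hη'1
      exact Int.abs_lt_one_iff.1 (by exact_mod_cast h6)
    simp only [hN, h5, add_zero]
    split_ifs with hw2
    · have h6 : Q w.1 = 0 := by simpa [hV0, diagW, hw2] using h2
      have h7 : cnt x₀ w.1 = 0 := by
        by_contra hne
        obtain ⟨i, hi⟩ := (cnt_pos_iff _ _).1 (Nat.pos_of_ne_zero hne)
        exact hx₀Q i (hi ▸ h6)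
      exact_mod_cast h7
    · rfl
  have hNnn : ∀ w, 0 ≤ N w := fun w => by
    by_cases hw : V w = 0
    · rw [hN0 w hw]
    · have h1 := (abs_lt.1 (hNV w)).1
      have h2 := hv w hw
      have h3 : ρ' ≤ v := min_le_right _ _
      have h4 : 0 < (N w : ℝ) / n := by linarith
      have h5 : 0 < (N w : ℝ) := by
        by_contra h
        exact absurd h4 (not_lt.2 (div_nonpos_of_nonpos_of_nonneg (not_lt.1 h) hn'.le))
      exact_mod_cast h5.le
  have hNsum : ∑ w, (N w).toNat = n := by
    have h1 := hzsum (fun _ => 1) (by simpa using hd1) (by simpa using hKc)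
    simp only [mul_one] at h1
    have h2 : ∑ w, z w = 0 := by
      have h3 : |((∑ w, z w : ℤ) : ℝ)| < 1 := by
        push_cast
        exact h1.trans_le (min_le_right _ _)
      exact Int.abs_lt_one_iff.1 (by exact_mod_cast h3)
    have h3 : ((∑ w, (N w).toNat : ℕ) : ℝ) = n := by
      push_cast
      have e1 : ∀ w, (((N w).toNat : ℕ) : ℝ) = N w := fun w => by
        exact_mod_cast congrArg (Int.cast (R := ℝ)) (Int.toNat_of_nonneg (hNnn w))
      have e2 := sum_diagW y₀ (fun b => (cnt x₀ b : ℝ)) fun _ => 1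
      simp only [mul_one] at e2
      have e3 : ∑ w, (z w : ℝ) = 0 := by exact_mod_cast h2
      simp_rw [e1, hNcast]
      rw [Finset.sum_add_distrib, e2, e3, add_zero]
      exact_mod_cast sum_cnt x₀
    exact_mod_cast h3
  obtain ⟨w, hw⟩ := exists_word (fun u => (N u).toNat) hNsum
  have hcntN : ∀ u, (cnt w u : ℝ) = diagW y₀ (fun b => (cnt x₀ b : ℝ)) u + z u := fun u => by
    rw [← hNcast, hw]
    exact_mod_cast congrArg (Int.cast (R := ℝ)) (Int.toNat_of_nonneg (hNnn u))
  have hwsum : ∀ f : X × X × Y → ℝ, ∑ i, f (w i) =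
      ∑ b, (cnt x₀ b : ℝ) * f (b, b, y₀ b) + ∑ u, (z u : ℝ) * f u := fun f => by
    rw [sum_word, ← sum_diagW, ← Finset.sum_add_distrib]
    exact Finset.sum_congr rfl fun u _ => by rw [hcntN]; ring
  have hwV : ∀ i, V (w i) ≠ 0 := fun i h => by
    have h1 := cnt_apply_pos w i
    rw [hw] at h1
    simp only [hN0 _ h] at h1
    exact lt_irrefl _ h1
  have hsupp : ∀ i, Q (w i).1 * W (w i).1 (w i).2.2 ≠ 0 ∧ Q (w i).2.1 ≠ 0 ∧
      q (w i).2.1 (w i).2.2 ≠ 0 := fun i => by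
    rcases hVsupp _ (hwV i) with h | h
    · simp only [hVs, couple] at h
      have h1 : P ((w i).1, (w i).2.2) ≠ 0 := fun h0 => h (by simp [h0])
      have h2 : P' (w i).2 ≠ 0 := fun h0 => h (by simp [h0])
      exact ⟨fun h0 => h1 (hac1 _ h0), fun h0 => h2 (hac2 _ h0), fun h0 => h2 (hac3 _ h0)⟩
    · simp only [hV0, diagW] at h
      split_ifs at h with h1
      · have e1 : (w i).2.1 = (w i).1 := by rw [h1]
        have e2 : (w i).2.2 = y₀ (w i).1 := by rw [h1]
        rw [e1, e2]
        have h3 : Q (w i).1 * W (w i).1 (y₀ (w i).1) ≠ 0 := mul_ne_zero h (hy₀ _)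
        exact ⟨h3, h, fun h0 => h3 (hqW _ _ h0)⟩
      · exact absurd rfl h
  refine ⟨fun i => (w i).1, ?_, fun i => (w i).2.1, ?_, fun i => (w i).2.2,
    fun i => (hsupp i).1, fun i => (hsupp i).2.1, ?_, ?_⟩
  · refine hx₀s _ (fun i => left_ne_zero_of_mul (hsupp i).1) fun l => ?_
    rw [hwsum fun u => a l u.1, sum_word x₀, add_sub_cancel_left]
    refine (hzsum _ (hdA1 l) (le_trans ?_ (hKl l))).trans_le (min_le_left _ _)
    have : 0 ≤ ∑ z : X × X × Y, |a l z.2.1| := by positivity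
    linarith
  · refine hx₀s _ (fun i => (hsupp i).2.1) fun l => ?_
    rw [hwsum fun u => a l u.2.1, sum_word x₀, add_sub_cancel_left]
    refine (hzsum _ (hdA2 l) (le_trans ?_ (hKl l))).trans_le (min_le_left _ _)
    have : 0 ≤ ∑ z : X × X × Y, |a l z.1| := by positivity
    linarith
  · have h1 : ∀ i, 0 < q (w i).1 (w i).2.2 := fun i =>
      lt_of_le_of_ne (hq _ _) fun h => (hsupp i).1 (hqW _ _ h.symm)
    have h2 : ∀ i, 0 < q (w i).2.1 (w i).2.2 := fun i =>
      lt_of_le_of_ne (hq _ _) (hsupp i).2.2.symm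
    unfold metricN
    rw [← Real.log_le_log_iff (Finset.prod_pos fun i _ => h1 i) (Finset.prod_pos fun i _ => h2 i),
      Real.log_prod fun i _ => (h1 i).ne', Real.log_prod fun i _ => (h2 i).ne', ← sub_nonneg,
      ← Finset.sum_sub_distrib]
    have h3 := hwsum B
    simp only [hB, sub_self, mul_zero, Finset.sum_const_zero, zero_add] at h3
    rw [h3]
    exact hzB
  · have h1 : dist (wordType w) V < ρ := by
      rw [dist_pi_lt_iff hρ]
      intro u
      rw [Real.dist_eq, wordType_eq, hcntN, ← hNcast]
      exact (hNV u).trans_le (min_le_left _ _)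
    have h2 := hball h1
    simp only [F, ← wordType_comp] at h2
    exact h2

theorem eventually_le_rcu {Q : X → ℝ} (hQ : Q ∈ stdSimplex ℝ X) {W : X → Y → ℝ}
    (hW : IsChannel W) {q : X → Y → ℝ} (hq : ∀ x y, 0 ≤ q x y)
    (hqW : ∀ x y, q x y = 0 → Q x * W x y = 0) {R : ℝ} {k : ℕ → ℕ}
    (hk : ∀ᶠ n : ℕ in atTop, Real.exp (n * R) ≤ 2 * k n) {L : ℕ} {a : Fin L → X → ℝ}
    {D : ∀ n, Set (Fin n → X)} (hD : IsEnsemble Q a D) {p : (X × Y → ℝ) × (X × Y → ℝ)}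
    (hp : p ∈ feasible Q W q a) {ε : ℝ} (hε : 0 < ε) :
    ∀ᶠ n : ℕ in atTop, 4 * Real.exp (-(n * (objR Q W R p.1 p.2 + ε))) ≤
      rcu W q (k n) (condDist Q (D n)) := by
  filter_upwards [eventually_exists_words hQ hW hq hqW (R := R) hD hp (show 0 < ε / 2 by linarith),
    hk, hD.mass 1 one_pos,
    eventually_poly_le_exp 8 (2 * Fintype.card (X × Y)) (show 0 < ε / 2 by linarith)]
    with n h1 h2 h3 h4
  obtain ⟨x, hx, x', hx', y, hxy, hx'Q, hm, hobj⟩ := h1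
  have hμ : 0 < condMass Q (D n) := (Real.exp_pos _).trans_le h3
  have h5 := exp_le_rcu hQ hW q h2 hμ (hD.inv n) hx hx' hxy hx'Q hm
  have hA : 0 < 2 * ((n : ℝ) + 1) ^ (2 * Fintype.card (X × Y)) := by positivity
  have h6 : Real.exp (-(n * (objR Q W R p.1 p.2 + ε / 2))) ≤
      2 * ((n : ℝ) + 1) ^ (2 * Fintype.card (X × Y)) * rcu W q (k n) (condDist Q (D n)) := by
    refine le_trans (Real.exp_le_exp.2 ?_) h5
    have := mul_le_mul_of_nonneg_left hobj.le (n.cast_nonneg (α := ℝ))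
    linarith
  refine le_of_mul_le_mul_left (le_trans ?_ h6) hA
  calc 2 * ((n : ℝ) + 1) ^ (2 * Fintype.card (X × Y)) *
        (4 * Real.exp (-(n * (objR Q W R p.1 p.2 + ε))))
      = 8 * ((n : ℝ) + 1) ^ (2 * Fintype.card (X × Y)) *
        Real.exp (-(n * (objR Q W R p.1 p.2 + ε))) := by ring
    _ ≤ Real.exp (n * (ε / 2)) * Real.exp (-(n * (objR Q W R p.1 p.2 + ε))) := by gcongr
    _ = _ := by rw [← Real.exp_add]; congr 1; ring

/-- The exponent of an ensemble of conditioned i.i.d. words. -/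
theorem IsEnsemble.hasExponent {Q : X → ℝ} (hQ : Q ∈ stdSimplex ℝ X) {W : X → Y → ℝ}
    (hW : IsChannel W) {q : X → Y → ℝ} (hq : ∀ x y, 0 ≤ q x y) {R : ℝ} (hR : 0 < R) {M : ℕ → ℕ}
    (hM : ∀ n : ℕ, |(M n : ℝ) - Real.exp (n * R)| < 1) {L : ℕ} {a : Fin L → X → ℝ}
    {D : ∀ n, Set (Fin n → X)} (hD : IsEnsemble Q a D) :
    HasExponent (fun n => avgErrProb W q (M n) (condDist Q (D n))) (expCost Q W q R a) := by
  -- Since `exp (n * R) ≥ 1`, rounding never gives zero codewords.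
  have hM1 : ∀ n, ∃ k, M n = k + 1 := fun n => by
    refine Nat.exists_eq_succ_of_ne_zero fun h => ?_
    have h1 := hM n
    have h2 : 1 ≤ Real.exp (n * R) := Real.one_le_exp (by positivity)
    rw [h, Nat.cast_zero, zero_sub, abs_neg, abs_of_pos (by linarith)] at h1
    linarith
  choose k hk using hM1
  have hkM : ∀ n, (M n : ℝ) = k n + 1 := fun n => by rw [hk]; push_cast; ring
  have hk1 : ∀ n, (k n : ℝ) ≤ 2 * Real.exp (n * R) := fun n => by
    have := (abs_lt.1 (hM n)).2
    rw [hkM] at this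
    linarith [Real.exp_pos (n * R)]
  -- Rounding and removing the sent message cost less than 2, which is at most half of `exp (n * R)`
  -- once this is at least 4.
  have hk2 : ∀ᶠ n : ℕ in atTop, Real.exp (n * R) ≤ 2 * k n := by
    filter_upwards [eventually_poly_le_exp 4 0 hR] with n hn
    have := (abs_lt.1 (hM n)).1
    rw [hkM] at this
    simp only [pow_zero, mul_one] at hn
    linarith
  have hμ : ∀ᶠ n : ℕ in atTop, 0 < condMass Q (D n) := by
    filter_upwards [hD.mass 1 one_pos] with n hn
    exact (Real.exp_pos _).trans_le hn
  by_cases hqW : ∀ x y, q x y = 0 → Q x * W x y = 0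
  · obtain ⟨p, hp, hmin, he⟩ := exists_feasible_min hQ hW hqW R a
    rw [he]
    refine hasExponent_of_bounds (fun ε hε => ?_) (fun ε hε => ?_)
    · filter_upwards [eventually_rcu_le hQ hW hq hqW hk1 hD hε hmin, hμ] with n hn hμn
      rw [hk n]
      exact (avgErrProb_le_rcu hW q (k n) (condDist_mem hQ hμn)).trans hn
    · filter_upwards [eventually_le_rcu hQ hW hq hqW hk2 hD hp hε, hμ] with n hn hμn
      rw [hk n]
      linarith [rcu_le_avgErrProb hW q (k n) (condDist_mem hQ hμn)]
  · rw [(exists_min_of_zero hQ hW hqW hR a).1, ← EReal.coe_zero]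
    have hk3 : ∀ᶠ n in atTop, 1 ≤ k n := by
      filter_upwards [hk2] with n hn
      by_contra h
      have h0 : k n = 0 := by omega
      rw [h0] at hn
      simp only [Nat.cast_zero, mul_zero] at hn
      linarith [Real.exp_pos (n * R)]
    refine hasExponent_of_bounds (fun ε hε => ?_) (fun ε hε => ?_)
    · filter_upwards [hμ] with n hμn
      have hP := condDist_mem hQ hμn
      have h1 : rcu W q (k n) (condDist Q (D n)) ≤ 1 := by
        calc rcu W q (k n) (condDist Q (D n))
            ≤ ∑ x : Fin n → X, ∑ y : Fin n → Y, condDist Q (D n) x * chanN W x y := by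
              refine Finset.sum_le_sum fun x _ => Finset.sum_le_sum fun y _ => ?_
              exact mul_le_of_le_one_right (mul_nonneg (hP.1 x) (chanN_nonneg hW x y))
                (min_le_left _ _)
          _ = 1 := by
              rw [← hP.2]
              refine Finset.sum_congr rfl fun x _ => ?_
              rw [← Finset.mul_sum]
              have := Finset.prod_univ_sum (fun _ : Fin n => (Finset.univ : Finset Y))
                (fun i b => W (x i) b)
              simp only [(hW _).2, Finset.prod_const_one, Fintype.piFinset_univ] at this
              unfold chanN
              rw [← this, mul_one]
      rw [hk n]
      refine ((avgErrProb_le_rcu hW q (k n) hP).trans h1).trans (Real.one_le_exp ?_)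
      have : 0 ≤ (n : ℝ) * ε := by positivity
      linarith
    · filter_upwards [eventually_le_rcu_of_zero hQ hW hq hqW hk3 hD.mass, hμ,
        eventually_poly_le_exp 8 0 hε] with n hn hμn h8
      rw [hk n]
      have h1 := rcu_le_avgErrProb hW q (k n) (condDist_mem hQ hμn)
      have h2 : Real.exp (-(n * (0 + ε))) ≤ 1 / 8 := by
        rw [zero_add, Real.exp_neg, ← one_div]
        exact one_div_le_one_div_of_le (by norm_num) (by simpa using h8)
      linarith

end Converse

/-! ### Concentration of multinomial counts -/

section Packing

variable {X : Type*} [Fintype X]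

/-- Shifts of order `√m` change factorials symmetrically only by a bounded factor: the ratio is at
most `((m + k) / (m - k + 1)) ^ k`, and Bernoulli's inequality bounds its inverse below by 1/2. -/
theorem factorial_add_mul_factorial_sub_le {m k : ℕ} (h : 4 * k ^ 2 ≤ m) :
    ((m + k).factorial : ℝ) * ((m - k).factorial : ℝ) ≤ 2 * (m.factorial : ℝ) ^ 2 := by
  rcases Nat.eq_zero_or_pos k with rfl | hk
  · simp only [add_zero, Nat.sub_zero]
    nlinarith [sq_nonneg (m.factorial : ℝ)]
  have hkm : k ≤ m := by nlinarith
  have h1 : (((m + k).factorial : ℕ) : ℝ) ≤ m.factorial * ((m : ℝ) + k) ^ k := by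
    have e := Nat.factorial_mul_ascFactorial m k
    have e2 := Nat.ascFactorial_le_pow_add m k
    rw [← e]
    push_cast
    gcongr
    exact_mod_cast e2
  have h2 : ((m - k).factorial : ℝ) * ((m : ℝ) - k + 1) ^ k ≤ m.factorial := by
    have e := Nat.factorial_mul_pow_le_factorial (m := m - k) (n := k)
    rw [Nat.sub_add_cancel hkm] at e
    have e3 : ((m : ℝ) - k + 1) = ((m - k + 1 : ℕ) : ℝ) := by push_cast [hkm]; ring
    rw [e3]
    exact_mod_cast e
  have hk' : (1 : ℝ) ≤ k := by exact_mod_cast hk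
  have hm' : 4 * (k : ℝ) ^ 2 ≤ m := by exact_mod_cast h
  have hmk : 0 < (m : ℝ) + k := by positivity
  have hpos : 0 < (m : ℝ) - k + 1 := by nlinarith
  have h3 : ((m : ℝ) + k) ^ k ≤ 2 * ((m : ℝ) - k + 1) ^ k := by
    have hb := one_add_mul_le_pow (a := -((2 * (k : ℝ) - 1) / (m + k))) (by
      have : (2 * (k : ℝ) - 1) / (m + k) ≤ 2 := by
        rw [div_le_iff₀ hmk]; nlinarith
      linarith) k
    have e1 : 1 + -((2 * (k : ℝ) - 1) / (m + k)) = ((m : ℝ) - k + 1) / (m + k) := by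
      field_simp; ring
    rw [e1, div_pow] at hb
    have e2 : (1 : ℝ) / 2 ≤ 1 + (k : ℝ) * -((2 * (k : ℝ) - 1) / (m + k)) := by
      have : (k : ℝ) * ((2 * (k : ℝ) - 1) / (m + k)) ≤ 1 / 2 := by
        rw [← mul_div_assoc, div_le_iff₀ hmk]; nlinarith
      linarith
    have e3 := e2.trans hb
    rw [le_div_iff₀ (by positivity)] at e3
    linarith
  have hP : 0 < ((m : ℝ) - k + 1) ^ k := by positivity
  have h4 : ((m + k).factorial : ℝ) * ((m - k).factorial : ℝ) * ((m : ℝ) - k + 1) ^ k ≤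
      2 * (m.factorial : ℝ) ^ 2 * ((m : ℝ) - k + 1) ^ k := by
    calc _ = ((m + k).factorial : ℝ) * (((m - k).factorial : ℝ) * ((m : ℝ) - k + 1) ^ k) := by ring
      _ ≤ (m.factorial * ((m : ℝ) + k) ^ k) * m.factorial := by gcongr
      _ ≤ (m.factorial * (2 * ((m : ℝ) - k + 1) ^ k)) * m.factorial := by gcongr
      _ = _ := by ring
  exact le_of_mul_le_mul_right h4 hP

theorem factorial_mul_factorial_le {m p s : ℕ} {k : ℤ} (hp : (p : ℤ) = m + k)
    (hs : (s : ℤ) = m - k) (h : 4 * k ^ 2 ≤ m) :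
    (p.factorial : ℝ) * (s.factorial : ℝ) ≤ 2 * (m.factorial : ℝ) ^ 2 := by
  have h' : 4 * k.natAbs ^ 2 ≤ m := by
    have : (4 * (k.natAbs : ℤ) ^ 2) ≤ m := by rw [Int.natAbs_sq]; exact h
    exact_mod_cast this
  have := factorial_add_mul_factorial_sub_le h'
  rcases le_total 0 k with h0 | h0
  · have e1 : p = m + k.natAbs := by omega
    have e2 : s = m - k.natAbs := by omega
    rw [e1, e2]
    exact this
  · have e1 : p = m - k.natAbs := by omega
    have e2 : s = m + k.natAbs := by omega
    rw [e1, e2, mul_comm]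
    exact this

/-- Counts are not much more likely than one of their translates by `±w`. -/
theorem clsProb_le_add {Q : X → ℝ} (hQ : ∀ b, 0 ≤ Q b) {n : ℕ} {N Np Ns : X → ℕ} {w : X → ℤ}
    (hN : ∑ b, N b = n) (hw : ∑ b, w b = 0) (hp : ∀ b, (Np b : ℤ) = N b + w b)
    (hs : ∀ b, (Ns b : ℤ) = N b - w b) (h : ∀ b, 4 * w b ^ 2 ≤ N b) :
    clsProb Q N n ≤ 2 ^ Fintype.card X * (clsProb Q Np n + clsProb Q Ns n) := by
  have hNp : ∑ b, Np b = n := by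
    have : ∑ b, (Np b : ℤ) = n := by
      simp_rw [hp]; rw [Finset.sum_add_distrib, hw, add_zero]; exact_mod_cast hN
    exact_mod_cast this
  have hNs : ∑ b, Ns b = n := by
    have : ∑ b, (Ns b : ℤ) = n := by
      simp_rw [hs]; rw [Finset.sum_sub_distrib, hw, sub_zero]; exact_mod_cast hN
    exact_mod_cast this
  have hfac : ∀ K : X → ℕ, 0 < ∏ b, ((K b).factorial : ℝ) := fun K =>
    Finset.prod_pos fun b _ => by positivity
  have key : ∀ K : X → ℕ, ∑ b, K b = n → clsProb Q K n =
      n.factorial / (∏ b, ((K b).factorial : ℝ)) * ∏ b, Q b ^ K b := by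
    intro K hK
    have h1 : ((cls K n).card : ℝ) * ∏ b, ((K b).factorial : ℝ) = n.factorial := by
      exact_mod_cast card_cls_mul K hK
    rw [clsProb_eq, ← h1, mul_div_cancel_right₀ _ (hfac K).ne']
  have hQpow : (∏ b, Q b ^ N b) ^ 2 = (∏ b, Q b ^ Np b) * ∏ b, Q b ^ Ns b := by
    rw [← Finset.prod_pow, ← Finset.prod_mul_distrib]
    refine Finset.prod_congr rfl fun b _ => ?_
    rw [← pow_mul, ← pow_add]
    congr 1
    have := hp b; have := hs b
    omega
  have hF : (∏ b, ((Np b).factorial : ℝ)) * ∏ b, ((Ns b).factorial : ℝ) ≤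
      2 ^ Fintype.card X * (∏ b, ((N b).factorial : ℝ)) ^ 2 := by
    rw [← Finset.prod_mul_distrib, ← Finset.prod_pow, ← Finset.card_univ, ← Finset.prod_const,
      ← Finset.prod_mul_distrib]
    exact Finset.prod_le_prod (fun b _ => by positivity) fun b _ =>
      factorial_mul_factorial_le (hp b) (hs b) (h b)
  -- The powers of `Q` cancel exactly because `Np + Ns = 2 N`, so only factorials are compared. The
  -- product of the two translates then bounds the square, and their sum bounds the root.
  have hsq : clsProb Q N n ^ 2 ≤ 2 ^ Fintype.card X * (clsProb Q Np n * clsProb Q Ns n) := by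
    rw [key N hN, key Np hNp, key Ns hNs, mul_pow, hQpow]
    have hq0 : 0 ≤ (∏ b, Q b ^ Np b) * ∏ b, Q b ^ Ns b :=
      mul_nonneg (Finset.prod_nonneg fun b _ => pow_nonneg (hQ b) _)
        (Finset.prod_nonneg fun b _ => pow_nonneg (hQ b) _)
    have e : 2 ^ Fintype.card X * (n.factorial / (∏ b, ((Np b).factorial : ℝ)) *
        (∏ b, Q b ^ Np b) * (n.factorial / (∏ b, ((Ns b).factorial : ℝ)) * ∏ b, Q b ^ Ns b)) =
        (2 ^ Fintype.card X * n.factorial ^ 2 /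
          ((∏ b, ((Np b).factorial : ℝ)) * ∏ b, ((Ns b).factorial : ℝ))) *
        ((∏ b, Q b ^ Np b) * ∏ b, Q b ^ Ns b) := by
      have := (hfac Np).ne'
      have := (hfac Ns).ne'
      field_simp
    rw [e]
    refine mul_le_mul_of_nonneg_right ?_ hq0
    rw [div_pow, div_le_div_iff₀ (pow_pos (hfac N) 2) (mul_pos (hfac Np) (hfac Ns))]
    nlinarith [sq_nonneg (n.factorial : ℝ)]
  have hp0 := clsProb_nonneg hQ Np n
  have hs0 := clsProb_nonneg hQ Ns n
  have hC : (1 : ℝ) ≤ 2 ^ Fintype.card X := one_le_pow₀ (by norm_num)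
  refine le_of_sq_le_sq ?_ (by positivity)
  refine hsq.trans ?_
  rw [mul_pow]
  refine mul_le_mul ?_ (by nlinarith) (by positivity) (by positivity)
  nlinarith

theorem sum_clsProb_le_one {Q : X → ℝ} (hQ : Q ∈ stdSimplex ℝ X) (n : ℕ) (T : Finset (X → ℕ)) :
    ∑ K ∈ T, clsProb Q K n ≤ 1 := by
  have h := Finset.sum_fiberwise_of_maps_to
    (s := (Finset.univ : Finset (Fin n → X)).filter fun w => cnt w ∈ T) (t := T) (g := cnt)
    (fun w hw => (Finset.mem_filter.1 hw).2) (fun w => ∏ i, Q (w i))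
  have h2 : ∑ K ∈ T, clsProb Q K n =
      ∑ w ∈ (Finset.univ : Finset (Fin n → X)).filter fun w => cnt w ∈ T, ∏ i, Q (w i) := by
    rw [← h]
    refine Finset.sum_congr rfl fun K hK => ?_
    unfold clsProb
    congr 1
    ext w
    simp only [mem_cls, Finset.mem_filter, Finset.mem_univ, true_and]
    exact ⟨fun e => ⟨e ▸ hK, e⟩, fun e => e.2⟩
  rw [h2]
  calc _ ≤ ∑ w : Fin n → X, ∏ i, Q (w i) :=
        Finset.sum_le_sum_of_subset_of_nonneg (Finset.subset_univ _) fun _ _ _ =>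
          Finset.prod_nonneg fun _ _ => hQ.1 _
    _ = 1 := by rw [sum_prod_word, hQ.2, one_pow]

/-- A set of counts with many disjoint translates has small probability. -/
theorem card_mul_sum_clsProb_le {Q : X → ℝ} (hQ : Q ∈ stdSimplex ℝ X) {n : ℕ} {I : Type*}
    [Fintype I] (w : I → X → ℤ) (hw : ∀ i, ∑ b, w i b = 0) (S : Finset (X → ℕ))
    (hS : ∀ N ∈ S, ∑ b, N b = n) (hbig : ∀ N ∈ S, ∀ i b, 4 * w i b ^ 2 ≤ N b)
    (hsep : ∀ N ∈ S, ∀ N' ∈ S, ∀ i i', (∀ b, (N b : ℤ) - N' b = w i b - w i' b) → i = i') :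
    Fintype.card I * ∑ N ∈ S, clsProb Q N n ≤ 2 * 2 ^ Fintype.card X := by
  have hle : ∀ N ∈ S, ∀ i b, |w i b| ≤ N b := fun N hN i b => by
    have h1 := hbig N hN i b
    have h2 : |w i b| ≤ w i b ^ 2 := by
      rw [← sq_abs]
      rcases Int.le_iff_lt_or_eq.1 (abs_nonneg (w i b)) with h | h
      · nlinarith
      · rw [← h]; norm_num
    nlinarith [sq_nonneg (w i b)]
  -- Separation makes all the translates `N + σ * w i` distinct, so for either sign their
  -- probabilities add up to at most 1.
  have inj : ∀ (σ : ℤ) (hσ : σ = 1 ∨ σ = -1),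
      ∑ p ∈ (Finset.univ : Finset I) ×ˢ S, clsProb Q (fun b => (p.2 b + σ * w p.1 b).toNat) n ≤
        1 := by
    intro σ hσ
    have hnn : ∀ N ∈ S, ∀ i b, ((((N b : ℤ) + σ * w i b).toNat : ℕ) : ℤ) = N b + σ * w i b :=
      fun N hN i b => Int.toNat_of_nonneg (by
        have := abs_le.1 (hle N hN i b)
        rcases hσ with rfl | rfl <;> omega)
    rw [← Finset.sum_image (s := (Finset.univ : Finset I) ×ˢ S)
      (g := fun p => fun b => ((p.2 b : ℤ) + σ * w p.1 b).toNat) (f := fun K => clsProb Q K n)]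
    · exact sum_clsProb_le_one hQ n _
    · rintro ⟨i, N⟩ hp ⟨i', N'⟩ hp' heq
      have hN := (Finset.mem_product.1 (Finset.mem_coe.1 hp)).2
      have hN' := (Finset.mem_product.1 (Finset.mem_coe.1 hp')).2
      simp only at hN hN' heq
      have e : ∀ b, (N b : ℤ) + σ * w i b = N' b + σ * w i' b := fun b => by
        rw [← hnn N hN, ← hnn N' hN']
        exact_mod_cast congrFun heq b
      have hi : i = i' := by
        rcases hσ with rfl | rfl
        · exact hsep N' hN' N hN i i' fun b => by have := e b; omega
        · exact hsep N hN N' hN' i i' fun b => by have := e b; omega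
      subst hi
      have : N = N' := by
        funext b
        have := e b
        omega
      rw [this]
  have h1 := inj 1 (Or.inl rfl)
  have h2 := inj (-1) (Or.inr rfl)
  have h3 : (Fintype.card I : ℝ) * ∑ N ∈ S, clsProb Q N n =
      ∑ p ∈ (Finset.univ : Finset I) ×ˢ S, clsProb Q p.2 n := by
    rw [Finset.sum_product]
    simp
  rw [h3]
  calc ∑ p ∈ (Finset.univ : Finset I) ×ˢ S, clsProb Q p.2 n
      ≤ ∑ p ∈ (Finset.univ : Finset I) ×ˢ S, 2 ^ Fintype.card X *
        (clsProb Q (fun b => ((p.2 b : ℤ) + 1 * w p.1 b).toNat) n +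
          clsProb Q (fun b => ((p.2 b : ℤ) + -1 * w p.1 b).toNat) n) := by
        refine Finset.sum_le_sum fun p hp => ?_
        have hN := (Finset.mem_product.1 hp).2
        refine clsProb_le_add hQ.1 (hS _ hN) (hw p.1) (fun b => ?_) (fun b => ?_)
          (hbig _ hN p.1)
        · have := abs_le.1 (hle _ hN p.1 b)
          rw [Int.toNat_of_nonneg (by omega)]; ring
        · have := abs_le.1 (hle _ hN p.1 b)
          rw [Int.toNat_of_nonneg (by omega)]; ring
    _ = 2 ^ Fintype.card X * _ := by rw [← Finset.mul_sum, Finset.sum_add_distrib]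
    _ ≤ 2 ^ Fintype.card X * (1 + 1) := by gcongr
    _ = _ := by ring

/-- Words whose type is far from `Q` are exponentially unlikely. -/
theorem exists_sum_far_le {Q : X → ℝ} (hQ : Q ∈ stdSimplex ℝ X) {ε : ℝ} (hε : 0 < ε) :
    ∃ κ > 0, ∀ n : ℕ, 0 < n → ∑ x : Fin n → X,
      (if ∃ b, ε < |wordType x b - Q b| then iidDist Q x else 0) ≤
        ((n : ℝ) + 1) ^ Fintype.card X * Real.exp (-(n * κ)) := by
  -- On this compact set of distributions bounded away from `Q` the divergence attains its minimum,
  -- which is positive since it vanishes only at `Q`; the minimum is the rate.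
  set F : Set (X → ℝ) := (stdSimplex ℝ X ∩ {P | ∀ b, Q b = 0 → P b = 0}) ∩
    ⋃ b, {P | ε ≤ |P b - Q b|} with hF
  have hFc : IsCompact F := by
    refine ((isCompact_stdSimplex ℝ X).inter_right (isClosed_setOf_imp_eq_zero _)).inter_right ?_
    exact isClosed_iUnion_of_finite fun b =>
      isClosed_le continuous_const ((continuous_apply b).sub continuous_const).abs
  obtain ⟨κ, hκ, hmin⟩ : ∃ κ > 0, ∀ P ∈ F, κ ≤ klR P Q := by
    by_cases hne : F.Nonempty
    · obtain ⟨P, hP, hmin⟩ := hFc.exists_isMinOn hne (continuous_klR Q).continuousOn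
      refine ⟨klR P Q, lt_of_le_of_ne (klR_nonneg hP.1.1 hQ hP.1.2) fun h0 => ?_, fun P' h => hmin h⟩
      have := eq_of_klR_eq_zero hP.1.1 hQ hP.1.2 h0.symm
      obtain ⟨b, hb⟩ := Set.mem_iUnion.1 hP.2
      have hb' : ε ≤ |P b - Q b| := hb
      rw [this, sub_self, abs_zero] at hb'
      linarith
    · exact ⟨1, one_pos, fun P hP => absurd ⟨P, hP⟩ hne⟩
  refine ⟨κ, hκ, fun n hn => ?_⟩
  rw [← sum_counts]
  have : ∀ N ∈ counts X n, ∑ x ∈ cls N n,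
      (if ∃ b, ε < |wordType x b - Q b| then iidDist Q x else 0) ≤ Real.exp (-(n * κ)) := by
    intro N _
    by_cases hex : ∃ x ∈ cls N n, (∃ b, ε < |wordType x b - Q b|) ∧ iidDist Q x ≠ 0
    · obtain ⟨x, hx, ⟨b, hb⟩, hx0⟩ := hex
      have hmem : wordType x ∈ F := by
        refine ⟨⟨wordType_mem hn x, fun c hc => wordType_eq_zero fun i hi => hx0 ?_⟩,
          Set.mem_iUnion.2 ⟨b, hb.le⟩⟩
        exact Finset.prod_eq_zero (Finset.mem_univ i) (by rw [hi, hc])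
      have h1 := hmin _ hmem
      rw [wordType_of_mem_cls hx] at h1
      calc _ ≤ clsProb Q N n := Finset.sum_le_sum fun x _ => by
            split_ifs
            · exact le_rfl
            · exact iidDist_nonneg hQ.1 x
        _ ≤ _ := clsProb_le hQ.1 N
        _ ≤ _ := Real.exp_le_exp.2 (by
            have := mul_le_mul_of_nonneg_left h1 (n.cast_nonneg (α := ℝ))
            linarith)
    · rw [Finset.sum_eq_zero]
      · positivity
      · intro x hx
        split_ifs with h
        · by_contra h0
          exact hex ⟨x, hx, h, h0⟩
        · rfl
  refine (Finset.sum_le_card_nsmul _ _ _ this).trans (le_of_eq ?_)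
  rw [card_counts, nsmul_eq_mul]
  push_cast
  ring

end Packing

/-! ### The cost-constrained ensemble -/

section Cost

variable {X : Type*} [Fintype X]

/-- The rank of the covariance matrix is reached by differences of cost vectors. -/
theorem exists_linearIndependent_cost {Q : X → ℝ} (hQ : Q ∈ stdSimplex ℝ X) {L : ℕ}
    (a : Fin L → X → ℝ) : ∃ (b₀ : X) (f : Fin (costCov Q a).rank → X), Q b₀ ≠ 0 ∧
      (∀ i, Q (f i) ≠ 0) ∧ LinearIndependent ℝ fun i l => a l (f i) - a l b₀ := by
  obtain ⟨b₀, hb₀⟩ : ∃ b, Q b ≠ 0 := by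
    by_contra h
    push Not at h
    have := hQ.2
    simp [h] at this
  let u : X → Fin L → ℝ := fun b l => a l b - a l b₀
  let s : Set (Fin L → ℝ) := u '' {b | Q b ≠ 0}
  have hs : s.Finite := (Set.toFinite _).image u
  have hu : ∀ b, Q b ≠ 0 → u b ∈ Submodule.span ℝ s := fun b hb =>
    Submodule.subset_span ⟨b, hb, rfl⟩
  have hcen : ∀ b, Q b ≠ 0 → (fun l => a l b - mean Q (a l)) ∈ Submodule.span ℝ s := by
    intro b hb
    have e : (fun l => a l b - mean Q (a l)) = u b - ∑ x, Q x • u x := by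
      funext l
      simp only [u, Pi.sub_apply, Finset.sum_apply, Pi.smul_apply, smul_eq_mul, mul_sub,
        Finset.sum_sub_distrib, ← Finset.sum_mul, hQ.2, mean]
      ring
    rw [e]
    refine Submodule.sub_mem _ (hu b hb) (Submodule.sum_mem _ fun x _ => ?_)
    by_cases hx : Q x = 0
    · rw [hx, zero_smul]; exact Submodule.zero_mem _
    · exact Submodule.smul_mem _ _ (hu x hx)
  have hrange : LinearMap.range (costCov Q a).mulVecLin ≤ Submodule.span ℝ s := by
    -- The image of `v` is a combination of centred cost vectors of letters charged by `Q`, and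
    -- these are spanned by differences of such cost vectors.
    rintro _ ⟨v, rfl⟩
    have e : (costCov Q a).mulVecLin v = ∑ x, (Q x * ∑ k, (a k x - mean Q (a k)) * v k) •
        (fun l => a l x - mean Q (a l)) := by
      funext l
      simp only [Matrix.mulVecLin_apply, Matrix.mulVec, dotProduct, costCov, Finset.sum_apply,
        Pi.smul_apply, smul_eq_mul, Finset.sum_mul, Finset.mul_sum]
      rw [Finset.sum_comm]
      exact Finset.sum_congr rfl fun x _ => Finset.sum_congr rfl fun k _ => by ring
    rw [e]
    refine Submodule.sum_mem _ fun x _ => ?_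
    by_cases hx : Q x = 0
    · rw [hx, zero_mul, zero_smul]; exact Submodule.zero_mem _
    · exact Submodule.smul_mem _ _ (hcen x hx)
  obtain ⟨t, hts, hspan, hli⟩ := exists_linearIndependent ℝ s
  have htf : t.Finite := hs.subset hts
  have : Fintype t := htf.fintype
  have hcard : (costCov Q a).rank ≤ Fintype.card t := by
    rw [← Set.toFinset_card, ← finrank_span_set_eq_card hli, hspan]
    exact Submodule.finrank_mono hrange
  obtain ⟨g⟩ : Nonempty (Fin (costCov Q a).rank ↪ t) :=
    Function.Embedding.nonempty_of_card_le (by simpa using hcard)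
  have hpre : ∀ i, ∃ b, Q b ≠ 0 ∧ u b = g i := fun i => hts (g i).2
  choose f hf1 hf2 using hpre
  refine ⟨b₀, f, hb₀, hf1, ?_⟩
  have e : (fun i l => a l (f i) - a l b₀) = fun i => ((g i : t) : Fin L → ℝ) := funext hf2
  rw [e]
  exact hli.comp g g.injective

/-- An injective linear map from a finite-dimensional space is bounded below. -/
theorem exists_lower_bound_of_linearIndependent {r L : ℕ} {v : Fin r → Fin L → ℝ}
    (hv : LinearIndependent ℝ v) : ∃ κ > 0, ∀ c : Fin r → ℝ, ∀ t, (∀ l, |∑ i, c i * v i l| ≤ t) →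
      0 ≤ t → ∀ j, κ * |c j| ≤ t := by
  have hker : LinearMap.ker (Fintype.linearCombination ℝ v) = ⊥ :=
    LinearMap.ker_eq_bot.2 hv.fintypeLinearCombination_injective
  obtain ⟨K, hK, hanti⟩ := LinearMap.exists_antilipschitzWith _ hker
  have hK' : (0 : ℝ) < K := hK
  refine ⟨1 / K, by positivity, fun c t ht ht0 j => ?_⟩
  have h1 := hanti.le_mul_dist c 0
  rw [map_zero, dist_zero_right, dist_zero_right] at h1
  have h2 : ‖Fintype.linearCombination ℝ v c‖ ≤ t := by
    rw [pi_norm_le_iff_of_nonneg ht0]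
    intro l
    have := ht l
    simpa [Fintype.linearCombination_apply, Finset.sum_apply, Real.norm_eq_abs] using this
  have h3 : |c j| ≤ ‖c‖ := norm_le_pi_norm c j
  rw [one_div, inv_mul_le_iff₀ hK']
  exact h3.trans (h1.trans (by gcongr))

/-- The coordinate `l` of the total cost can be moved by arbitrarily small steps. -/
def IsFree (Q : X → ℝ) {L : ℕ} (a : Fin L → X → ℝ) (l : Fin L) : Prop :=
  ∀ η > 0, ∃ z : X → ℤ, ∑ b, z b = 0 ∧ (∀ b, Q b = 0 → z b = 0) ∧
    (∀ k, |∑ b, (z b : ℝ) * a k b| < η) ∧ ∑ b, (z b : ℝ) * a l b ≠ 0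

/-- A thin slab of counts in the cost window has about `J * √n ^ r` disjoint translates of
comparable probability: `√n` steps in each of `r` independent cost directions, each step too long
for the window, and `J` small steps that move cost `l` out of the slab while barely moving the
others. It is essential that `C` is chosen before `J`, so that thinning the slab makes it as
unlikely as desired relative to `√n ^ (-r)`. -/
theorem exists_slab_bound {Q : X → ℝ} (hQ : Q ∈ stdSimplex ℝ X) {L : ℕ} (a : Fin L → X → ℝ)
    {δ : ℝ} (hδ : 0 < δ) : ∃ C > 0, ∀ l, IsFree Q a l → ∀ J : ℕ, ∃ η > 0, ∀ᶠ n : ℕ in atTop,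
      ∀ S : Finset (X → ℕ), (∀ N ∈ S, ∑ b, N b = n) → (∀ N ∈ S, ∀ b, Q b = 0 → N b = 0) →
      (∀ N ∈ S, ∀ b, n * Q b / 2 ≤ N b) →
      (∀ N ∈ S, ∀ N' ∈ S, ∀ k, |∑ b, (N b : ℝ) * a k b - ∑ b, (N' b : ℝ) * a k b| ≤ 2 * δ) →
      (∀ N ∈ S, ∀ N' ∈ S, |∑ b, (N b : ℝ) * a l b - ∑ b, (N' b : ℝ) * a l b| ≤ η) →
      J * (√(n : ℝ)) ^ (costCov Q a).rank * ∑ N ∈ S, clsProb Q N n ≤ C := by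
  have hcost := exists_linearIndependent_cost hQ a
  generalize (costCov Q a).rank = r at hcost ⊢
  obtain ⟨b₀, f, hb₀, hf, hli⟩ := hcost
  obtain ⟨κ, hκ, hκ'⟩ := exists_lower_bound_of_linearIndependent hli
  -- Step length in the independent directions: `κ * d > 3 * δ` exceeds the `2 * δ` of the cost
  -- window plus the `δ` allowed to the small steps.
  obtain ⟨d, hd⟩ := exists_nat_gt (3 * δ / κ)
  rw [div_lt_iff₀ hκ] at hd
  have hd0 : (0 : ℝ) ≤ d := d.cast_nonneg
  obtain ⟨v, hv0, hv⟩ : ∃ v > 0, ∀ b, Q b ≠ 0 → v ≤ Q b := by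
    obtain ⟨z0, hz0, hmin⟩ := Finset.exists_min_image (Finset.univ.filter fun b => Q b ≠ 0) Q
      ⟨b₀, Finset.mem_filter.2 ⟨Finset.mem_univ _, hb₀⟩⟩
    refine ⟨Q z0, lt_of_le_of_ne (hQ.1 _) (Finset.mem_filter.1 hz0).2.symm, fun z hz => ?_⟩
    exact hmin z (Finset.mem_filter.2 ⟨Finset.mem_univ _, hz⟩)
  -- With at most about `τ * √n` steps per direction, `4 * w ^ 2 ≤ n * v / 2`, as the comparison of
  -- translates requires; half of `√(v / 8)` is kept for the lower-order terms.
  set τ : ℝ := √(v / 8) / (2 * (r * d + 1)) with hτ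
  have hrd : (0 : ℝ) ≤ r * d := by positivity
  have hτ0 : 0 < τ := div_pos (Real.sqrt_pos.2 (by positivity)) (by positivity)
  refine ⟨2 * 2 ^ Fintype.card X / τ ^ r, by positivity, fun l hl J => ?_⟩
  -- Differences of fewer than `J` multiples of `z` change each cost by less than `δ`, yet one `z`
  -- moves cost `l` by a nonzero amount; half of that is the thickness of the slab.
  obtain ⟨z, hz1, hz2, hz3, hz4⟩ := hl (δ / (J + 1)) (by positivity)
  have hσ : 0 < |∑ b, (z b : ℝ) * a l b| := abs_pos.2 hz4
  refine ⟨|∑ b, (z b : ℝ) * a l b| / 2, by positivity, ?_⟩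
  set Z : ℝ := ∑ b, |(z b : ℝ)| with hZ
  have hZ0 : 0 ≤ Z := Finset.sum_nonneg fun _ _ => abs_nonneg _
  obtain ⟨n₀, hn₀⟩ := exists_nat_gt (((r * d + J * Z) / (√(v / 8) / 2)) ^ 2)
  filter_upwards [eventually_ge_atTop n₀] with n hn S hS hSQ hSn hSδ hSη
  have hsq : r * d + J * Z ≤ √(v / 8) / 2 * √(n : ℝ) := by
    have h1 : (r * d + J * Z) / (√(v / 8) / 2) ≤ √(n : ℝ) := by
      refine Real.le_sqrt_of_sq_le (hn₀.le.trans (by exact_mod_cast hn))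
    rw [div_le_iff₀ (by positivity)] at h1
    linarith
  set K : ℕ := ⌊τ * √(n : ℝ)⌋₊ + 1 with hK
  have hKle : (K : ℝ) ≤ τ * √(n : ℝ) + 1 := by
    rw [hK]; push_cast
    linarith [Nat.floor_le (show 0 ≤ τ * √(n : ℝ) by positivity)]
  have hKge : τ * √(n : ℝ) ≤ K := by
    rw [hK]; push_cast
    exact (Nat.lt_floor_add_one _).le
  -- the translations
  let e : Fin r → X → ℤ := fun i b => (if b = f i then 1 else 0) - (if b = b₀ then 1 else 0)
  have he1 : ∀ i, ∑ b, e i b = 0 := fun i => by simp [e]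
  have heA : ∀ i k, ∑ b, (e i b : ℝ) * a k b = a k (f i) - a k b₀ := fun i k => by
    simp [e, sub_mul]
  have heabs : ∀ i b, |(e i b : ℝ)| ≤ 1 := fun i b => by
    simp only [e]; split_ifs <;> simp
  have heQ : ∀ i b, Q b = 0 → e i b = 0 := fun i b hb => by
    have h1 : b ≠ f i := fun h => hf i (h ▸ hb)
    have h2 : b ≠ b₀ := fun h => hb₀ (h ▸ hb)
    simp [e, h1, h2]
  let w : (Fin r → Fin K) × Fin J → X → ℤ := fun p b =>
    ∑ i, (p.1 i : ℤ) * (d * e i b) + (p.2 : ℤ) * z b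
  have hwA : ∀ p k, ∑ b, (w p b : ℝ) * a k b =
      d * ∑ i, (p.1 i : ℝ) * (a k (f i) - a k b₀) + p.2 * ∑ b, (z b : ℝ) * a k b := by
    intro p k
    simp only [w]
    push_cast
    simp_rw [add_mul, Finset.sum_mul]
    rw [Finset.sum_add_distrib, Finset.sum_comm, Finset.mul_sum, Finset.mul_sum]
    congr 1
    · refine Finset.sum_congr rfl fun i _ => ?_
      rw [← heA, Finset.mul_sum, Finset.mul_sum]
      exact Finset.sum_congr rfl fun b _ => by ring
    · exact Finset.sum_congr rfl fun b _ => by ring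
  have hwabs : ∀ p b, |(w p b : ℝ)| ≤ r * d * K + J * Z := by
    intro p b
    simp only [w]
    push_cast
    refine (abs_add_le _ _).trans (add_le_add ((Finset.abs_sum_le_sum_abs _ _).trans ?_) ?_)
    · have : ∀ i ∈ (Finset.univ : Finset (Fin r)), |(p.1 i : ℝ) * (d * (e i b : ℝ))| ≤ K * d := by
        intro i _
        rw [abs_mul, abs_mul, abs_of_nonneg (Nat.cast_nonneg _), abs_of_nonneg hd0]
        refine mul_le_mul (by exact_mod_cast (p.1 i).2.le)
          (mul_le_of_le_one_right hd0 (heabs i b)) (by positivity) (by positivity)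
      refine (Finset.sum_le_card_nsmul _ _ _ this).trans (le_of_eq ?_)
      rw [Finset.card_univ, Fintype.card_fin, nsmul_eq_mul]
      ring
    · rw [abs_mul, abs_of_nonneg (Nat.cast_nonneg _)]
      refine mul_le_mul (by exact_mod_cast p.2.2.le) ?_ (abs_nonneg _) (by positivity)
      exact Finset.single_le_sum (f := fun b => |(z b : ℝ)|) (fun _ _ => abs_nonneg _)
        (Finset.mem_univ b)
  have hpack := card_mul_sum_clsProb_le hQ w (fun p => by
      simp only [w]
      rw [Finset.sum_add_distrib, Finset.sum_comm, ← Finset.mul_sum, hz1, mul_zero, add_zero]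
      refine Finset.sum_eq_zero fun i _ => ?_
      rw [← Finset.mul_sum, ← Finset.mul_sum, he1, mul_zero, mul_zero]) S hS
    (by
      intro N hN p b
      by_cases hb : Q b = 0
      · have : w p b = 0 := by simp [w, heQ _ b hb, hz2 b hb]
        rw [this]; simp
      · have h1 : |(w p b : ℝ)| ≤ √(v / 8) * √(n : ℝ) := by
          refine (hwabs p b).trans ?_
          have h2 : r * d * (K : ℝ) ≤ r * d * (τ * √(n : ℝ) + 1) := by gcongr
          have h3 : r * d * τ ≤ √(v / 8) / 2 := by
            rw [hτ, ← mul_div_assoc, div_le_iff₀ (by positivity)]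
            nlinarith [Real.sqrt_nonneg (v / 8)]
          have h4 := mul_le_mul_of_nonneg_right h3 (Real.sqrt_nonneg (n : ℝ))
          nlinarith
        have h2 : (w p b : ℝ) ^ 2 ≤ v / 8 * n := by
          rw [← sq_abs]
          calc |(w p b : ℝ)| ^ 2 ≤ (√(v / 8) * √(n : ℝ)) ^ 2 := by gcongr
            _ = v / 8 * n := by
                rw [mul_pow, Real.sq_sqrt (by positivity), Real.sq_sqrt (by positivity)]
        have h3 := hSn N hN b
        have h4 := mul_le_mul_of_nonneg_left (hv b hb) (n.cast_nonneg (α := ℝ))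
        have h5 : 4 * (w p b : ℝ) ^ 2 ≤ N b := by linarith
        exact_mod_cast h5)
    (by
      intro N hN N' hN' p p' heq
      have hA : ∀ k, ∑ b, (N b : ℝ) * a k b - ∑ b, (N' b : ℝ) * a k b =
          d * ∑ i, ((p.1 i : ℝ) - p'.1 i) * (a k (f i) - a k b₀) +
            ((p.2 : ℝ) - p'.2) * ∑ b, (z b : ℝ) * a k b := by
        intro k
        have e1 : ∑ b, (N b : ℝ) * a k b - ∑ b, (N' b : ℝ) * a k b =
            ∑ b, (w p b : ℝ) * a k b - ∑ b, (w p' b : ℝ) * a k b := by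
          rw [← Finset.sum_sub_distrib, ← Finset.sum_sub_distrib]
          refine Finset.sum_congr rfl fun b _ => ?_
          have : (N b : ℝ) - N' b = w p b - w p' b := by exact_mod_cast heq b
          rw [← sub_mul, ← sub_mul, this]
        rw [e1, hwA, hwA]
        simp_rw [sub_mul ((p.1 _ : ℕ) : ℝ)]
        rw [Finset.sum_sub_distrib]
        ring
      have hJ : |(p.2 : ℝ) - p'.2| ≤ J := by
        have h1 : ((p.2 : ℕ) : ℝ) ≤ J := by exact_mod_cast p.2.2.le
        have h2 : ((p'.2 : ℕ) : ℝ) ≤ J := by exact_mod_cast p'.2.2.le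
        have h3 : (0 : ℝ) ≤ ((p.2 : ℕ) : ℝ) := Nat.cast_nonneg _
        have h4 : (0 : ℝ) ≤ ((p'.2 : ℕ) : ℝ) := Nat.cast_nonneg _
        exact abs_le.2 ⟨by linarith, by linarith⟩
      have h1 : ∀ i, p.1 i = p'.1 i := by
        -- For two coinciding translates the costs differ by at most `2 * δ` from the slab and `δ`
        -- from the multiples of `z`, which is below one step in any independent direction.
        have hb : ∀ k, |∑ i, (d * ((p.1 i : ℝ) - p'.1 i)) * (a k (f i) - a k b₀)| ≤ 3 * δ := by
          intro k
          have e1 : ∑ i, (d * ((p.1 i : ℝ) - p'.1 i)) * (a k (f i) - a k b₀) =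
              (∑ b, (N b : ℝ) * a k b - ∑ b, (N' b : ℝ) * a k b) -
                ((p.2 : ℝ) - p'.2) * ∑ b, (z b : ℝ) * a k b := by
            rw [hA k, add_sub_cancel_right, Finset.mul_sum]
            exact Finset.sum_congr rfl fun i _ => by ring
          rw [e1]
          refine (abs_sub _ _).trans ?_
          have e2 : |((p.2 : ℝ) - p'.2) * ∑ b, (z b : ℝ) * a k b| ≤ δ := by
            rw [abs_mul]
            have e3 : |∑ b, (z b : ℝ) * a k b| * (J + 1) < δ :=
              (lt_div_iff₀ (by positivity)).1 (hz3 k)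
            have e4 := mul_le_mul_of_nonneg_right hJ (abs_nonneg (∑ b, (z b : ℝ) * a k b))
            nlinarith [abs_nonneg (∑ b, (z b : ℝ) * a k b)]
          linarith [hSδ N hN N' hN' k]
        intro i
        have h2 := hκ' _ _ hb (by linarith) i
        rw [abs_mul, abs_of_nonneg hd0] at h2
        by_contra hne
        have h3 : (1 : ℝ) ≤ |((p.1 i : ℕ) : ℝ) - (p'.1 i : ℕ)| := by
          have h4 : ((p.1 i : ℕ) : ℤ) - (p'.1 i : ℕ) ≠ 0 := fun h => hne (Fin.ext (by omega))
          have h5 := Int.one_le_abs h4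
          exact_mod_cast h5
        have h6 := mul_le_mul_of_nonneg_left h3 (show 0 ≤ κ * d by positivity)
        linarith
      have h2 : p.1 = p'.1 := funext h1
      have h3 : p.2 = p'.2 := by
        have e1 := hSη N hN N' hN'
        rw [hA l, h2] at e1
        simp only [sub_self, zero_mul, Finset.sum_const_zero, mul_zero, zero_add] at e1
        rw [abs_mul] at e1
        by_contra hne
        have h3 : (1 : ℝ) ≤ |((p.2 : ℕ) : ℝ) - (p'.2 : ℕ)| := by
          have h4 : ((p.2 : ℕ) : ℤ) - (p'.2 : ℕ) ≠ 0 := fun h => hne (Fin.ext (by omega))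
          have h5 := Int.one_le_abs h4
          exact_mod_cast h5
        nlinarith
      exact Prod.ext h2 h3)
  have hcard : (Fintype.card ((Fin r → Fin K) × Fin J) : ℝ) = (K : ℝ) ^ r * J := by
    simp
  rw [hcard] at hpack
  rw [le_div_iff₀ (by positivity)]
  have hp0 : 0 ≤ ∑ N ∈ S, clsProb Q N n := Finset.sum_nonneg fun N _ => clsProb_nonneg hQ.1 N n
  calc J * √(n : ℝ) ^ r * (∑ N ∈ S, clsProb Q N n) * τ ^ r
      = ((τ * √(n : ℝ)) ^ r * J) * ∑ N ∈ S, clsProb Q N n := by rw [mul_pow]; ring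
    _ ≤ ((K : ℝ) ^ r * J) * ∑ N ∈ S, clsProb Q N n := by gcongr
    _ ≤ _ := hpack

theorem mem_costSet_iff {Q : X → ℝ} {L : ℕ} {a : Fin L → X → ℝ} {δ : ℝ} {n : ℕ} (hn : 0 < n)
    {x : Fin n → X} : x ∈ costSet Q a δ n ↔
      ∀ l, |∑ b, (cnt x b : ℝ) * a l b - n * mean Q (a l)| ≤ δ := by
  have hn' : (0 : ℝ) < n := by exact_mod_cast hn
  refine forall_congr' fun l => ?_
  rw [← sum_word]
  have e : 1 / (n : ℝ) * ∑ i, a l (x i) - mean Q (a l) =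
      (∑ i, a l (x i) - n * mean Q (a l)) / n := by field_simp
  rw [e, abs_div, abs_of_pos hn', div_le_div_iff_of_pos_right hn']

/-- The mass bound gives subexponentiality at once. For `slack`, if no word had room, every nearly
typical word of the set would lie in a boundary slab of some free coordinate; but atypical words and
all those slabs together carry less than the assumed mass. -/
theorem isEnsemble_costSet {Q : X → ℝ} (hQ : Q ∈ stdSimplex ℝ X) {L : ℕ} (a : Fin L → X → ℝ)
    {δ : ℝ} (hδ : 0 < δ) (hO : (fun n : ℕ => (n : ℝ) ^ (-((costCov Q a).rank : ℝ) / 2))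
      =O[atTop] fun n : ℕ => costMass Q a δ n) : IsEnsemble Q a (costSet Q a δ) := by
  set r := (costCov Q a).rank with hr
  obtain ⟨c, hc, hO⟩ := hO.exists_pos
  have hmass0 : ∀ n, 0 ≤ costMass Q a δ n := fun n => Finset.sum_nonneg fun x _ => by
    split_ifs
    · exact iidDist_nonneg hQ.1 x
    · exact le_rfl
  have hmass : ∀ᶠ n : ℕ in atTop, 1 ≤ c * √(n : ℝ) ^ r * costMass Q a δ n := by
    filter_upwards [hO.bound, eventually_gt_atTop 0] with n hn hpos
    have hn' : (0 : ℝ) < n := by exact_mod_cast hpos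
    rw [Real.norm_of_nonneg (by positivity), Real.norm_of_nonneg (hmass0 n)] at hn
    have e : (n : ℝ) ^ (-(r : ℝ) / 2) = (√(n : ℝ) ^ r)⁻¹ := by
      rw [Real.sqrt_eq_rpow, ← Real.rpow_natCast, ← Real.rpow_mul hn'.le, ← Real.rpow_neg hn'.le]
      congr 1
      ring
    rw [e] at hn
    have h2 : 0 < √(n : ℝ) ^ r := pow_pos (Real.sqrt_pos.2 hn') r
    rw [inv_le_iff_one_le_mul₀ h2] at hn
    linarith
  have hsqrt : ∀ n : ℕ, √(n : ℝ) ≤ (n : ℝ) + 1 := fun n => by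
    rw [Real.sqrt_le_left (by positivity)]
    nlinarith [n.cast_nonneg (α := ℝ)]
  refine ⟨?_, ?_, ?_, ?_⟩
  · intro n x x' h hx l
    have := hx l
    rw [sum_word, ← h, ← sum_word]
    exact this
  · intro ε hε
    filter_upwards [hmass, eventually_poly_le_exp c r hε] with n h1 h2
    have h3 : c * √(n : ℝ) ^ r ≤ Real.exp (n * ε) := le_trans (by gcongr; exact hsqrt n) h2
    have h4 : 1 ≤ Real.exp (n * ε) * costMass Q a δ n :=
      h1.trans (mul_le_mul_of_nonneg_right h3 (hmass0 n))
    rw [Real.exp_neg, inv_le_iff_one_le_mul₀' (Real.exp_pos _)]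
    exact h4
  · intro ε hε
    obtain ⟨n₀, hn₀⟩ := exists_nat_gt (δ / ε)
    filter_upwards [eventually_ge_atTop n₀, eventually_gt_atTop 0] with n hn hpos x hx l
    have hn' : (0 : ℝ) < n := by exact_mod_cast hpos
    have e : mean (wordType x) (a l) = 1 / (n : ℝ) * ∑ i, a l (x i) := by
      rw [sum_word_wordType, mean]
      field_simp
    rw [e]
    refine (hx l).trans ?_
    have h1 : δ / ε ≤ n := hn₀.le.trans (by exact_mod_cast hn)
    rw [div_le_iff₀ hε] at h1
    rw [div_le_iff₀ hn']
    linarith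
  · obtain ⟨C, hC, hslab⟩ := exists_slab_bound hQ a hδ
    -- the number of translates that makes all slabs together unlikely
    obtain ⟨J, hJ⟩ := exists_nat_gt (4 * c * L * C)
    have hJ0 : (0 : ℝ) < J + 1 := by positivity
    -- For a free coordinate `η` is the slab thickness; for any other one it is a size below which
    -- admissible integer moves leave that cost unchanged.
    have hη : ∀ l, ∃ η > 0, (IsFree Q a l → ∀ᶠ n : ℕ in atTop,
        ∀ S : Finset (X → ℕ), (∀ N ∈ S, ∑ b, N b = n) → (∀ N ∈ S, ∀ b, Q b = 0 → N b = 0) →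
        (∀ N ∈ S, ∀ b, n * Q b / 2 ≤ N b) →
        (∀ N ∈ S, ∀ N' ∈ S, ∀ k, |∑ b, (N b : ℝ) * a k b - ∑ b, (N' b : ℝ) * a k b| ≤ 2 * δ) →
        (∀ N ∈ S, ∀ N' ∈ S, |∑ b, (N b : ℝ) * a l b - ∑ b, (N' b : ℝ) * a l b| ≤ η) →
        ((J + 1 : ℕ) : ℝ) * (√(n : ℝ)) ^ r * ∑ N ∈ S, clsProb Q N n ≤ C) ∧
        (¬IsFree Q a l → ∀ z : X → ℤ, ∑ b, z b = 0 → (∀ b, Q b = 0 → z b = 0) →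
          (∀ k, |∑ b, (z b : ℝ) * a k b| < η) → ∑ b, (z b : ℝ) * a l b = 0) := by
      intro l
      by_cases hl : IsFree Q a l
      · obtain ⟨η, hη, h⟩ := hslab l hl (J + 1)
        exact ⟨η, hη, fun _ => h, fun h' => absurd hl h'⟩
      · have hl' := hl
        unfold IsFree at hl'
        push Not at hl'
        obtain ⟨η, hη, h⟩ := hl'
        exact ⟨η, hη, fun h' => absurd h' hl, fun _ z h1 h2 h3 => h z h1 h2 h3⟩
    choose η hη0 hηf hηr using hη
    obtain ⟨η₀, hη₀, hη₀le⟩ : ∃ η₀ > 0, ∀ l, η₀ ≤ η l := by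
      by_cases hL : Nonempty (Fin L)
      · obtain ⟨l, hl⟩ := Finite.exists_min η
        exact ⟨η l, hη0 l, hl⟩
      · exact ⟨1, one_pos, fun l => absurd ⟨l⟩ hL⟩
    refine ⟨η₀, hη₀, fun ε hε => ?_⟩
    obtain ⟨v, hv0, hv⟩ : ∃ v > 0, ∀ b, Q b ≠ 0 → v ≤ Q b := by
      by_cases hne : (Finset.univ.filter fun b => Q b ≠ 0).Nonempty
      · obtain ⟨z0, hz0, hmin⟩ := Finset.exists_min_image _ Q hne
        refine ⟨Q z0, lt_of_le_of_ne (hQ.1 _) (Finset.mem_filter.1 hz0).2.symm, fun z hz => ?_⟩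
        exact hmin z (Finset.mem_filter.2 ⟨Finset.mem_univ _, hz⟩)
      · refine ⟨1, one_pos, fun z hz => ?_⟩
        exact absurd ⟨z, Finset.mem_filter.2 ⟨Finset.mem_univ _, hz⟩⟩ hne
    -- The second bound forces every letter count to be at least `n * Q b / 2`, as the slab bound
    -- requires.
    set ε' := min ε (v / 2) with hε'
    have hε'0 : 0 < ε' := lt_min hε (by linarith)
    obtain ⟨κ, hκ, hfar⟩ := exists_sum_far_le hQ hε'0
    have hslabs : ∀ᶠ n : ℕ in atTop, ∀ l, IsFree Q a l → ∀ S : Finset (X → ℕ),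
        (∀ N ∈ S, ∑ b, N b = n) → (∀ N ∈ S, ∀ b, Q b = 0 → N b = 0) →
        (∀ N ∈ S, ∀ b, n * Q b / 2 ≤ N b) →
        (∀ N ∈ S, ∀ N' ∈ S, ∀ k, |∑ b, (N b : ℝ) * a k b - ∑ b, (N' b : ℝ) * a k b| ≤ 2 * δ) →
        (∀ N ∈ S, ∀ N' ∈ S, |∑ b, (N b : ℝ) * a l b - ∑ b, (N' b : ℝ) * a l b| ≤ η l) →
        ((J + 1 : ℕ) : ℝ) * (√(n : ℝ)) ^ r * ∑ N ∈ S, clsProb Q N n ≤ C :=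
      eventually_all.2 fun l => by
        by_cases hl : IsFree Q a l
        · filter_upwards [hηf l hl] with n hn _ using hn
        · exact Eventually.of_forall fun n h => absurd h hl
    filter_upwards [hslabs, hmass, eventually_gt_atTop 0,
      eventually_poly_le_exp (4 * c) (r + Fintype.card X) hκ] with n hn1 hn2 hn3 hn4
    have hn' : (0 : ℝ) < n := by exact_mod_cast hn3
    by_contra hcon
    push Not at hcon
    -- the counts in a slab, on the side given by the sign `s`
    let T : Finset (X → ℕ) := (counts X n).filter fun N => ∑ b, N b = n ∧
      (∀ b, Q b = 0 → N b = 0) ∧ (∀ b, n * Q b / 2 ≤ N b) ∧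
      ∀ k, |∑ b, (N b : ℝ) * a k b - n * mean Q (a k)| ≤ δ
    let slab : Fin L → ℝ → Finset (X → ℕ) := fun l s => T.filter fun N =>
      δ - η l ≤ s * (∑ b, (N b : ℝ) * a l b - n * mean Q (a l))
    have hslab_le : ∀ l, IsFree Q a l → ∀ s, (s = 1 ∨ s = -1) →
        √(n : ℝ) ^ r * ∑ N ∈ slab l s, clsProb Q N n ≤ C / (J + 1) := by
      intro l hl s hs
      have hT : ∀ N ∈ slab l s, N ∈ T := fun N hN => (Finset.mem_filter.1 hN).1
      have hT' := fun N hN => (Finset.mem_filter.1 (hT N hN)).2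
      have := hn1 l hl (slab l s) (fun N hN => (hT' N hN).1) (fun N hN => (hT' N hN).2.1)
        (fun N hN => (hT' N hN).2.2.1) (fun N hN N' hN' k => by
          have h1 := abs_le.1 ((hT' N hN).2.2.2 k)
          have h2 := abs_le.1 ((hT' N' hN').2.2.2 k)
          exact abs_le.2 ⟨by linarith, by linarith⟩) (fun N hN N' hN' => by
          have h1 := abs_le.1 ((hT' N hN).2.2.2 l)
          have h2 := abs_le.1 ((hT' N' hN').2.2.2 l)
          have h3 := (Finset.mem_filter.1 hN).2
          have h4 := (Finset.mem_filter.1 hN').2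
          rcases hs with rfl | rfl <;> exact abs_le.2 ⟨by linarith, by linarith⟩)
      rw [le_div_iff₀ hJ0]
      push_cast at this
      linarith
    -- Under the contrary assumption each nearly typical word has a neighbour outside the set. The
    -- neighbour violates the cost of some `l`, which is free because a small move changed it, so
    -- the word itself lies in a slab of `l`.
    have hcover : costMass Q a δ n ≤
        ∑ x : Fin n → X, (if ∃ b, ε' < |wordType x b - Q b| then iidDist Q x else 0) +
          ∑ l, (if IsFree Q a l then ∑ N ∈ slab l 1, clsProb Q N n +
            ∑ N ∈ slab l (-1), clsProb Q N n else 0) := by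
      have hind : ∀ S : Finset (X → ℕ), ∑ N ∈ S, clsProb Q N n =
          ∑ x : Fin n → X, if cnt x ∈ S then iidDist Q x else 0 := by
        intro S
        unfold clsProb cls
        simp_rw [Finset.sum_filter]
        rw [Finset.sum_comm]
        refine Finset.sum_congr rfl fun x _ => ?_
        rw [Finset.sum_ite_eq]
        rfl
      simp_rw [hind]
      have hswap : ∑ l, (if IsFree Q a l then
          (∑ x : Fin n → X, if cnt x ∈ slab l 1 then iidDist Q x else 0) +
            (∑ x : Fin n → X, if cnt x ∈ slab l (-1) then iidDist Q x else 0) else 0) =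
          ∑ x : Fin n → X, ∑ l, (if IsFree Q a l then
            (if cnt x ∈ slab l 1 then iidDist Q x else 0) +
            (if cnt x ∈ slab l (-1) then iidDist Q x else 0) else 0) := by
        rw [Finset.sum_comm]
        refine Finset.sum_congr rfl fun l _ => ?_
        split_ifs
        · rw [Finset.sum_add_distrib]
        · simp
      rw [hswap, ← Finset.sum_add_distrib]
      refine Finset.sum_le_sum fun x _ => ?_
      have hx0 := iidDist_nonneg hQ.1 x
      have hterm : ∀ l, 0 ≤ (if IsFree Q a l then
          (if cnt x ∈ slab l 1 then iidDist Q x else 0) +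
            (if cnt x ∈ slab l (-1) then iidDist Q x else 0) else 0) := fun l => by
        split_ifs <;> linarith
      have hsum0 := Finset.sum_nonneg fun l (_ : l ∈ Finset.univ) => hterm l
      by_cases hxD : x ∈ costSet Q a δ n
      swap
      · rw [if_neg hxD]
        refine add_nonneg ?_ hsum0
        split_ifs <;> linarith
      rw [if_pos hxD]
      by_cases hxfar : ∃ b, ε' < |wordType x b - Q b|
      · rw [if_pos hxfar]
        linarith
      rw [if_neg hxfar, zero_add]
      by_cases hxQ : ∀ i, Q (x i) ≠ 0
      swap
      · push Not at hxQ
        obtain ⟨i, hi⟩ := hxQ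
        have : iidDist Q x = 0 := Finset.prod_eq_zero (Finset.mem_univ i) hi
        rw [this] at hsum0 ⊢
        exact hsum0
      push Not at hxfar
      obtain ⟨x', hx'Q, hx'η, hx'D⟩ := hcon x hxD
        (fun b => (hxfar b).trans (min_le_left _ _)) hxQ
      rw [mem_costSet_iff hn3] at hxD hx'D
      push Not at hx'D
      obtain ⟨l, hl⟩ := hx'D
      have hdiff : ∀ k, ∑ b, (((cnt x' b : ℤ) - cnt x b : ℤ) : ℝ) * a k b =
          ∑ b, (cnt x' b : ℝ) * a k b - ∑ b, (cnt x b : ℝ) * a k b := fun k => by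
        rw [← Finset.sum_sub_distrib]
        exact Finset.sum_congr rfl fun b _ => by push_cast; ring
      have hsupp : ∀ {y : Fin n → X}, (∀ i, Q (y i) ≠ 0) → ∀ b, Q b = 0 → cnt y b = 0 := by
        intro y hy b hb
        by_contra hne
        obtain ⟨i, hi⟩ := (cnt_pos_iff _ _).1 (Nat.pos_of_ne_zero hne)
        exact hy i (hi ▸ hb)
      have hη' : ∀ k, |∑ b, (cnt x' b : ℝ) * a k b - ∑ b, (cnt x b : ℝ) * a k b| < η₀ := fun k => by
        rw [← sum_word, ← sum_word]
        exact hx'η k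
      have hfree : IsFree Q a l := by
        by_contra hnf
        have h0 := hηr l hnf (fun b => (cnt x' b : ℤ) - cnt x b) (by
            rw [Finset.sum_sub_distrib, ← Nat.cast_sum, ← Nat.cast_sum, sum_cnt, sum_cnt, sub_self])
          (fun b hb => by rw [hsupp hxQ b hb, hsupp hx'Q b hb, sub_self])
          (fun k => by rw [hdiff]; exact (hη' k).trans_le (hη₀le l))
        rw [hdiff] at h0
        have := hxD l
        rw [show ∑ b, (cnt x b : ℝ) * a l b = ∑ b, (cnt x' b : ℝ) * a l b by linarith] at this
        linarith
      have hxT : cnt x ∈ T := by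
        refine Finset.mem_filter.2 ⟨cnt_mem_counts x, sum_cnt x, hsupp hxQ, fun b => ?_, hxD⟩
        by_cases hb : Q b = 0
        · rw [hb]; simp
        · have h1 := (abs_le.1 (hxfar b)).1
          have h2 := hv b hb
          have h3 : ε' ≤ v / 2 := min_le_right _ _
          rw [wordType_eq] at h1
          have h4 : Q b / 2 ≤ (cnt x b : ℝ) / n := by linarith
          rw [le_div_iff₀ hn'] at h4
          linarith
      refine le_trans ?_ (Finset.single_le_sum (fun l _ => hterm l) (Finset.mem_univ l))
      rw [if_pos hfree]
      have h1 := abs_lt.1 (hη' l)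
      have h2 := hη₀le l
      rcases lt_abs.1 hl with h3 | h3
      · have : cnt x ∈ slab l 1 := Finset.mem_filter.2 ⟨hxT, by linarith⟩
        rw [if_pos this]
        split_ifs <;> linarith
      · have : cnt x ∈ slab l (-1) := Finset.mem_filter.2 ⟨hxT, by linarith⟩
        rw [if_pos this]
        split_ifs <;> linarith
    have hs0 : 0 ≤ √(n : ℝ) ^ r := by positivity
    have hfar' : c * (√(n : ℝ) ^ r * ∑ x : Fin n → X,
        (if ∃ b, ε' < |wordType x b - Q b| then iidDist Q x else 0)) ≤ 1 / 4 := by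
      have h1 := hfar n hn3
      calc _ ≤ c * (((n : ℝ) + 1) ^ r * (((n : ℝ) + 1) ^ Fintype.card X *
            Real.exp (-(n * κ)))) := by
            gcongr
            · exact Finset.sum_nonneg fun x _ => by
                split_ifs
                · exact iidDist_nonneg hQ.1 x
                · exact le_rfl
            · exact hsqrt n
        _ = 4 * c * ((n : ℝ) + 1) ^ (r + Fintype.card X) * Real.exp (-(n * κ)) / 4 := by
            rw [pow_add]; ring
        _ ≤ Real.exp (n * κ) * Real.exp (-(n * κ)) / 4 := by gcongr
        _ = 1 / 4 := by rw [← Real.exp_add, add_neg_cancel, Real.exp_zero]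
    -- Two slabs per coordinate, each at most `C / (J + 1)` after scaling, with `J > 4 * c * L * C`.
    -- With the 1/4 for atypical words the total is at most 3/4, contradicting `1 ≤ c * √n ^ r *
    -- costMass`.
    have hslab' : c * (√(n : ℝ) ^ r * ∑ l, (if IsFree Q a l then ∑ N ∈ slab l 1, clsProb Q N n +
        ∑ N ∈ slab l (-1), clsProb Q N n else 0)) ≤ 1 / 2 := by
      have h1 : ∀ l ∈ (Finset.univ : Finset (Fin L)), √(n : ℝ) ^ r * (if IsFree Q a l then
          ∑ N ∈ slab l 1, clsProb Q N n + ∑ N ∈ slab l (-1), clsProb Q N n else 0) ≤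
            2 * (C / (J + 1)) := by
        intro l _
        split_ifs with hl
        · rw [mul_add]
          linarith [hslab_le l hl 1 (Or.inl rfl), hslab_le l hl (-1) (Or.inr rfl)]
        · rw [mul_zero]; positivity
      have h2 := Finset.sum_le_card_nsmul _ _ _ h1
      rw [Finset.card_univ, Fintype.card_fin, nsmul_eq_mul] at h2
      rw [Finset.mul_sum]
      refine (mul_le_mul_of_nonneg_left h2 hc.le).trans ?_
      have e : c * (L * (2 * (C / (J + 1)))) = 2 * c * L * C / (J + 1) := by ring
      rw [e, div_le_iff₀ hJ0]
      linarith
    have h1 := mul_le_mul_of_nonneg_left hcover (mul_nonneg hc.le hs0)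
    rw [mul_add, mul_assoc, mul_assoc] at h1
    linarith

end Cost

/-! ### The i.i.d. and constant-composition ensembles -/

section Special

variable {X : Type*} [Fintype X]

theorem costDist_eq_condDist (Q : X → ℝ) {L : ℕ} (a : Fin L → X → ℝ) (δ : ℝ) (n : ℕ) :
    costDist Q a δ (n := n) = condDist Q (costSet Q a δ n) := rfl

theorem costSet_fin_zero (Q : X → ℝ) (a : Fin 0 → X → ℝ) (δ : ℝ) (n : ℕ) :
    costSet Q a δ n = Set.univ :=
  Set.eq_univ_of_forall fun _ l => l.elim0

theorem costMass_fin_zero {Q : X → ℝ} (hQ : Q ∈ stdSimplex ℝ X) (a : Fin 0 → X → ℝ) (δ : ℝ)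
    (n : ℕ) : costMass Q a δ n = 1 := by
  simp only [costMass, costSet_fin_zero, Set.mem_univ, if_true, iidDist]
  rw [sum_prod_word, hQ.2, one_pow]

theorem costDist_fin_zero {Q : X → ℝ} (hQ : Q ∈ stdSimplex ℝ X) (a : Fin 0 → X → ℝ) (δ : ℝ)
    (n : ℕ) : costDist Q a δ (n := n) = iidDist Q := by
  funext x
  simp only [costDist, costMass_fin_zero hQ, costSet_fin_zero, Set.mem_univ, if_true, div_one]

theorem isBigO_costMass_fin_zero {Q : X → ℝ} (hQ : Q ∈ stdSimplex ℝ X) (a : Fin 0 → X → ℝ)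
    (δ : ℝ) : (fun n : ℕ => (n : ℝ) ^ (-((costCov Q a).rank : ℝ) / 2))
      =O[atTop] fun n : ℕ => costMass Q a δ n := by
  have h : (costCov Q a).rank = 0 := Nat.le_zero.1 (by simpa using (costCov Q a).rank_le_card_width)
  simp only [h, costMass_fin_zero hQ, Nat.cast_zero, neg_zero, zero_div, Real.rpow_zero]
  exact isBigO_refl _ _

theorem mem_typeClass {P : X → ℝ} {n : ℕ} {x : Fin n → X} :
    x ∈ typeClass P n ↔ wordType x = P := by simp [typeClass]

theorem cnt_eq_of_wordType_eq {n : ℕ} {x x' : Fin n → X} (h : wordType x = wordType x') :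
    cnt x = cnt x' := by
  funext b
  rcases Nat.eq_zero_or_pos n with rfl | hn
  · simp [cnt]
  · have hn' : (n : ℝ) ≠ 0 := by positivity
    have := congrFun h b
    rw [wordType_eq, wordType_eq, div_left_inj' hn'] at this
    exact_mod_cast this

theorem iidDist_eq_of_cnt_eq (Q : X → ℝ) {n : ℕ} {x x' : Fin n → X} (h : cnt x = cnt x') :
    iidDist Q x = iidDist Q x' := by
  unfold iidDist
  rw [prod_word, prod_word, h]

theorem condMass_eq_sum (Q : X → ℝ) {n : ℕ} {D : Set (Fin n → X)} {F : Finset (Fin n → X)}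
    (h : ∀ x, x ∈ D ↔ x ∈ F) : condMass Q D = ∑ x ∈ F, iidDist Q x := by
  unfold condMass
  rw [← Finset.sum_filter]
  refine Finset.sum_congr ?_ fun _ _ => rfl
  ext x
  simp [h]

/-- The i.i.d. probability is constant on a type class, and nonzero there because `P ≪ Q`, so
conditioning on a nonempty class makes it uniform. -/
theorem ccDist_eq_condDist {Q : X → ℝ} {P : X → ℝ} {n : ℕ}
    (hPQ : ∀ b, Q b = 0 → P b = 0) :
    ccDist P (n := n) = condDist Q {x | wordType x = P} := by
  funext x
  unfold ccDist condDist
  simp only [mem_typeClass, Set.mem_ofPred_eq]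
  split_ifs with hx
  · have hx0 : iidDist Q x ≠ 0 := Finset.prod_ne_zero_iff.2 fun i _ h0 => by
      have h1 := wordType_apply_pos x i
      rw [hx, hPQ _ h0] at h1
      exact lt_irrefl _ h1
    have hm : condMass Q {x : Fin n → X | wordType x = P} =
        (typeClass P n).card * iidDist Q x := by
      rw [condMass_eq_sum Q (D := {x | wordType x = P}) (F := typeClass P n)
        fun x' => mem_typeClass.symm, ← nsmul_eq_mul, ← Finset.sum_const]
      refine Finset.sum_congr rfl fun x' hx' => ?_
      have h1 : wordType x' = P := mem_typeClass.1 hx'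
      exact iidDist_eq_of_cnt_eq Q (cnt_eq_of_wordType_eq (h1.trans hx.symm))
    have hc : ((typeClass P n).card : ℝ) ≠ 0 :=
      Nat.cast_ne_zero.2 (Finset.card_ne_zero_of_mem (mem_typeClass.2 hx))
    rw [hm]
    field_simp
  · rfl

/-- The class of `Qn n` has probability about `exp (-n D(Qn‖Q))`, and the divergence tends to 0 by
continuity. `slack` holds with `η = 1`: the indicator costs are the counts, and integers less than 1
apart are equal. -/
theorem isEnsemble_typeClass {Q : X → ℝ} (hQ : Q ∈ stdSimplex ℝ X) {L : ℕ} (e : Fin L ≃ X)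
    {Qn : ℕ → X → ℝ} (hQn : ∀ n, 1 ≤ n → (typeClass (Qn n) n).Nonempty ∧
      (∀ x, |Qn n x - Q x| ≤ 1 / (n : ℝ)) ∧ ∀ x, Q x = 0 → Qn n x = 0) :
    IsEnsemble Q (fun l x => if x = e l then (1 : ℝ) else 0) fun n => {x | wordType x = Qn n} := by
  have hclose : ∀ ε > 0, ∀ᶠ n : ℕ in atTop, 0 < n ∧ ∀ b, |Qn n b - Q b| ≤ ε := by
    intro ε hε
    obtain ⟨n₀, hn₀⟩ := exists_nat_one_div_lt hε
    filter_upwards [eventually_ge_atTop (n₀ + 1)] with n hn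
    refine ⟨by omega, fun b => ((hQn n (by omega)).2.1 b).trans (le_trans ?_ hn₀.le)⟩
    exact one_div_le_one_div_of_le (by positivity) (by exact_mod_cast hn)
  have hlim : Tendsto Qn atTop (𝓝 Q) := by
    rw [tendsto_pi_nhds]
    intro b
    rw [Metric.tendsto_nhds]
    intro ε hε
    filter_upwards [hclose (ε / 2) (by linarith)] with n hn
    rw [Real.dist_eq]
    exact (hn.2 b).trans_lt (by linarith)
  have hsuppx : ∀ n (x : Fin n → X), 1 ≤ n → wordType x = Qn n → ∀ i, Q (x i) ≠ 0 := by
    intro n x hn hx i h0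
    have h1 := wordType_apply_pos x i
    rw [hx, (hQn n hn).2.2 _ h0] at h1
    exact lt_irrefl _ h1
  refine ⟨?_, ?_, ?_, ⟨1, one_pos, ?_⟩⟩
  · intro n x x' h hx
    have hx' : wordType x = Qn n := hx
    have : wordType x' = wordType x := by
      funext b
      rw [wordType_eq, wordType_eq, h]
    exact this.trans hx'
  · intro ε hε
    have hkl := ((continuous_klR Q).tendsto Q).comp hlim
    rw [klR_self] at hkl
    filter_upwards [hkl.eventually (gt_mem_nhds (show (0 : ℝ) < ε / 2 by linarith)),
      eventually_gt_atTop 0, eventually_poly_le_exp 1 (Fintype.card X)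
        (show 0 < ε / 2 by linarith)] with n h1 hn h3
    obtain ⟨x, hx⟩ := (hQn n hn).1
    rw [mem_typeClass] at hx
    have h4 := clsProb_ge hQ.1 (cnt x) (sum_cnt x) fun b hb => by
      by_contra hne
      obtain ⟨i, hi⟩ := (cnt_pos_iff _ _).1 (Nat.pos_of_ne_zero hne)
      exact hsuppx n x hn hx i (hi ▸ hb)
    have h5 : (fun b => (cnt x b : ℝ) / n) = Qn n := hx
    rw [h5] at h4
    have h6 : clsProb Q (cnt x) n = condMass Q {x : Fin n → X | wordType x = Qn n} := by
      refine (condMass_eq_sum Q fun x' => ?_).symm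
      rw [mem_cls, Set.mem_ofPred_eq]
      refine ⟨fun h => cnt_eq_of_wordType_eq (h.trans hx.symm), fun h => ?_⟩
      rw [← hx]
      funext b
      rw [wordType_eq, wordType_eq, h]
    rw [h6] at h4
    simp only [Function.comp] at h1
    rw [one_mul] at h3
    have hm0 : 0 ≤ condMass Q {x : Fin n → X | wordType x = Qn n} :=
      h6 ▸ clsProb_nonneg hQ.1 _ _
    have h7 : Real.exp (-(n * (ε / 2))) ≤
        Real.exp (n * (ε / 2)) * condMass Q {x : Fin n → X | wordType x = Qn n} := by
      refine le_trans (Real.exp_le_exp.2 ?_)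
        (h4.trans (mul_le_mul_of_nonneg_right h3 hm0))
      have := mul_le_mul_of_nonneg_left h1.le (n.cast_nonneg (α := ℝ))
      linarith
    have h8 : Real.exp (-(n * ε)) = Real.exp (-(n * (ε / 2))) * (Real.exp (n * (ε / 2)))⁻¹ := by
      rw [← Real.exp_neg, ← Real.exp_add]; congr 1; ring
    rw [h8, mul_inv_le_iff₀ (Real.exp_pos _)]
    linarith
  · intro ε hε
    filter_upwards [hclose ε hε] with n hn x hx l
    have hx' : wordType x = Qn n := hx
    rw [hx']
    simpa [mean] using hn.2 (e l)
  · intro ε hε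
    filter_upwards [hclose ε hε] with n hn
    obtain ⟨x, hx⟩ := (hQn n hn.1).1
    rw [mem_typeClass] at hx
    refine ⟨x, hx, fun b => by rw [hx]; exact hn.2 b, hsuppx n x hn.1 hx, fun x' _ hx' => ?_⟩
    have hcnt : ∀ b, cnt x' b = cnt x b := fun b => by
      have h1 := hx' (e.symm b)
      rw [sum_word x' fun c => if c = e (e.symm b) then 1 else 0,
        sum_word x fun c => if c = e (e.symm b) then 1 else 0] at h1
      simp only [Equiv.apply_symm_apply, mul_ite, mul_one, mul_zero, Finset.sum_ite_eq',
        Finset.mem_univ, if_true] at h1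
      have h2 : |((cnt x' b : ℤ) - cnt x b)| < 1 := by exact_mod_cast h1
      have := Int.abs_lt_one_iff.1 h2
      omega
    have : wordType x' = wordType x := by
      funext b
      rw [wordType_eq, wordType_eq, hcnt]
    exact this.trans hx

end Special

end Mismatched

end

theorem theorem2 {X Y : Type*} [Fintype X] [Fintype Y]
    (Q : X → ℝ) (hQ : Q ∈ stdSimplex ℝ X)
    (W : X → Y → ℝ) (hW : Mismatched.IsChannel W)
    (q : X → Y → ℝ) (hq : ∀ x y, 0 ≤ q x y)
    (R : ℝ) (hR : 0 < R)
    -- the number of codewords is `e^{nR}`, rounded up or down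
    (M : ℕ → ℕ) (hM : ∀ n : ℕ, |(M n : ℝ) - Real.exp (n * R)| < 1) :
    -- the minima that define the exponent exist, and the exponent is finite
    (∀ (L : ℕ) (a : Fin L → X → ℝ),
      (∀ P ∈ Mismatched.setScost (Y := Y) Q a, ∃ P' ∈ Mismatched.setTcost Q q a P,
        IsMinOn (Mismatched.objective Q W R P) (Mismatched.setTcost Q q a P) P') ∧
      (∃ P ∈ Mismatched.setScost (Y := Y) Q a, ∃ P' ∈ Mismatched.setTcost Q q a P,
        Mismatched.objective Q W R P P' = Mismatched.expCost Q W q R a) ∧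
      Mismatched.expCost Q W q R a ≠ ⊤) ∧
    -- the cost-constrained ensemble
    (∀ (L : ℕ) (a : Fin L → X → ℝ) (δ : ℝ), 0 < δ →
      ((fun n : ℕ => (n : ℝ) ^ (-((Mismatched.costCov Q a).rank : ℝ) / 2))
        =O[atTop] fun n : ℕ => Mismatched.costMass Q a δ n) →
      Mismatched.HasExponent
        (fun n => Mismatched.avgErrProb W q (M n) (Mismatched.costDist Q a δ (n := n)))
        (Mismatched.expCost Q W q R a)) ∧
    -- the i.i.d. ensemble (no costs)
    (∀ a : Fin 0 → X → ℝ, Mismatched.expCost Q W q R a = Mismatched.expIid Q W q R) ∧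
    Mismatched.HasExponent
      (fun n => Mismatched.avgErrProb W q (M n) (Mismatched.iidDist Q (n := n)))
      (Mismatched.expIid Q W q R) ∧
    -- the constant-composition ensemble (indicator costs)
    (∀ e : Fin (Fintype.card X) ≃ X,
      Mismatched.expCost Q W q R (fun l x => if x = e l then (1 : ℝ) else 0) =
        Mismatched.expCC Q W q R) ∧
    (∀ Qn : ℕ → X → ℝ,
      (∀ n, 1 ≤ n → (Mismatched.typeClass (Qn n) n).Nonempty ∧
        (∀ x, |Qn n x - Q x| ≤ 1 / (n : ℝ)) ∧ ∀ x, Q x = 0 → Qn n x = 0) →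
      Mismatched.HasExponent
        (fun n => Mismatched.avgErrProb W q (M n) (Mismatched.ccDist (Qn n) (n := n)))
        (Mismatched.expCC Q W q R)) := by
  refine ⟨fun L a => ⟨fun P hP => Mismatched.exists_isMinOn_setTcost Q W q R a hP,
    Mismatched.expCost_attained hQ hW q hR a⟩, fun L a δ hδ hO => ?_,
    Mismatched.expCost_eq_expIid Q W q R, ?_, Mismatched.expCost_eq_expCC Q W q R,
    fun Qn hQn => ?_⟩
  · exact (Mismatched.isEnsemble_costSet hQ a hδ hO).hasExponent hQ hW hq hR hM
  · let a : Fin 0 → X → ℝ := fun l => l.elim0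
    have h := (Mismatched.isEnsemble_costSet hQ a one_pos
      (Mismatched.isBigO_costMass_fin_zero hQ a 1)).hasExponent hQ hW hq hR hM
    rw [Mismatched.expCost_eq_expIid] at h
    simp only [← Mismatched.costDist_eq_condDist, Mismatched.costDist_fin_zero hQ] at h
    exact h
  · let e : Fin (Fintype.card X) ≃ X := (Fintype.equivFin X).symm
    have h := (Mismatched.isEnsemble_typeClass hQ e hQn).hasExponent hQ hW hq hR hM
    rw [Mismatched.expCost_eq_expCC] at h
    -- The hypotheses on `Qn` start at `n = 1`, so the two codeword distributions are identified
    -- only eventually, which suffices for the exponent.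
    have heq : ∀ᶠ n : ℕ in atTop, Mismatched.avgErrProb W q (M n)
        (Mismatched.condDist Q {x : Fin n → X | Mismatched.wordType x = Qn n}) =
        Mismatched.avgErrProb W q (M n) (Mismatched.ccDist (Qn n) (n := n)) := by
      filter_upwards [eventually_gt_atTop 0] with n hn
      rw [Mismatched.ccDist_eq_condDist (hQn n hn).2.2]
    refine ⟨?_, ?_⟩
    · filter_upwards [h.1, heq] with n h1 h2
      rwa [← h2]
    · refine h.2.congr' ?_
      filter_upwards [heq] with n h2
      rw [h2]
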